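/- **Theorem 2 (Bosonic integration).** Fix an integer $M\ge 2$ and a mass $m>0$. On $[0,1]^2$ let $C_j(x,y)=\int_{I_j}e^{-\alpha m^2-|x-y|^2/(4\alpha)}\,\frac{d\alpha}{\alpha}$ with $I_0=[1,\infty)$ and $I_j=[M^{-2j},M^{-2(j-1)}]$ for $j\ge1$, and let $T_j=C_j(x,x)$. For $t=(t_k)\in[0,1]^{\mathbb N}$ put $C_{\le j}(t)=\sum_{k\le j}t_kC_k$, $T_{\le j}(t)=\sum_{k\le j}t_kT_k$, $$V_{\le j}(t,\sigma)=\mathrm{Tr}\Bigl[3\lambda T_{\le j}(t)^2+2i\sqrt\lambda\,T_{\le j}(t)\,\sigma-\tfrac12\log_2\bigl(1+2i\sqrt\lambda\,C_{\le j}(t)\,\sigma\bigr)\Bigr],\qquad \log_2(1+x)=\log(1+x)-x,$$ and $V_j=V_{\le j}-V_{\le j-1}$ (with $V_{\le -1}=0$). Here $\sigma$ is a real field on $[0,1]^2$, acting by multiplication in the operator $C\sigma$ on $L^2([0,1]^2)$; $\mathrm{Tr}$ is $\int_{[0,1]^2}dx$ for functions and the operator trace for operators. Let $\mathcal B$ be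 a finite set of vertices with a tree $\mathcal T$ on it, let $w_\ell\in[0,1]$ for every edge $\ell$ of $\mathcal T$, let $X_{ab}(w)$ be the infimum of the $w_\ell$ over the path from $a$ to $b$ in $\mathcal T$ (and $X_{aa}=1$), and let $d\nu_{\mathcal B}$ be the centered Gaussian measure of the fields $(\sigma_a)_{a\in\mathcal B}$ with covariance $X_{ab}(w)\,\delta(x-y)$. Let $(J_a)_{a\in\mathcal B}$ be pairwise disjoint finite sets of scales $j\ge 0$, and $J(\mathcal B)=\bigcup_aJ_a$. The values $V_j(t,\sigma_a)$ at the white noises $\sigma_a$ exist as limits in probability along the expansion of $\sigma_a$ in any orthonormal basis of $L^2([0,1]^2)$ made of continuous functions (the limit does not depend on the basis). There are $\rho_0>0$ and $K>0$, depending only on $M$ and $m$, such that for all $0<\rho\le\rho_0$, all $\lambda$ in the cardioid $|\lambda|<\rho\cos^2(\tfrac12\mathrm{Arg}\,\lambda)$, all $\mathcal B$, $\mathcal T$, $w$, $(J_a)$ as above and all interpolation parameters $t=t^{(j)}\in[0,1]^{\mathbb N}$ in $V_j$ (they may differ from one $j$ to another), $$\Bigl(\int d\nu_{\mathcal B}\prod_{a\in\mathcal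 B}\prod_{j\in J_a}\bigl|e^{V_j(\sigma_a)}\bigr|^2\Bigr)^{1/2}\le \exp\Bigl(K\rho\,\max\bigl(1,\textstyle\sum_{j\in J(\mathcal B)}j\bigr)\Bigr)$$ and $$\Bigl(\int d\nu_{\mathcal B}\,e^{2\sum_{a\in\mathcal B}\sum_{j\in J_a}|V_j(\sigma_a)|}\Bigr)^{1/2}\le \exp\Bigl(K\sqrt\rho\,\max\bigl(1,\textstyle\sum_{j\in J(\mathcal B)}j\bigr)\Bigr),$$ both integrands being integrable. (The maximum equals $\sum_{j\in J(\mathcal B)} j$ unless $J(\mathcal B)\subseteq\{0\}$.) -/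

import Mathlib

open MeasureTheory ProbabilityTheory Filter

noncomputable section

namespace PhiFour

/-! ### The unit square and the sliced propagator -/

/-- The unit square `[0,1]²`, with Lebesgue measure. -/
abbrev Sq : Type := unitInterval × unitInterval

/-- The squared Euclidean distance `(x - y)²` on the unit square. -/
def sqDist (x y : Sq) : ℝ :=
  ((x.1 : ℝ) - (y.1 : ℝ)) ^ 2 + ((x.2 : ℝ) - (y.2 : ℝ)) ^ 2

/-- The range of the parameter `α` in slice `j`: `[1, ∞)` for `j = 0`, and
`[M^(-2j), M^(-2(j-1))]` for `j ≥ 1`. -/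
def sliceRange (M j : ℕ) : Set ℝ :=
  if j = 0 then Set.Ici 1
  else Set.Icc ((M : ℝ) ^ (-2 * (j : ℤ))) ((M : ℝ) ^ (-2 * ((j : ℤ) - 1)))

/-- The slice `C_j(x, y)` of the propagator of mass `m`. -/
def sliceProp (M : ℕ) (m : ℝ) (j : ℕ) (x y : Sq) : ℝ :=
  ∫ α in sliceRange M j, Real.exp (-α * m ^ 2 - sqDist x y / (4 * α)) / α

/-- `∑_{k < N} t_k C_k(x, y)`. For `N = j + 1` this is `C_{≤ j}(t)(x, y)`. -/
def cutProp (M : ℕ) (m : ℝ) (t : ℕ → ℝ) (N : ℕ) (x y : Sq) : ℝ :=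
  ∑ k ∈ Finset.range N, t k * sliceProp M m k x y

/-- The tadpole `∑_{k < N} t_k T_k`, where `T_k = C_k(x, x)` does not depend on `x`.
For `N = j + 1` this is `T_{≤ j}(t)`. -/
def cutTadpole (M : ℕ) (m : ℝ) (t : ℕ → ℝ) (N : ℕ) : ℝ :=
  cutProp M m t N 0 0

/-! ### Operators on `L²([0,1]²)` -/

/-- The complex Hilbert space `L²([0,1]²)`. -/
abbrev H : Type := Lp ℂ 2 (volume : Measure Sq)

theorem continuous_integral_kernel {k : Sq → Sq → ℂ} (hk : Continuous (Function.uncurry k))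
    (f : H) : Continuous fun x => ∫ y, k x y * f y := by
  obtain ⟨B, hB⟩ := (isCompact_range hk).isBounded.exists_norm_le
  have hf : Integrable (fun y => (f y : ℂ)) := (Lp.memLp f).integrable (by norm_num)
  refine continuous_of_dominated (bound := fun y => B * ‖f y‖) (fun x => ?_) (fun x => ?_) ?_ ?_
  · exact ((hk.comp (Continuous.prodMk_right x)).aestronglyMeasurable).mul
      hf.aestronglyMeasurable
  · refine Eventually.of_forall fun y => ?_
    rw [norm_mul]
    exact mul_le_mul_of_nonneg_right (hB _ ⟨(x, y), rfl⟩) (norm_nonneg _)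
  · exact hf.norm.const_mul B
  · exact Eventually.of_forall fun y =>
      (hk.comp (Continuous.prodMk_left y)).mul continuous_const

theorem integrable_kernel_mul {k : Sq → Sq → ℂ} (hk : Continuous (Function.uncurry k))
    (x : Sq) (f : H) : Integrable fun y => k x y * f y := by
  obtain ⟨B, hB⟩ := (isCompact_range hk).isBounded.exists_norm_le
  exact ((Lp.memLp f).integrable (by norm_num)).bdd_mul
    (hk.comp (Continuous.prodMk_right x)).aestronglyMeasurable
    (Eventually.of_forall fun y => hB _ ⟨(x, y), rfl⟩)

/-- `f ↦ ∫ k(·, y) f(y) dy`, as a linear map from `L²` to `L²`. -/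
def kernelLinearMap (k : Sq → Sq → ℂ) (hk : Continuous (Function.uncurry k)) : H →ₗ[ℂ] H where
  toFun f := ContinuousMap.toLp 2 volume ℂ
    (⟨fun x => ∫ y, k x y * f y, continuous_integral_kernel hk f⟩ : C(Sq, ℂ))
  map_add' f g := by
    rw [← map_add]
    congr 1
    ext x
    simp only [ContinuousMap.coe_mk, ContinuousMap.add_apply]
    rw [← integral_add (integrable_kernel_mul hk x f) (integrable_kernel_mul hk x g)]
    refine integral_congr_ae ?_
    filter_upwards [Lp.coeFn_add f g] with y hy
    rw [hy, Pi.add_apply, mul_add]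
  map_smul' c f := by
    rw [RingHom.id_apply, ← map_smul]
    congr 1
    ext x
    simp only [ContinuousMap.coe_mk, ContinuousMap.smul_apply, smul_eq_mul]
    rw [← integral_const_mul]
    refine integral_congr_ae ?_
    filter_upwards [Lp.coeFn_smul c f] with y hy
    rw [hy, Pi.smul_apply, smul_eq_mul]
    ring

theorem kernelLinearMap_bound (k : Sq → Sq → ℂ) (hk : Continuous (Function.uncurry k)) :
    ∃ B : ℝ, ∀ f : H, ‖kernelLinearMap k hk f‖ ≤ B * ‖f‖ := by
  obtain ⟨B, hB⟩ := (isCompact_range hk).isBounded.exists_norm_le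
  have hB0 : 0 ≤ B := (norm_nonneg _).trans (hB _ ⟨(0, 0), rfl⟩)
  refine ⟨‖(ContinuousMap.toLp 2 volume ℂ : C(Sq, ℂ) →L[ℂ] H)‖ * B, fun f => ?_⟩
  refine (ContinuousLinearMap.le_opNorm (ContinuousMap.toLp 2 volume ℂ : C(Sq, ℂ) →L[ℂ] H) _).trans ?_
  rw [mul_assoc]
  refine mul_le_mul_of_nonneg_left ?_ (norm_nonneg _)
  have hf1 : Integrable (fun y => (f y : ℂ)) := (Lp.memLp f).integrable (by norm_num)
  have hL1 : ∫ y, ‖f y‖ ≤ ‖f‖ := by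
    rw [integral_norm_eq_lintegral_enorm hf1.aestronglyMeasurable, Lp.norm_def,
      ← eLpNorm_one_eq_lintegral_enorm]
    exact ENNReal.toReal_mono (Lp.eLpNorm_ne_top f)
      (eLpNorm_le_eLpNorm_of_exponent_le (by norm_num) hf1.aestronglyMeasurable)
  rw [ContinuousMap.norm_le _ (by positivity)]
  intro x
  refine (norm_integral_le_of_norm_le (hf1.norm.const_mul B) ?_).trans ?_
  · refine Eventually.of_forall fun y => ?_
    rw [norm_mul]
    exact mul_le_mul_of_nonneg_right (hB _ ⟨(x, y), rfl⟩) (norm_nonneg _)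
  · rw [integral_const_mul]
    exact mul_le_mul_of_nonneg_left hL1 hB0

open Classical in
/-- The integral operator on `L²([0,1]²)` with continuous kernel `k`. -/
def kernelOp (k : Sq → Sq → ℂ) : H →L[ℂ] H :=
  if hk : Continuous (Function.uncurry k) then
    (kernelLinearMap k hk).mkContinuousOfExistsBound (kernelLinearMap_bound k hk)
  else 0

/-- The trace `∑ ⟨e, A e⟩` over an orthonormal basis of `L²([0,1]²)`; on trace class operators,
the only ones it is applied to, the value does not depend on the basis. -/
def opTrace (A : H →L[ℂ] H) : ℂ :=
  ∑' e : (exists_hilbertBasis ℂ H).choose, inner ℂ (e : H) (A (e : H))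

/-- The operator `log₂ (1 + X) = log (1 + X) - X = ∫₀¹ ((1 + s X)⁻¹ - 1) X ds`
(principal branch). For small `X` it is the sum of the series `-∑_{k ≥ 2} (-X)^k / k`. -/
def opLog2 (X : H →L[ℂ] H) : H →L[ℂ] H :=
  ∫ s in (0 : ℝ)..1, (Ring.inverse (1 + (s : ℂ) • X) - 1) * X

/-! ### The interaction in terms of the intermediate field -/

/-- The principal square root of the coupling constant. -/
def sqrtC (lam : ℂ) : ℂ := lam ^ (1 / 2 : ℂ)

/-- The operator `2 i √λ C(t) σ`, where `C(t) = ∑_{k < N} t_k C_k` and the field `σ` acts by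
multiplication. -/
def fieldOp (M : ℕ) (m : ℝ) (lam : ℂ) (t : ℕ → ℝ) (N : ℕ) (σ : C(Sq, ℝ)) : H →L[ℂ] H :=
  (2 * Complex.I * sqrtC lam) • kernelOp fun x y => ((cutProp M m t N x y * σ y : ℝ) : ℂ)

/-- `Tr (3 λ T² + 2 i √λ T σ - (1/2) log₂ (1 + 2 i √λ C σ))`, with `T` and `C` made of the slices
`k < N` weighted by `t_k`. For `N = j + 1` this is `V_{≤ j}(t, σ)`; for `N = 0` it is `0`. -/
def cutV (M : ℕ) (m : ℝ) (lam : ℂ) (t : ℕ → ℝ) (N : ℕ) (σ : C(Sq, ℝ)) : ℂ :=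
  (∫ x : Sq, (3 * lam * (cutTadpole M m t N : ℂ) ^ 2
      + 2 * Complex.I * sqrtC lam * (cutTadpole M m t N : ℂ) * ((σ x : ℝ) : ℂ)))
    - (1 / 2) * opTrace (opLog2 (fieldOp M m lam t N σ))

/-- The part `V_j = V_{≤ j} - V_{≤ j-1}` of the interaction attributed to slice `j`. -/
def sliceV (M : ℕ) (m : ℝ) (lam : ℂ) (t : ℕ → ℝ) (j : ℕ) (σ : C(Sq, ℝ)) : ℂ :=
  cutV M m lam t (j + 1) σ - cutV M m lam t j σ

/-- The cardioid `|λ| < ρ cos² (Arg λ / 2)`. -/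
def cardioid (ρ : ℝ) : Set ℂ :=
  {lam | ‖lam‖ < ρ * Real.cos (lam.arg / 2) ^ 2}

/-! ### The interpolated covariance of the forest formula -/

open Classical in
/-- `X_{ab}(w)`: the infimum of the parameters `w` over the edges of the path from `a` to `b` in the
forest `F`; it is `1` if `a = b`, and `0` if `a` and `b` are not connected. -/
def forestCov {n : ℕ} (F : SimpleGraph (Fin n)) (w : Sym2 (Fin n) → ℝ) (a b : Fin n) : ℝ :=
  if h : ∃ p : F.Walk a b, p.IsPath then (h.choose.edges.map w).foldr min 1 else 0

/-! ### The Gaussian measure -/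

/-- The family of random fields `σ_a` on the unit square is centered, jointly Gaussian, with
covariance `X_{ab} δ(x - y)`; `σ a f` stands for `∫ σ_a(x) f(x) dx`. -/
structure IsWhiteNoise {Ω : Type*} [MeasurableSpace Ω] (P : Measure Ω) {n : ℕ}
    (X : Fin n → Fin n → ℝ) (σ : Fin n → C(Sq, ℝ) → Ω → ℝ) : Prop where
  gaussian : IsGaussianProcess (fun (p : Fin n × C(Sq, ℝ)) (ω : Ω) => σ p.1 p.2 ω) P
  centered : ∀ a f, ∫ ω, σ a f ω ∂P = 0
  covariance : ∀ a b f g, ∫ ω, σ a f ω * σ b g ω ∂P = X a b * ∫ x : Sq, f x * g x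

/-- An orthonormal basis of the real space `L²([0,1]²)` made of continuous functions. -/
def IsContinuousBasis (e : ℕ → C(Sq, ℝ)) : Prop :=
  let v : ℕ → Lp ℝ 2 (volume : Measure Sq) := fun i => ContinuousMap.toLp 2 volume ℝ (e i)
  Orthonormal ℝ v ∧ (Submodule.span ℝ (Set.range v)).topologicalClosure = ⊤

/-- The random variable `Y` is the value `F(σ)` of the functional `F` at the white noise `σ`: for
every orthonormal basis `(e_i)` of continuous functions, it is the limit in probability of
`F(σ^N)`, where `σ^N = ∑_{i < N} σ(e_i) e_i`. -/
def IsValueAt {Ω : Type*} [MeasurableSpace Ω] (P : Measure Ω)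
    (F : C(Sq, ℝ) → ℂ) (σ : C(Sq, ℝ) → Ω → ℝ) (Y : Ω → ℂ) : Prop :=
  AEStronglyMeasurable Y P ∧
    ∀ e : ℕ → C(Sq, ℝ), IsContinuousBasis e →
      TendstoInMeasure P (fun N ω => F (∑ i ∈ Finset.range N, σ (e i) ω • e i)) atTop Y

end PhiFour

end

/-! A centered Gaussian in `|x - y|` is a characteristic function, so each slice is `C_j(x, y) = ∫
exp (i ξ · (x - y)) dμ_j(ξ)` with `μ_j` a finite measure of mass `T_j`
(`fourierKernel_sliceMeasure`). An operator `A` with spectral measure `μ` is then a superposition of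
rank one operators on plane waves `φ_ξ` of norm at most `1`, and `Tr (W A V)` is the integral of
`⟨φ_ξ, V W φ_ξ⟩` against `μ` (`opTrace_mul_mixture`). Traces thus become integrals against finite
measures.

Let `A = T²`, let `S` be the multiplication by `σ`, `g = 2 i √λ` and `c = cos (Arg λ / 2)`. Then `Tr
log₂ (1 + g A S) = -g² ∫₀¹ s Tr (S G_s S A) ds`, where `G_s = T (1 + s g T S T)⁻¹ T` is the dressed
propagator. As `T S T` is self-adjoint and `|1 + g x| ≥ c` for real `x`, the resolvent is bounded by
`1 / c` whatever the field. Adding slice `j` to the propagator changes the trace by at most `4 |g|²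
c⁻²` times a quadratic form in `σ`, which is dominated by the form `Q_j` of kernel `C_j C_{≤ j}`
(`norm_mixTrace_dressed_sub_propagator`). Since `|g|² = 4 |λ|`, the cardioid is exactly the
condition that makes this `O(ρ Q_j)`. Hence `V_j` is an explicit linear functional of `σ`, of size
`√ρ`, up to `O(ρ (j + 1) + ρ Q_j)` (`norm_sliceV_sub_linear_le`).

The form `Q_j` has trace `O(j + 1)`, and operator norm `O((j + 1) 4^(-j))` by the Schur test. For a
standard Gaussian vector, `E exp (ε Q) ≤ exp (2 ε Tr Q)` as soon as `ε ‖Q‖ ≤ 1/4`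
(`lintegral_exp_quadratic_le`). The linear part is a centered Gaussian of variance `O(ρ)`, hence the
rate `ρ` for `|exp V_j|`; its absolute value only gives `√ρ`.

The vertices and scales are decoupled by Hölder's inequality, so that only the marginal law of each
`σ_a` enters. The weight of the scale `j` is `θ_j = 1 / (2 |U|) + 2^(-j) / 4`, where `U` is the set
of all scales. The bound `θ_j⁻¹ ≤ 4 · 2^j` is beaten by the decay of `‖Q_j‖`. The bound `θ_j⁻¹ ≤ 2
|U|` makes the variances of the linear parts sum to `O(ρ |U|²)`, and `|U|² = O(max (1, ∑ j))`
because the scales are distinct.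

All of this is proved for truncated noises, uniformly in the truncation. It passes to the limit by
Fatou's lemma: `V_j` is locally Lipschitz in the norm of `σ̂` in `L²(κ)`, for a finite measure `κ`,
and the truncations of the white noise converge in that norm in quadratic mean
(`IsStdWhiteNoise.exists_isValueAt`). -/

noncomputable section

set_option linter.unusedSectionVars false

open scoped ComplexConjugate

namespace PhiFour

/-! ### Traces of superpositions of rank one operators -/

section Mixture

variable {E Z : Type*} [NormedAddCommGroup E] [InnerProductSpace ℂ E] [CompleteSpace E]
  [MeasurableSpace Z]

/-- `A` is the superposition `∫ |φ_z⟩⟨φ_z| dμ(z)` of rank one operators. -/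
def IsMixture (φ : Z → E) (μ : Measure Z) (A : E →L[ℂ] E) : Prop :=
  ∀ u v : E, inner ℂ u (A v) = ∫ z, inner ℂ u (φ z) * inner ℂ (φ z) v ∂μ

/-- The trace `∫ ⟨φ_z, W φ_z⟩ dμ(z)` of the product of `W` with `∫ |φ_z⟩⟨φ_z| dμ(z)`. -/
def mixTrace (φ : Z → E) (μ : Measure Z) (W : E →L[ℂ] E) : ℂ :=
  ∫ z, inner ℂ (φ z) (W (φ z)) ∂μ

variable {φ : Z → E} {μ ν : Measure Z} {A B C : E →L[ℂ] E}

theorem norm_inner_apply_le (hb : ∀ z, ‖φ z‖ ≤ 1) (W : E →L[ℂ] E) (z w : Z) :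
    ‖inner ℂ (φ z) (W (φ w))‖ ≤ ‖W‖ := by
  refine (norm_inner_le_norm _ _).trans ?_
  have h1 := W.le_opNorm (φ w)
  have h2 : ‖W‖ * ‖φ w‖ ≤ ‖W‖ := mul_le_of_le_one_right (norm_nonneg _) (hb w)
  calc ‖φ z‖ * ‖W (φ w)‖ ≤ 1 * ‖W‖ := by
        gcongr
        · exact hb z
        · exact h1.trans h2
    _ = ‖W‖ := one_mul _

theorem stronglyMeasurable_inner_apply (hφ : StronglyMeasurable φ) (W : E →L[ℂ] E) :
    StronglyMeasurable fun z => inner ℂ (φ z) (W (φ z)) :=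
  hφ.inner (W.continuous.comp_stronglyMeasurable hφ)

theorem integrable_inner_apply [IsFiniteMeasure μ] (hφ : StronglyMeasurable φ)
    (hb : ∀ z, ‖φ z‖ ≤ 1) (W : E →L[ℂ] E) :
    Integrable (fun z => inner ℂ (φ z) (W (φ z))) μ :=
  Integrable.of_bound (stronglyMeasurable_inner_apply hφ W).aestronglyMeasurable ‖W‖
    (Eventually.of_forall fun z => norm_inner_apply_le hb W z z)

theorem mixTrace_add [IsFiniteMeasure μ] (hφ : StronglyMeasurable φ)
    (hb : ∀ z, ‖φ z‖ ≤ 1) (W V : E →L[ℂ] E) :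
    mixTrace φ μ (W + V) = mixTrace φ μ W + mixTrace φ μ V := by
  rw [mixTrace, mixTrace, mixTrace, ← integral_add (integrable_inner_apply hφ hb W)
    (integrable_inner_apply hφ hb V)]
  simp

theorem mixTrace_smul (c : ℂ) (W : E →L[ℂ] E) :
    mixTrace φ μ (c • W) = c * mixTrace φ μ W := by
  simp [mixTrace, integral_const_mul]

theorem mixTrace_sub [IsFiniteMeasure μ] (hφ : StronglyMeasurable φ)
    (hb : ∀ z, ‖φ z‖ ≤ 1) (W V : E →L[ℂ] E) :
    mixTrace φ μ (W - V) = mixTrace φ μ W - mixTrace φ μ V := by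
  rw [mixTrace, mixTrace, mixTrace, ← integral_sub (integrable_inner_apply hφ hb W)
    (integrable_inner_apply hφ hb V)]
  simp

theorem mixTrace_add_measure [IsFiniteMeasure μ] [IsFiniteMeasure ν] (hφ : StronglyMeasurable φ)
    (hb : ∀ z, ‖φ z‖ ≤ 1) (W : E →L[ℂ] E) :
    mixTrace φ (μ + ν) W = mixTrace φ μ W + mixTrace φ ν W :=
  integral_add_measure (integrable_inner_apply hφ hb W) (integrable_inner_apply hφ hb W)

theorem norm_mixTrace_le [IsFiniteMeasure μ] (hb : ∀ z, ‖φ z‖ ≤ 1) (W : E →L[ℂ] E) :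
    ‖mixTrace φ μ W‖ ≤ μ.real Set.univ * ‖W‖ := by
  rw [mul_comm]
  exact norm_integral_le_of_norm_le_const
    (Eventually.of_forall fun z => norm_inner_apply_le hb W z z)

/-- `mixTrace` as a continuous linear functional. -/
def mixTraceL (φ : Z → E) (μ : Measure Z) [IsFiniteMeasure μ] (hφ : StronglyMeasurable φ)
    (hb : ∀ z, ‖φ z‖ ≤ 1) : (E →L[ℂ] E) →L[ℂ] ℂ :=
  LinearMap.mkContinuous
    { toFun := mixTrace φ μ
      map_add' := mixTrace_add hφ hb
      map_smul' := mixTrace_smul } (μ.real Set.univ) (norm_mixTrace_le hb)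

theorem mixTraceL_apply [IsFiniteMeasure μ] (hφ : StronglyMeasurable φ)
    (hb : ∀ z, ‖φ z‖ ≤ 1) (W : E →L[ℂ] E) : mixTraceL φ μ hφ hb W = mixTrace φ μ W := rfl

open ContinuousLinearMap in
-- Both sides are the double integral of `⟨φ_z, W φ_w⟩ ⟨φ_w, V φ_z⟩`, in the two orders. The
-- integrand is bounded and the measures are finite, so Fubini applies. This cyclicity exchanges the
-- roles of the two measures.
theorem IsMixture.mixTrace_cyclic [IsFiniteMeasure μ] [IsFiniteMeasure ν]
    (hφ : StronglyMeasurable φ) (hb : ∀ z, ‖φ z‖ ≤ 1)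
    (hA : IsMixture φ μ A) (hC : IsMixture φ ν C) (W V : E →L[ℂ] E) :
    mixTrace φ μ (W * C * V) = mixTrace φ ν (V * A * W) := by
  have key : ∀ (W V : E →L[ℂ] E) (z w : Z),
      inner ℂ (adjoint W (φ z)) (φ w) * inner ℂ (φ w) (V (φ z))
        = inner ℂ (φ z) (W (φ w)) * inner ℂ (φ w) (V (φ z)) := fun W V z w => by
    rw [adjoint_inner_left]
  simp only [mixTrace, mul_apply_eq_comp]
  calc ∫ z, inner ℂ (φ z) (W (C (V (φ z)))) ∂μ
      = ∫ z, ∫ w, inner ℂ (φ z) (W (φ w)) * inner ℂ (φ w) (V (φ z)) ∂ν ∂μ := by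
        refine integral_congr_ae (Eventually.of_forall fun z => ?_)
        beta_reduce
        rw [← adjoint_inner_left W, hC]
        exact integral_congr_ae (Eventually.of_forall fun w => key W V z w)
    _ = ∫ w, ∫ z, inner ℂ (φ z) (W (φ w)) * inner ℂ (φ w) (V (φ z)) ∂μ ∂ν := by
        refine integral_integral_swap (Integrable.of_bound ?_ (‖W‖ * ‖V‖)
          (Eventually.of_forall fun p => ?_))
        · have h1 : StronglyMeasurable fun p : Z × Z => φ p.1 :=
            hφ.comp_measurable measurable_fst
          have h2 : StronglyMeasurable fun p : Z × Z => φ p.2 :=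
            hφ.comp_measurable measurable_snd
          exact ((h1.inner (W.continuous.comp_stronglyMeasurable h2)).mul
            (h2.inner (V.continuous.comp_stronglyMeasurable h1))).aestronglyMeasurable
        · simp only [Function.uncurry, norm_mul]
          exact mul_le_mul (norm_inner_apply_le hb W _ _) (norm_inner_apply_le hb V _ _)
            (norm_nonneg _) (norm_nonneg _)
    _ = ∫ w, inner ℂ (φ w) (V (A (W (φ w)))) ∂ν := by
        refine integral_congr_ae (Eventually.of_forall fun w => ?_)
        beta_reduce
        rw [← adjoint_inner_left V, hA]
        refine integral_congr_ae (Eventually.of_forall fun z => ?_)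
        beta_reduce
        rw [adjoint_inner_left, mul_comm]

open ContinuousLinearMap in
-- At fixed `z` the sum is Parseval's identity. The sum and the integral are exchanged by dominated
-- convergence: a product is at most half the sum of the squares, and these sum to squared norms,
-- again by Parseval.
theorem IsMixture.hasSum_inner [IsFiniteMeasure μ] (hφ : StronglyMeasurable φ)
    (hb : ∀ z, ‖φ z‖ ≤ 1) (hA : IsMixture φ μ A) {ι : Type*} [Countable ι]
    (b : HilbertBasis ι ℂ E) (W V : E →L[ℂ] E) :
    HasSum (fun i => inner ℂ (b i) ((W * A * V) (b i))) (mixTrace φ μ (V * W)) := by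
  have hsq : ∀ v : E, HasSum (fun i => ‖inner ℂ v (b i)‖ ^ 2) (‖v‖ ^ 2) := fun v => by
    have h := (Complex.reCLM.hasSum (b.hasSum_inner_mul_inner v v))
    simp only [Complex.reCLM_apply] at h
    convert h using 1
    · ext i
      rw [← inner_conj_symm (b i) v, Complex.mul_conj, Complex.normSq_eq_norm_sq]
      norm_cast
    · exact (inner_self_eq_norm_sq (𝕜 := ℂ) v).symm
  have hterm : ∀ i, inner ℂ (b i) ((W * A * V) (b i))
      = ∫ z, inner ℂ (adjoint V (φ z)) (b i) * inner ℂ (b i) (W (φ z)) ∂μ := fun i => by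
    simp only [mul_apply_eq_comp]
    rw [← adjoint_inner_left W, hA]
    refine integral_congr_ae (Eventually.of_forall fun z => ?_)
    simp only [adjoint_inner_left]
    ring
  have hlim : ∀ z, HasSum (fun i => inner ℂ (adjoint V (φ z)) (b i) * inner ℂ (b i) (W (φ z)))
      (inner ℂ (φ z) ((V * W) (φ z))) := fun z => by
    rw [mul_apply_eq_comp, ← adjoint_inner_left V]
    exact b.hasSum_inner_mul_inner _ _
  have hbd : ∀ z, HasSum (fun i => (‖inner ℂ (adjoint V (φ z)) (b i)‖ ^ 2
      + ‖inner ℂ (W (φ z)) (b i)‖ ^ 2) / 2)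
      ((‖adjoint V (φ z)‖ ^ 2 + ‖W (φ z)‖ ^ 2) / 2) := fun z =>
    ((hsq _).add (hsq _)).div_const 2
  simp only [hterm]
  have hVm : StronglyMeasurable fun z => adjoint V (φ z) :=
    (adjoint V).continuous.comp_stronglyMeasurable hφ
  have hWm : StronglyMeasurable fun z => W (φ z) := W.continuous.comp_stronglyMeasurable hφ
  refine hasSum_integral_of_dominated_convergence
    (fun i z => (‖inner ℂ (adjoint V (φ z)) (b i)‖ ^ 2
      + ‖inner ℂ (W (φ z)) (b i)‖ ^ 2) / 2)
    (fun i => ?_) (fun i => Eventually.of_forall fun z => ?_)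
    (Eventually.of_forall fun z => (hbd z).summable) ?_ (Eventually.of_forall hlim)
  · exact ((hVm.inner stronglyMeasurable_const).mul
      (stronglyMeasurable_const.inner hWm)).aestronglyMeasurable
  · rw [norm_mul, norm_inner_symm (b i)]
    nlinarith [sq_nonneg (‖inner ℂ (adjoint V (φ z)) (b i)‖ - ‖inner ℂ (W (φ z)) (b i)‖)]
  · simp only [(hbd _).tsum_eq]
    refine Integrable.of_bound (C := (‖adjoint V‖ ^ 2 + ‖W‖ ^ 2) / 2)
      ((((hVm.norm.pow 2).add (hWm.norm.pow 2)).mul_const _).aestronglyMeasurable.congr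
        (Eventually.of_forall fun z => (div_eq_mul_inv _ _).symm))
      (Eventually.of_forall fun z => ?_)
    have h1 : ‖adjoint V (φ z)‖ ≤ ‖adjoint V‖ :=
      ((adjoint V).le_opNorm _).trans (mul_le_of_le_one_right (norm_nonneg _) (hb z))
    have h2 : ‖W (φ z)‖ ≤ ‖W‖ :=
      (W.le_opNorm _).trans (mul_le_of_le_one_right (norm_nonneg _) (hb z))
    rw [Real.norm_of_nonneg (by positivity)]
    gcongr

end Mixture

/-! ### Resolvents of self-adjoint operators and the dressed propagator -/

section Resolvent

variable {E : Type*} [NormedAddCommGroup E] [InnerProductSpace ℂ E] [CompleteSpace E]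

theorem isUnit_one_add_smul {S : E →L[ℂ] E} (hS : IsSelfAdjoint S) {κ : ℂ} {c : ℝ} (hc : 0 < c)
    (hκ : ∀ x : ℝ, c ≤ ‖1 + κ * x‖) : IsUnit (1 + κ • S) := by
  rcases eq_or_ne κ 0 with rfl | h0
  · simp
  have hns : -κ⁻¹ ∉ spectrum ℂ S := fun hmem => by
    have hre := hS.mem_spectrum_eq_re hmem
    have := hκ (-κ⁻¹).re
    rw [← hre, mul_neg, mul_inv_cancel₀ h0, add_neg_cancel, norm_zero] at this
    exact absurd this (not_le.mpr hc)
  rw [spectrum.notMem_iff] at hns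
  have : 1 + κ • S = (-κ) • (algebraMap ℂ (E →L[ℂ] E) (-κ⁻¹) - S) := by
    rw [Algebra.algebraMap_eq_smul_one, smul_sub, smul_smul, neg_mul_neg, mul_inv_cancel₀ h0,
      one_smul, neg_smul, sub_neg_eq_add]
  rw [this]
  exact hns.smul (Units.mk0 _ (neg_ne_zero.mpr h0))

/-- The expectation `⟨v, S v⟩ / ‖v‖²` is a real number `x`, so `⟨v, (1 + κ S) v⟩ = ‖v‖² (1 + κ x)`,
and Cauchy-Schwarz concludes. -/
theorem norm_apply_ge {S : E →L[ℂ] E} (hS : IsSelfAdjoint S) {κ : ℂ} {c : ℝ}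
    (hκ : ∀ x : ℝ, c ≤ ‖1 + κ * x‖) (v : E) : c * ‖v‖ ≤ ‖(1 + κ • S) v‖ := by
  rcases eq_or_ne v 0 with rfl | hv
  · simp
  have hv' : 0 < ‖v‖ := norm_pos_iff.mpr hv
  have hreal : ((inner ℂ v (S v)).re : ℂ) = inner ℂ v (S v) := by
    have h2 := hS.adjoint_eq
    rw [← Complex.conj_eq_iff_re, inner_conj_symm]
    conv_lhs => rw [← h2]
    rw [ContinuousLinearMap.adjoint_inner_left]
  have h1 : inner ℂ v ((1 + κ • S) v)
      = (‖v‖ ^ 2 : ℝ) * (1 + κ * (((inner ℂ v (S v)).re / ‖v‖ ^ 2 : ℝ) : ℂ)) := by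
    have hne : (‖v‖ : ℂ) ≠ 0 := by exact_mod_cast hv'.ne'
    simp only [_root_.add_apply, one_apply_eq_self,
      _root_.smul_apply, inner_add_right, inner_smul_right, inner_self_eq_norm_sq_to_K]
    rw [← hreal]
    push_cast
    rw [Complex.ofReal_re]
    simp only [Complex.coe_algebraMap]
    field_simp
  have h2 : c * ‖v‖ ^ 2 ≤ ‖v‖ * ‖(1 + κ • S) v‖ := by
    refine le_trans ?_ (norm_inner_le_norm (𝕜 := ℂ) v ((1 + κ • S) v))
    rw [h1, norm_mul, Complex.norm_real, Real.norm_of_nonneg (by positivity), mul_comm]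
    exact mul_le_mul_of_nonneg_left (hκ _) (by positivity)
  nlinarith

theorem norm_inverse_le {S : E →L[ℂ] E} (hS : IsSelfAdjoint S) {κ : ℂ} {c : ℝ} (hc : 0 < c)
    (hκ : ∀ x : ℝ, c ≤ ‖1 + κ * x‖) : ‖Ring.inverse (1 + κ • S)‖ ≤ c⁻¹ := by
  refine ContinuousLinearMap.opNorm_le_bound _ (by positivity) fun v => ?_
  have h := norm_apply_ge hS hκ (Ring.inverse (1 + κ • S) v)
  rw [← mul_apply_eq_comp, Ring.mul_inverse_cancel _
    (isUnit_one_add_smul hS hc hκ), one_apply_eq_self] at h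
  rw [inv_mul_eq_div, le_div_iff₀ hc, mul_comm]
  exact h

/-- The propagator `T (1 + T S T)⁻¹ T = (1 + T² S)⁻¹ T²`, where `T²` is the bare propagator and
`S` is the field. -/
def dressed (T S : E →L[ℂ] E) : E →L[ℂ] E := T * Ring.inverse (1 + T * S * T) * T

variable {T S : E →L[ℂ] E}

/-- This identity and its mirror image `dressed_mul` involve `T` only through the propagator `T * T`
and `dressed T S`. The algebra below uses nothing else; the square root itself serves for the norm
estimates. -/
theorem mul_dressed (h : IsUnit (1 + T * S * T)) :
    T * T * S * dressed T S = T * T - dressed T S := by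
  have h1 := Ring.mul_inverse_cancel _ h
  rw [dressed]
  generalize Ring.inverse (1 + T * S * T) = R at *
  have h2 : T * S * T * R = 1 - R := by rw [← h1]; noncomm_ring
  calc T * T * S * (T * R * T) = T * (T * S * T * R) * T := by noncomm_ring
    _ = T * T - T * R * T := by rw [h2]; noncomm_ring

theorem dressed_mul (h : IsUnit (1 + T * S * T)) :
    dressed T S * S * (T * T) = T * T - dressed T S := by
  have h1 := Ring.inverse_mul_cancel _ h
  rw [dressed]
  generalize Ring.inverse (1 + T * S * T) = R at *
  have h2 : R * (T * S * T) = 1 - R := by rw [← h1]; noncomm_ring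
  calc T * R * T * S * (T * T) = T * (R * (T * S * T)) * T := by noncomm_ring
    _ = T * T - T * R * T := by rw [h2]; noncomm_ring

theorem inverse_one_add (h : IsUnit (1 + T * S * T)) :
    Ring.inverse (1 + T * T * S) = 1 - dressed T S * S := by
  refine Ring.inverse_unit ⟨1 + T * T * S, 1 - dressed T S * S, ?_, ?_⟩
  · calc (1 + T * T * S) * (1 - dressed T S * S)
        = 1 + T * T * S - dressed T S * S - (T * T * S * dressed T S) * S := by noncomm_ring
      _ = 1 := by rw [mul_dressed h]; noncomm_ring
  · calc (1 - dressed T S * S) * (1 + T * T * S)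
        = 1 + T * T * S - dressed T S * S - (dressed T S * S * (T * T)) * S := by noncomm_ring
      _ = 1 := by rw [dressed_mul h]; noncomm_ring

/-- The resolvent identity, in both the bare propagator and the field. -/
theorem dressed_sub_dressed {T' S' : E →L[ℂ] E} (h : IsUnit (1 + T * S * T))
    (h' : IsUnit (1 + T' * S' * T')) :
    dressed T S - dressed T' S'
      = (1 - dressed T S * S) * (T * T - T' * T') * (1 - S' * dressed T' S')
        - dressed T S * (S - S') * dressed T' S' := by
  have h1 := dressed_mul h
  have h2 := mul_dressed h'
  generalize dressed T S = G at *
  generalize dressed T' S' = G' at *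
  generalize T * T = A at *
  generalize T' * T' = A' at *
  have e1 : (1 - G * S) * A = G := by rw [sub_mul, h1]; noncomm_ring
  have e2 : A' * (1 - S' * G') = G' := by
    calc A' * (1 - S' * G') = A' - A' * S' * G' := by noncomm_ring
      _ = G' := by rw [h2]; noncomm_ring
  calc G - G' = G * (1 - S' * G') - (1 - G * S) * G' - G * (S - S') * G' := by noncomm_ring
    _ = ((1 - G * S) * A) * (1 - S' * G') - (1 - G * S) * (A' * (1 - S' * G'))
        - G * (S - S') * G' := by rw [e1, e2]
    _ = _ := by noncomm_ring

end Resolvent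

/-! ### Variation of the trace with the propagator and with the field -/

theorem integral_mul_le_sqrt_mul_sqrt {Z : Type*} [MeasurableSpace Z] {μ : Measure Z}
    {f g : Z → ℝ} (hf0 : ∀ z, 0 ≤ f z) (hg0 : ∀ z, 0 ≤ g z) (hf : MemLp f 2 μ)
    (hg : MemLp g 2 μ) :
    ∫ z, f z * g z ∂μ ≤ √(∫ z, f z ^ 2 ∂μ) * √(∫ z, g z ^ 2 ∂μ) := by
  have h := integral_mul_le_Lp_mul_Lq_of_nonneg (μ := μ) (f := f) (g := g)
    Real.HolderConjugate.two_two (Eventually.of_forall hf0) (Eventually.of_forall hg0)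
    (by simpa using hf) (by simpa using hg)
  simpa [Real.sqrt_eq_rpow] using h

section Estimates

variable {E Z : Type*} [NormedAddCommGroup E] [InnerProductSpace ℂ E] [CompleteSpace E]
  [MeasurableSpace Z] {φ : Z → E} {μ ν : Measure Z}

open ContinuousLinearMap in
theorem IsSelfAdjoint.inner_apply {T : E →L[ℂ] E} (hT : IsSelfAdjoint T) (u v : E) :
    inner ℂ (T u) v = inner ℂ u (T v) := by
  conv_lhs => rw [← hT.adjoint_eq]
  rw [adjoint_inner_left]

theorem _root_.IsSelfAdjoint.triple_mul {T S : E →L[ℂ] E} (hT : IsSelfAdjoint T)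
    (hS : IsSelfAdjoint S) : IsSelfAdjoint (T * S * T) := by
  rw [IsSelfAdjoint, star_mul, star_mul, hT.star_eq, hS.star_eq, mul_assoc]

variable {T T' S S' : E →L[ℂ] E} {κ : ℂ} {c : ℝ}

theorem mul_smul_mul_eq (T S : E →L[ℂ] E) (κ : ℂ) : T * (κ • S) * T = κ • (T * S * T) := by
  rw [mul_smul_comm, smul_mul_assoc]

theorem isUnit_field (hT : IsSelfAdjoint T) (hS : IsSelfAdjoint S) (hc : 0 < c)
    (hκ : ∀ x : ℝ, c ≤ ‖1 + κ * x‖) : IsUnit (1 + T * (κ • S) * T) := by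
  rw [mul_smul_mul_eq]
  exact isUnit_one_add_smul (hT.triple_mul hS) hc hκ

theorem norm_inverse_field_le (hT : IsSelfAdjoint T) (hS : IsSelfAdjoint S) (hc : 0 < c)
    (hκ : ∀ x : ℝ, c ≤ ‖1 + κ * x‖) : ‖Ring.inverse (1 + T * (κ • S) * T)‖ ≤ c⁻¹ := by
  rw [mul_smul_mul_eq]
  exact norm_inverse_le (hT.triple_mul hS) hc hκ

/-- The outer factors `T` are kept on the vectors and only the resolvent is estimated in norm. With
`u = v = S φ_z`, the integral over `z` is then a quadratic form in the field. -/
theorem norm_inner_dressed_le (hT : IsSelfAdjoint T) (hS : IsSelfAdjoint S) (hc : 0 < c)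
    (hκ : ∀ x : ℝ, c ≤ ‖1 + κ * x‖) (u v : E) :
    ‖inner ℂ u (dressed T (κ • S) v)‖ ≤ c⁻¹ * (‖T u‖ * ‖T v‖) := by
  have h := norm_inverse_field_le hT hS hc hκ
  rw [dressed, mul_apply_eq_comp, mul_apply_eq_comp, ← IsSelfAdjoint.inner_apply hT]
  refine (norm_inner_le_norm _ _).trans ?_
  calc ‖T u‖ * ‖Ring.inverse (1 + T * (κ • S) * T) (T v)‖ ≤ ‖T u‖ * (c⁻¹ * ‖T v‖) := by
        gcongr
        exact ContinuousLinearMap.le_of_opNorm_le _ h _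
    _ = _ := by ring

/-- With `R` the resolvent, `T (κ S) T R T = (1 - R) T`: the explicit field is absorbed, and the
bound does not grow with it. -/
theorem norm_mul_field_dressed_le (hT : IsSelfAdjoint T) (hS : IsSelfAdjoint S) (hc : 0 < c)
    (hκ : ∀ x : ℝ, c ≤ ‖1 + κ * x‖) (v : E) :
    ‖T ((κ • S) (dressed T (κ • S) v))‖ ≤ (1 + c⁻¹) * ‖T v‖ := by
  have h := norm_inverse_field_le hT hS hc hκ
  have hu := Ring.mul_inverse_cancel _ (isUnit_field hT hS hc hκ)
  have : T ((κ • S) (dressed T (κ • S) v))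
      = T v - Ring.inverse (1 + T * (κ • S) * T) (T v) := by
    rw [dressed]
    generalize Ring.inverse (1 + T * (κ • S) * T) = R at *
    have h2 : T * (κ • S) * T * R = 1 - R := by rw [← hu]; noncomm_ring
    calc T ((κ • S) ((T * R * T) v)) = (T * (κ • S) * T * R) (T v) := rfl
      _ = _ := by rw [h2]; rfl
  rw [this]
  refine (norm_sub_le _ _).trans ?_
  rw [add_mul, one_mul]
  gcongr
  exact ContinuousLinearMap.le_of_opNorm_le _ h _

theorem memLp_apply [IsFiniteMeasure μ] (hφ : StronglyMeasurable φ) (hb : ∀ z, ‖φ z‖ ≤ 1)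
    (W : E →L[ℂ] E) : MemLp (fun z => ‖W (φ z)‖) 2 μ := by
  refine MemLp.of_bound (W.continuous.comp_stronglyMeasurable hφ).norm.aestronglyMeasurable ‖W‖
    (Eventually.of_forall fun z => ?_)
  rw [norm_norm]
  exact (W.le_opNorm _).trans (mul_le_of_le_one_right (norm_nonneg _) (hb z))

theorem norm_mixTrace_le_of_bound [IsFiniteMeasure μ] (hφ : StronglyMeasurable φ)
    (hb : ∀ z, ‖φ z‖ ≤ 1) {W U V : E →L[ℂ] E} {K : ℝ}
    (h : ∀ z, ‖inner ℂ (φ z) (W (φ z))‖ ≤ K * (‖U (φ z)‖ * ‖V (φ z)‖)) (hK : 0 ≤ K) :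
    ‖mixTrace φ μ W‖ ≤ K * (√(∫ z, ‖U (φ z)‖ ^ 2 ∂μ) * √(∫ z, ‖V (φ z)‖ ^ 2 ∂μ)) := by
  have hU := memLp_apply (μ := μ) hφ hb U
  have hV := memLp_apply (μ := μ) hφ hb V
  have hUV : Integrable (fun z => ‖U (φ z)‖ * ‖V (φ z)‖) μ := hU.integrable_mul hV
  refine (norm_integral_le_of_norm_le (hUV.const_mul K) (Eventually.of_forall h)).trans ?_
  rw [integral_const_mul]
  exact mul_le_mul_of_nonneg_left (integral_mul_le_sqrt_mul_sqrt (fun _ => norm_nonneg _)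
    (fun _ => norm_nonneg _) hU hV) hK

theorem norm_mixTrace_le_of_sq [IsFiniteMeasure μ] (hφ : StronglyMeasurable φ)
    (hb : ∀ z, ‖φ z‖ ≤ 1) {W U : E →L[ℂ] E} {K : ℝ}
    (h : ∀ z, ‖inner ℂ (φ z) (W (φ z))‖ ≤ K * ‖U (φ z)‖ ^ 2) :
    ‖mixTrace φ μ W‖ ≤ K * ∫ z, ‖U (φ z)‖ ^ 2 ∂μ := by
  have hU : Integrable (fun z => ‖U (φ z)‖ ^ 2) μ := (memLp_apply hφ hb U).integrable_sq
  refine (norm_integral_le_of_norm_le (hU.const_mul K) (Eventually.of_forall h)).trans_eq ?_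
  rw [integral_const_mul]

theorem le_one_of_forall_le (hκ : ∀ x : ℝ, c ≤ ‖1 + κ * x‖) : c ≤ 1 := by
  simpa using hκ 0

/-- The change of the trace when a mixture over `ν` is added to the propagator. -/
theorem norm_mixTrace_dressed_sub_propagator [IsFiniteMeasure μ] [IsFiniteMeasure ν]
    (hφ : StronglyMeasurable φ) (hb : ∀ z, ‖φ z‖ ≤ 1)
    (hT : IsSelfAdjoint T) (hT' : IsSelfAdjoint T') (hS : IsSelfAdjoint S)
    (hB : IsMixture φ μ (T' * T')) (hC : IsMixture φ ν (T * T - T' * T'))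
    (hle : ∀ v, ‖T' v‖ ≤ ‖T v‖) (hc : 0 < c) (hκ : ∀ x : ℝ, c ≤ ‖1 + κ * x‖) :
    ‖mixTrace φ (μ + ν) (S * dressed T (κ • S) * S) - mixTrace φ μ (S * dressed T' (κ • S) * S)‖
      ≤ 4 * c⁻¹ ^ 2 * ∫ z, ‖T (S (φ z))‖ ^ 2 ∂ν := by
  have hu := isUnit_field hT hS hc hκ
  have hu' := isUnit_field hT' hS hc hκ
  have hc1 : 1 ≤ c⁻¹ := (one_le_inv₀ hc).mpr (le_one_of_forall_le hκ)
  set G := dressed T (κ • S) with hG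
  set G' := dressed T' (κ • S) with hG'
  have hres : G - G' = (1 - G * (κ • S)) * (T * T - T' * T') * (1 - (κ • S) * G') := by
    rw [hG, hG', dressed_sub_dressed hu hu', sub_self]
    noncomm_ring
  -- The resolvent identity contains the increment `T * T - T' * T'`, a mixture over `ν`. Cyclicity
  -- turns the integral over `μ` into one over `ν`, and the operator `T' * T'` that appears is
  -- absorbed into `G'`.
  have h1 : mixTrace φ μ (S * G * S) - mixTrace φ μ (S * G' * S)
      = mixTrace φ ν (S * G' * S - S * (G' * ((κ • S) * G)) * S) := by
    rw [← mixTrace_sub hφ hb]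
    have e1 : S * G * S - S * G' * S
        = (S * (1 - G * (κ • S))) * (T * T - T' * T') * ((1 - (κ • S) * G') * S) := by
      calc _ = S * (G - G') * S := by noncomm_ring
        _ = _ := by rw [hres]; noncomm_ring
    rw [e1, hB.mixTrace_cyclic hφ hb hC]
    congr 1
    have e2 : (1 - (κ • S) * G') * S * (T' * T') = S * G' := by
      have h := dressed_mul hu'
      rw [← hG'] at h
      have : (κ • S) * G' * S = S * (G' * (κ • S)) := by
        simp only [smul_mul_assoc, mul_smul_comm, mul_assoc]
      calc _ = S * (T' * T') - ((κ • S) * G' * S) * (T' * T') := by noncomm_ring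
        _ = S * (T' * T') - S * (G' * (κ • S) * (T' * T')) := by rw [this]; noncomm_ring
        _ = _ := by rw [h]; noncomm_ring
    have e3 : S * (1 - G * (κ • S)) = S - (κ • S) * G * S := by
      simp only [smul_mul_assoc, mul_smul_comm, mul_assoc, mul_sub, mul_one]
    rw [e2, e3]
    noncomm_ring
  rw [mixTrace_add_measure hφ hb, add_sub_right_comm, h1, ← mixTrace_add hφ hb]
  refine norm_mixTrace_le_of_sq (U := T * S) hφ hb fun z => ?_
  have hSz : inner ℂ (φ z) ((S * G' * S - S * (G' * ((κ • S) * G)) * S + S * G * S) (φ z))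
      = inner ℂ (S (φ z)) (G' (S (φ z))) - inner ℂ (S (φ z)) (G' ((κ • S) (G (S (φ z)))))
        + inner ℂ (S (φ z)) (G (S (φ z))) := by
    rw [IsSelfAdjoint.inner_apply hS, IsSelfAdjoint.inner_apply hS, IsSelfAdjoint.inner_apply hS,
      ← inner_sub_right, ← inner_add_right]
    rfl
  rw [hSz, mul_apply_eq_comp]
  set u := S (φ z)
  have b1 : ‖inner ℂ u (G' u)‖ ≤ c⁻¹ * (‖T u‖ * ‖T u‖) :=
    (norm_inner_dressed_le hT' hS hc hκ u u).trans (by gcongr <;> exact hle u)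
  have b2 : ‖inner ℂ u (G u)‖ ≤ c⁻¹ * (‖T u‖ * ‖T u‖) := norm_inner_dressed_le hT hS hc hκ u u
  have b3 : ‖inner ℂ u (G' ((κ • S) (G u)))‖ ≤ c⁻¹ * (‖T u‖ * ((1 + c⁻¹) * ‖T u‖)) := by
    refine (norm_inner_dressed_le hT' hS hc hκ _ _).trans ?_
    gcongr
    · exact hle u
    · exact (hle _).trans (norm_mul_field_dressed_le hT hS hc hκ u)
  -- The three terms contribute `c⁻¹`, `c⁻¹ (1 + c⁻¹)` and `c⁻¹`, in all at most `4 c⁻²` since `1 ≤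
  -- c⁻¹`.
  refine (norm_add_le _ _).trans ((add_le_add (norm_sub_le _ _) le_rfl).trans ?_)
  have hx : 0 ≤ ‖T u‖ * ‖T u‖ := by positivity
  nlinarith [mul_le_mul_of_nonneg_right hc1 hx, mul_le_mul_of_nonneg_right
    (mul_le_mul_of_nonneg_left hc1 (zero_le_one.trans hc1)) hx]

/-- The right-hand side is the Hilbert-Schmidt norm of `T * S * T`: indeed `‖T S T v‖²` is the
integral of `|⟨T S φ_z, v⟩|²`. -/
theorem norm_mul_mul_le [IsFiniteMeasure μ] (hφ : StronglyMeasurable φ) (hb : ∀ z, ‖φ z‖ ≤ 1)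
    (hT : IsSelfAdjoint T) (hS : IsSelfAdjoint S) (hA : IsMixture φ μ (T * T)) :
    ‖T * S * T‖ ≤ √(∫ z, ‖T (S (φ z))‖ ^ 2 ∂μ) := by
  refine ContinuousLinearMap.opNorm_le_bound _ (Real.sqrt_nonneg _) fun v => ?_
  have hint : Integrable (fun z => ‖(T * S) (φ z)‖ ^ 2) μ :=
    (memLp_apply hφ hb (T * S)).integrable_sq
  have h1 : ((‖(T * S * T) v‖ ^ 2 : ℝ) : ℂ)
      = ∫ z, ((‖inner ℂ (φ z) (S (T v))‖ ^ 2 : ℝ) : ℂ) ∂μ := by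
    have e1 : ((‖(T * S * T) v‖ ^ 2 : ℝ) : ℂ) = inner ℂ (S (T v)) ((T * T) (S (T v))) := by
      rw [mul_apply_eq_comp T T, ← IsSelfAdjoint.inner_apply hT, inner_self_eq_norm_sq_to_K]
      push_cast
      rfl
    rw [e1, hA]
    refine integral_congr_ae (Eventually.of_forall fun z => ?_)
    beta_reduce
    rw [← inner_conj_symm, mul_comm, Complex.mul_conj, Complex.normSq_eq_norm_sq]
  rw [integral_complex_ofReal, Complex.ofReal_inj] at h1
  have h2 : ‖(T * S * T) v‖ ^ 2 ≤ (∫ z, ‖T (S (φ z))‖ ^ 2 ∂μ) * ‖v‖ ^ 2 := by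
    rw [h1, ← integral_mul_const]
    refine integral_mono_of_nonneg (Eventually.of_forall fun z => by positivity)
      (hint.mul_const _) (Eventually.of_forall fun z => ?_)
    beta_reduce
    rw [← IsSelfAdjoint.inner_apply hS, ← IsSelfAdjoint.inner_apply hT, ← mul_pow]
    gcongr
    exact norm_inner_le_norm _ _
  refine le_of_sq_le_sq ?_ (by positivity)
  rw [mul_pow, Real.sq_sqrt (integral_nonneg fun z => by positivity)]
  exact h2

/-- The change of the trace when the field is changed. -/
theorem norm_mixTrace_dressed_sub_field [IsFiniteMeasure μ]
    (hφ : StronglyMeasurable φ) (hb : ∀ z, ‖φ z‖ ≤ 1)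
    (hT : IsSelfAdjoint T) (hS : IsSelfAdjoint S) (hS' : IsSelfAdjoint S')
    (hA : IsMixture φ μ (T * T)) (hc : 0 < c) (hκ : ∀ x : ℝ, c ≤ ‖1 + κ * x‖) {N : (E →L[ℂ] E) → ℝ}
    (hN : ∀ U, N U = √(∫ z, ‖T (U (φ z))‖ ^ 2 ∂μ)) :
    ‖mixTrace φ μ (S * dressed T (κ • S) * S) - mixTrace φ μ (S' * dressed T (κ • S') * S')‖
      ≤ c⁻¹ * (N (S - S') * N S) + c⁻¹ * (N S' * N (S - S'))
        + ‖κ‖ * c⁻¹ ^ 2 * N (S - S') * (N S' * N S) := by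
  have hu := isUnit_field hT hS hc hκ
  have hu' := isUnit_field hT hS' hc hκ
  have hD : IsSelfAdjoint (S - S') := hS.sub hS'
  set G := dressed T (κ • S) with hG
  set G' := dressed T (κ • S') with hG'
  have hres : G - G' = -(G * (κ • (S - S')) * G') := by
    rw [hG, hG', dressed_sub_dressed hu hu', sub_self, mul_zero, zero_mul, zero_sub, smul_sub]
  have h1 : S * G * S - S' * G' * S'
      = (S - S') * G * S + S' * G' * (S - S') - S' * (G * (κ • (S - S')) * G') * S := by
    have : S * G * S - S' * G' * S'
      = (S - S') * G * S + S' * G' * (S - S') + S' * (G - G') * S := by noncomm_ring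
    rw [this, hres]
    noncomm_ring
  rw [← mixTrace_sub hφ hb, h1, mixTrace_sub hφ hb, mixTrace_add hφ hb]
  refine (norm_sub_le _ _).trans (add_le_add ((norm_add_le _ _).trans (add_le_add ?_ ?_)) ?_)
  · rw [hN, hN]
    refine norm_mixTrace_le_of_bound (U := T * (S - S')) (V := T * S) hφ hb (fun z => ?_)
      (by positivity)
    rw [mul_apply_eq_comp, mul_apply_eq_comp, ← IsSelfAdjoint.inner_apply hD]
    exact norm_inner_dressed_le hT hS hc hκ _ _
  · rw [hN, hN]
    refine norm_mixTrace_le_of_bound (U := T * S') (V := T * (S - S')) hφ hb (fun z => ?_)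
      (by positivity)
    rw [mul_apply_eq_comp, mul_apply_eq_comp, ← IsSelfAdjoint.inner_apply hS']
    exact norm_inner_dressed_le hT hS' hc hκ _ _
  · rw [hN S, hN S']
    have hN0 : 0 ≤ N (S - S') := by rw [hN]; positivity
    refine norm_mixTrace_le_of_bound (U := T * S') (V := T * S) hφ hb (fun z => ?_)
      (by positivity)
    rw [mul_apply_eq_comp, mul_apply_eq_comp, ← IsSelfAdjoint.inner_apply hS']
    have hb1 := norm_inverse_field_le hT hS hc hκ
    have hb2 := norm_inverse_field_le hT hS' hc hκ
    rw [hG, hG', dressed, dressed]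
    set R := Ring.inverse (1 + T * (κ • S) * T)
    set R' := Ring.inverse (1 + T * (κ • S') * T)
    have e : (T * R * T * (κ • (S - S')) * (T * R' * T))
        = κ • (T * (R * (T * (S - S') * T) * R') * T) := by
      simp only [smul_mul_assoc, mul_smul_comm, mul_assoc]
    rw [e, _root_.smul_apply, inner_smul_right, norm_mul]
    rw [mul_apply_eq_comp, mul_apply_eq_comp, ← IsSelfAdjoint.inner_apply hT]
    -- The change of field sits between two resolvents as `T * (S - S') * T`, whose operator norm is
    -- at most its Hilbert-Schmidt norm `N (S - S')`.
    have hop : ‖R * (T * (S - S') * T) * R'‖ ≤ c⁻¹ * N (S - S') * c⁻¹ := by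
      refine (norm_mul_le _ _).trans (mul_le_mul ((norm_mul_le _ _).trans (mul_le_mul hb1 ?_
        (norm_nonneg _) (by positivity))) hb2 (norm_nonneg _) (by positivity))
      rw [hN]
      exact norm_mul_mul_le hφ hb hT hD hA
    calc _ ≤ ‖κ‖ * (‖T (S' (φ z))‖ * ((c⁻¹ * N (S - S') * c⁻¹) * ‖T (S (φ z))‖)) := by
          gcongr
          refine (norm_inner_le_norm _ _).trans ?_
          gcongr
          exact ContinuousLinearMap.le_of_opNorm_le _ hop _
      _ = _ := by
          rw [mul_apply_eq_comp, mul_apply_eq_comp]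
          ring

end Estimates

/-! ### The trace of `log₂` -/

theorem countable_of_orthonormal {E ι : Type*} [NormedAddCommGroup E] [InnerProductSpace ℂ E]
    [SecondCountableTopology E] {v : ι → E} (hv : Orthonormal ℂ v) : Countable ι := by
  refine Pairwise.countable_of_isOpen_disjoint (s := fun i => Metric.ball (v i) (1 / 2))
    (fun i j hij => ?_) (fun i => Metric.isOpen_ball) fun i => ⟨v i, by simp⟩
  refine Metric.ball_disjoint_ball ?_
  have h := norm_sub_sq (𝕜 := ℂ) (v i) (v j)
  rw [hv.1 i, hv.1 j, hv.2 hij] at h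
  simp only [map_zero, mul_zero, sub_zero, one_pow] at h
  rw [dist_eq_norm]
  nlinarith [norm_nonneg (v i - v j)]

section Log

variable {Z : Type*} [MeasurableSpace Z] {φ : Z → H} {μ : Measure Z} {A : H →L[ℂ] H}

theorem opTrace_mul_mixture [IsFiniteMeasure μ] (hφ : StronglyMeasurable φ)
    (hb : ∀ z, ‖φ z‖ ≤ 1) (hA : IsMixture φ μ A) (W V : H →L[ℂ] H) :
    opTrace (W * A * V) = mixTrace φ μ (V * W) := by
  obtain ⟨b, hbe⟩ := (exists_hilbertBasis ℂ H).choose_spec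
  -- `L²` is separable, so the basis that defines `opTrace` is countable, as the dominated
  -- convergence in `IsMixture.hasSum_inner` requires.
  have : Fact ((2 : ENNReal) ≠ ⊤) := ⟨by norm_num⟩
  have : MeasureTheory.IsSeparable (volume : Measure Sq) := by
    apply @MeasureTheory.instIsSeparableOfCountablyGeneratedOfSFinite
  have : SecondCountableTopology H := Lp.SecondCountableTopology
  have : Countable (exists_hilbertBasis ℂ H).choose := countable_of_orthonormal b.orthonormal
  have h := hA.hasSum_inner hφ hb b W V
  simp only [hbe] at h
  exact h.tsum_eq

variable {T S : H →L[ℂ] H} {g : ℂ} {c : ℝ}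

/-- The lower bound holds at every real `x`, in particular at `s x`: one constant serves for all `s`
in the integral that defines `opLog2`. -/
theorem le_norm_one_add_smul (hg : ∀ x : ℝ, c ≤ ‖1 + g * x‖) (s x : ℝ) :
    c ≤ ‖1 + (s * g) * x‖ := by
  have := hg (s * x)
  push_cast at this
  rwa [mul_comm (s : ℂ) g, mul_assoc]

/-- The operator `T * T * S` is not self-adjoint, but the inverse is explicit in terms of the
dressed propagator, whose resolvent contains the self-adjoint `T * S * T`. -/
theorem isUnit_one_add_smul_mul (hT : IsSelfAdjoint T) (hS : IsSelfAdjoint S) (hc : 0 < c)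
    (hg : ∀ x : ℝ, c ≤ ‖1 + g * x‖) (s : ℝ) : IsUnit (1 + (s : ℂ) • (g • (T * T * S))) := by
  have hu := isUnit_field hT hS hc (le_norm_one_add_smul hg s)
  have e : (s : ℂ) • (g • (T * T * S)) = T * T * (((s : ℂ) * g) • S) := by
    rw [smul_smul, mul_smul_comm]
  rw [e]
  have h1 := mul_dressed hu
  have h2 := dressed_mul hu
  refine ⟨⟨_, 1 - dressed T (((s : ℂ) * g) • S) * (((s : ℂ) * g) • S), ?_, ?_⟩, rfl⟩
  · generalize ((s : ℂ) * g) • S = S' at *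
    calc (1 + T * T * S') * (1 - dressed T S' * S')
        = 1 + T * T * S' - dressed T S' * S' - (T * T * S' * dressed T S') * S' := by noncomm_ring
      _ = 1 := by rw [h1]; noncomm_ring
  · generalize ((s : ℂ) * g) • S = S' at *
    calc (1 - dressed T S' * S') * (1 + T * T * S')
        = 1 + T * T * S' - dressed T S' * S' - (dressed T S' * S' * (T * T)) * S' := by
          noncomm_ring
      _ = 1 := by rw [h2]; noncomm_ring

theorem inverse_sub_one_eq (hT : IsSelfAdjoint T) (hS : IsSelfAdjoint S) (hc : 0 < c)
    (hg : ∀ x : ℝ, c ≤ ‖1 + g * x‖) (s : ℝ) :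
    Ring.inverse (1 + (s : ℂ) • (g • (T * T * S))) - 1
      = -(dressed T (((s : ℂ) * g) • S) * (((s : ℂ) * g) • S)) := by
  have hu := isUnit_field hT hS hc (le_norm_one_add_smul hg s)
  have e : (s : ℂ) • (g • (T * T * S)) = T * T * (((s : ℂ) * g) • S) := by
    rw [smul_smul, mul_smul_comm]
  rw [e, inverse_one_add hu]
  noncomm_ring

theorem continuous_inverse_sub_one (hT : IsSelfAdjoint T) (hS : IsSelfAdjoint S) (hc : 0 < c)
    (hg : ∀ x : ℝ, c ≤ ‖1 + g * x‖) :
    Continuous fun s : ℝ => Ring.inverse (1 + (s : ℂ) • (g • (T * T * S))) - 1 := by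
  refine Continuous.sub (continuous_iff_continuousAt.mpr fun s => ?_) continuous_const
  obtain ⟨u, hu⟩ := isUnit_one_add_smul_mul hT hS hc hg s
  have h1 := NormedRing.inverse_continuousAt u
  rw [hu] at h1
  exact ContinuousAt.comp (f := fun s : ℝ => 1 + (s : ℂ) • (g • (T * T * S))) h1
    (by fun_prop)

/-- The integrand in the formula for the trace of `log₂ (1 + g T² S)`. -/
def logTerm (φ : Z → H) (μ : Measure Z) (T S : H →L[ℂ] H) (g : ℂ) (s : ℝ) : ℂ :=
  s * mixTrace φ μ (S * dressed T (((s : ℂ) * g) • S) * S)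

theorem smul_logTerm [IsFiniteMeasure μ] (hφ : StronglyMeasurable φ) (hb : ∀ z, ‖φ z‖ ≤ 1)
    (hT : IsSelfAdjoint T) (hS : IsSelfAdjoint S)
    (hc : 0 < c) (hg : ∀ x : ℝ, c ≤ ‖1 + g * x‖) (s : ℝ) :
    mixTraceL φ μ hφ hb (g • S * (Ring.inverse (1 + (s : ℂ) • (g • (T * T * S))) - 1))
      = -g ^ 2 * logTerm φ μ T S g s := by
  rw [inverse_sub_one_eq hT hS hc hg, mixTraceL_apply, logTerm]
  have : g • S * -(dressed T (((s : ℂ) * g) • S) * (((s : ℂ) * g) • S))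
      = (-(s * g ^ 2)) • (S * dressed T (((s : ℂ) * g) • S) * S) := by
    rw [mul_neg, mul_smul_comm, smul_mul_assoc, mul_smul_comm, smul_smul, neg_smul, mul_assoc]
    ring_nf
  rw [this, mixTrace_smul]
  ring

theorem intervalIntegrable_logTerm [IsFiniteMeasure μ] (hφ : StronglyMeasurable φ)
    (hb : ∀ z, ‖φ z‖ ≤ 1) (hT : IsSelfAdjoint T) (hS : IsSelfAdjoint S)
    (hc : 0 < c) (hg : ∀ x : ℝ, c ≤ ‖1 + g * x‖) (a b : ℝ) :
    IntervalIntegrable (fun s => g ^ 2 * logTerm φ μ T S g s) volume a b := by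
  refine Continuous.intervalIntegrable ?_ a b
  have h : (fun s => g ^ 2 * logTerm φ μ T S g s) = fun s : ℝ => -mixTraceL φ μ hφ hb
      (g • S * (Ring.inverse (1 + (s : ℂ) • (g • (T * T * S))) - 1)) := by
    ext s
    rw [smul_logTerm hφ hb hT hS hc hg]
    ring
  rw [h]
  exact ((mixTraceL φ μ hφ hb).continuous.comp
    (continuous_const.mul (continuous_inverse_sub_one hT hS hc hg))).neg

/-- The operator is a bounded operator times the mixture `T * T` times `g • S`, so its trace is an
integral over `μ`. That integral is norm continuous in the bounded operator, and therefore commutes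
with the integral over `s`. -/
theorem opTrace_opLog2 [IsFiniteMeasure μ] (hφ : StronglyMeasurable φ) (hb : ∀ z, ‖φ z‖ ≤ 1)
    (hA : IsMixture φ μ (T * T)) (hT : IsSelfAdjoint T) (hS : IsSelfAdjoint S)
    (hc : 0 < c) (hg : ∀ x : ℝ, c ≤ ‖1 + g * x‖) :
    opTrace (opLog2 (g • (T * T * S))) = -∫ s in (0 : ℝ)..1, g ^ 2 * logTerm φ μ T S g s := by
  have hcont := continuous_inverse_sub_one hT hS hc hg
  have h1 : opLog2 (g • (T * T * S))
      = (∫ s in (0 : ℝ)..1, (Ring.inverse (1 + (s : ℂ) • (g • (T * T * S))) - 1))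
        * (T * T) * (g • S) := by
    rw [mul_assoc _ (T * T), mul_smul_comm]
    exact ((ContinuousLinearMap.mul ℝ (H →L[ℂ] H)).flip (g • (T * T * S))).intervalIntegral_comp_comm
      (hcont.intervalIntegrable (μ := volume) 0 1)
  rw [h1, opTrace_mul_mixture hφ hb hA, ← mixTraceL_apply hφ hb, ← intervalIntegral.integral_neg]
  have h2 := ((mixTraceL φ μ hφ hb).comp (ContinuousLinearMap.mul ℂ (H →L[ℂ] H) (g • S)))
    |>.intervalIntegral_comp_comm (hcont.intervalIntegrable (μ := volume) 0 1)
  simp only [ContinuousLinearMap.comp_apply, ContinuousLinearMap.mul_apply'] at h2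
  rw [← h2]
  refine intervalIntegral.integral_congr fun s _ => ?_
  rw [smul_logTerm hφ hb hT hS hc hg]
  ring

end Log

/-! ### Plane waves, multiplication by the field, kernels with a spectral measure -/

/-- The plane wave `x ↦ exp (i ξ · x)`. -/
def phase (ξ : ℝ × ℝ) (x : Sq) : ℂ :=
  Complex.exp (((ξ.1 * (x.1 : ℝ) + ξ.2 * (x.2 : ℝ) : ℝ) : ℂ) * Complex.I)

theorem continuous_phase : Continuous fun p : (ℝ × ℝ) × Sq => phase p.1 p.2 := by
  unfold phase
  fun_prop

theorem norm_phase (ξ : ℝ × ℝ) (x : Sq) : ‖phase ξ x‖ = 1 := Complex.norm_exp_ofReal_mul_I _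

theorem conj_phase_mul (ξ ζ : ℝ × ℝ) (x : Sq) : conj (phase ξ x) * phase ζ x = phase (ζ - ξ) x := by
  unfold phase
  rw [← Complex.exp_conj, ← Complex.exp_add]
  congr 1
  simp only [map_mul, Complex.conj_ofReal, Complex.conj_I, Prod.fst_sub, Prod.snd_sub]
  push_cast
  ring

theorem phase_zero (x : Sq) : phase 0 x = 1 := by simp [phase]

/-- The plane wave as a continuous function on the unit square. -/
def phaseC : C(ℝ × ℝ, C(Sq, ℂ)) := ContinuousMap.curry ⟨_, continuous_phase⟩

/-- The plane wave as an element of `L²`. -/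
def wave (ξ : ℝ × ℝ) : H := ContinuousMap.toLp 2 volume ℂ (phaseC ξ)

theorem continuous_wave : Continuous wave :=
  (ContinuousMap.toLp 2 volume ℂ).continuous.comp phaseC.continuous

theorem stronglyMeasurable_wave : StronglyMeasurable wave := continuous_wave.stronglyMeasurable

theorem coeFn_wave (ξ : ℝ × ℝ) : wave ξ =ᵐ[volume] phase ξ := ContinuousMap.coeFn_toLp _ _

theorem inner_eq_integral (u v : H) : inner ℂ u v = ∫ x, conj (u x) * v x := by
  rw [L2.inner_def]
  refine integral_congr_ae (Eventually.of_forall fun x => ?_)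
  simp only [RCLike.inner_apply]
  ring

theorem inner_wave_left (ξ : ℝ × ℝ) (v : H) : inner ℂ (wave ξ) v = ∫ x, conj (phase ξ x) * v x := by
  rw [inner_eq_integral]
  refine integral_congr_ae ?_
  filter_upwards [coeFn_wave ξ] with x hx
  rw [hx]

theorem inner_wave_right (ξ : ℝ × ℝ) (v : H) : inner ℂ v (wave ξ) = ∫ x, conj (v x) * phase ξ x := by
  rw [inner_eq_integral]
  refine integral_congr_ae ?_
  filter_upwards [coeFn_wave ξ] with x hx
  rw [hx]

theorem norm_wave_le (ξ : ℝ × ℝ) : ‖wave ξ‖ ≤ 1 := by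
  have h : (‖wave ξ‖ : ℂ) ^ 2 = 1 := by
    have := inner_self_eq_norm_sq_to_K (𝕜 := ℂ) (wave ξ)
    rw [show (‖wave ξ‖ : ℂ) ^ 2 = inner ℂ (wave ξ) (wave ξ) from this.symm, inner_wave_left]
    have : ∫ x, conj (phase ξ x) * wave ξ x = ∫ x : Sq, (1 : ℂ) := by
      refine integral_congr_ae ?_
      filter_upwards [coeFn_wave ξ] with x hx
      rw [hx, conj_phase_mul, sub_self, phase_zero]
    rw [this]
    simp
  have h2 : ‖wave ξ‖ ^ 2 = 1 := by exact_mod_cast h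
  nlinarith [norm_nonneg (wave ξ)]

/-- A real continuous function as an element of the complex `L^∞`. -/
def toLinfty (σ : C(Sq, ℝ)) : Lp ℂ ⊤ (volume : Measure Sq) :=
  ContinuousMap.toLp ⊤ volume ℂ (⟨fun x => (σ x : ℂ), by fun_prop⟩ : C(Sq, ℂ))

theorem coeFn_toLinfty (σ : C(Sq, ℝ)) : toLinfty σ =ᵐ[volume] fun x => (σ x : ℂ) :=
  ContinuousMap.coeFn_toLp _ _

/-- Multiplication by the field `σ`, as an operator on `L²`. -/
def mulOp (σ : C(Sq, ℝ)) : H →L[ℂ] H :=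
  (ContinuousLinearMap.mul ℂ ℂ).holderL volume ⊤ 2 2 (toLinfty σ)

theorem coeFn_mulOp (σ : C(Sq, ℝ)) (f : H) : mulOp σ f =ᵐ[volume] fun x => (σ x : ℂ) * f x := by
  have h := (ContinuousLinearMap.mul ℂ ℂ).coeFn_holder (r := 2) (toLinfty σ) f
  filter_upwards [h, coeFn_toLinfty σ] with x h1 h2
  rw [← h2]
  exact h1

theorem mulOp_sub (σ τ : C(Sq, ℝ)) : mulOp (σ - τ) = mulOp σ - mulOp τ := by
  have : toLinfty (σ - τ) = toLinfty σ - toLinfty τ := by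
    rw [toLinfty, toLinfty, toLinfty, ← map_sub]
    congr 1
    ext x
    simp
  rw [mulOp, this, map_sub]
  rfl

theorem isSelfAdjoint_mulOp (σ : C(Sq, ℝ)) : IsSelfAdjoint (mulOp σ) := by
  rw [ContinuousLinearMap.isSelfAdjoint_iff_isSymmetric]
  intro u v
  simp only [ContinuousLinearMap.coe_coe, inner_eq_integral]
  refine integral_congr_ae ?_
  filter_upwards [coeFn_mulOp σ u, coeFn_mulOp σ v] with x hu hv
  rw [hu, hv, map_mul, Complex.conj_ofReal]
  ring

/-- The Fourier transform of `σ` on the unit square. -/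
def fourierSq (σ : C(Sq, ℝ)) (ζ : ℝ × ℝ) : ℂ := ∫ x, (σ x : ℂ) * phase ζ x

theorem inner_wave_mulOp_wave (σ : C(Sq, ℝ)) (ξ ζ : ℝ × ℝ) :
    inner ℂ (wave ξ) (mulOp σ (wave ζ)) = fourierSq σ (ζ - ξ) := by
  rw [inner_wave_left]
  refine integral_congr_ae ?_
  filter_upwards [coeFn_mulOp σ (wave ζ), coeFn_wave ζ] with x h1 h2
  rw [h1, h2, ← conj_phase_mul]
  ring

theorem integrable_ofReal_mul_phase (σ : C(Sq, ℝ)) (ζ : ℝ × ℝ) :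
    Integrable fun x => (σ x : ℂ) * phase ζ x := by
  refine Continuous.integrable_of_hasCompactSupport ?_
    (HasCompactSupport.of_compactSpace _)
  have := (phaseC ζ).continuous
  exact (by fun_prop : Continuous fun x => (σ x : ℂ)).mul this

theorem norm_fourierSq_le (σ : C(Sq, ℝ)) (ζ : ℝ × ℝ) : ‖fourierSq σ ζ‖ ≤ ‖σ‖ := by
  refine (norm_integral_le_of_norm_le_const (C := ‖σ‖) (Eventually.of_forall fun x => ?_)).trans ?_
  · rw [norm_mul, norm_phase, mul_one, Complex.norm_real]
    exact σ.norm_coe_le_norm x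
  · simp

theorem fourierSq_sub (σ τ : C(Sq, ℝ)) (ζ : ℝ × ℝ) :
    fourierSq (σ - τ) ζ = fourierSq σ ζ - fourierSq τ ζ := by
  rw [fourierSq, fourierSq, fourierSq, ← integral_sub (integrable_ofReal_mul_phase σ ζ)
    (integrable_ofReal_mul_phase τ ζ)]
  refine integral_congr_ae (Eventually.of_forall fun x => ?_)
  simp [sub_mul]

theorem continuous_fourierSq (σ : C(Sq, ℝ)) : Continuous (fourierSq σ) := by
  refine continuous_of_dominated (bound := fun _ => ‖σ‖) (fun ζ => ?_) (fun ζ => ?_)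
    (integrable_const _) (Eventually.of_forall fun x => ?_)
  · exact (integrable_ofReal_mul_phase σ ζ).aestronglyMeasurable
  · refine Eventually.of_forall fun x => ?_
    rw [norm_mul, norm_phase, mul_one, Complex.norm_real]
    exact σ.norm_coe_le_norm x
  · exact continuous_const.mul (continuous_phase.comp (Continuous.prodMk_left x))

/-- The quadratic form `∫ |σ̂(ζ)|² dκ(ζ)`. -/
def qForm (κ : Measure (ℝ × ℝ)) (σ : C(Sq, ℝ)) : ℝ := ∫ ζ, ‖fourierSq σ ζ‖ ^ 2 ∂κ

theorem qForm_nonneg (κ : Measure (ℝ × ℝ)) (σ : C(Sq, ℝ)) : 0 ≤ qForm κ σ :=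
  integral_nonneg fun _ => by positivity

theorem integrable_fourierSq_sq (κ : Measure (ℝ × ℝ)) [IsFiniteMeasure κ] (σ : C(Sq, ℝ)) :
    Integrable (fun ζ => ‖fourierSq σ ζ‖ ^ 2) κ :=
  Integrable.of_bound (by have := continuous_fourierSq σ; fun_prop) (‖σ‖ ^ 2)
    (Eventually.of_forall fun ζ => by
      rw [Real.norm_of_nonneg (by positivity)]
      gcongr
      exact norm_fourierSq_le σ ζ)

/-- The kernel `∫ exp (i ξ · (x - y)) dμ(ξ)`. -/
def fourierKernel (μ : Measure (ℝ × ℝ)) (x y : Sq) : ℂ := ∫ ξ, phase ξ x * conj (phase ξ y) ∂μ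

theorem continuous_fourierKernel (μ : Measure (ℝ × ℝ)) [IsFiniteMeasure μ] :
    Continuous (Function.uncurry (fourierKernel μ)) := by
  have h1 : ∀ ξ, Continuous (phase ξ) := fun ξ => (phaseC ξ).continuous
  refine continuous_of_dominated (bound := fun _ => 1) (fun p => ?_) (fun p => ?_)
    (integrable_const _) (Eventually.of_forall fun ξ => ?_)
  · have h2 : ∀ x, Continuous fun ξ => phase ξ x := fun x =>
      continuous_phase.comp (Continuous.prodMk_left x)
    exact ((h2 _).mul (Complex.continuous_conj.comp (h2 _))).aestronglyMeasurable
  · refine Eventually.of_forall fun ξ => ?_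
    rw [norm_mul, norm_phase, RCLike.norm_conj, norm_phase, one_mul]
  · exact ((h1 ξ).comp continuous_fst).mul (Complex.continuous_conj.comp ((h1 ξ).comp continuous_snd))

theorem coeFn_kernelOp {k : Sq → Sq → ℂ} (hk : Continuous (Function.uncurry k)) (f : H) :
    kernelOp k f =ᵐ[volume] fun x => ∫ y, k x y * f y := by
  rw [kernelOp, dif_pos hk]
  exact ContinuousMap.coeFn_toLp _ _

theorem kernelOp_mul {k : Sq → Sq → ℂ} (hk : Continuous (Function.uncurry k)) (σ : C(Sq, ℝ)) :
    kernelOp (fun x y => k x y * (σ y : ℂ)) = kernelOp k * mulOp σ := by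
  have hk' : Continuous (Function.uncurry fun x y => k x y * (σ y : ℂ)) := by
    simp only [Function.uncurry_def] at hk ⊢
    fun_prop
  ext1 f
  refine Lp.ext ?_
  filter_upwards [coeFn_kernelOp hk' f, coeFn_kernelOp hk (mulOp σ f)] with x h1 h2
  rw [h1, mul_apply_eq_comp, h2]
  refine integral_congr_ae ?_
  filter_upwards [coeFn_mulOp σ f] with y hy
  rw [hy]
  ring

theorem integrable_coeFn (f : H) : Integrable (fun x => (f x : ℂ)) :=
  (Lp.memLp f).integrable (by norm_num)

/-- Fubini, used twice: elements of `L²` are integrable on the square, phases have modulus one, and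
`μ` is finite. -/
theorem isMixture_fourierKernel (μ : Measure (ℝ × ℝ)) [IsFiniteMeasure μ] :
    IsMixture wave μ (kernelOp (fourierKernel μ)) := by
  intro u v
  have hu := integrable_coeFn u
  have hv := integrable_coeFn v
  have hph : Measurable fun p : (ℝ × ℝ) × Sq => phase p.1 p.2 := continuous_phase.measurable
  have hX : Integrable (fun p : Sq × (ℝ × ℝ) => conj (u p.1) * phase p.2 p.1)
      ((volume : Measure Sq).prod μ) := by
    have h0 : Integrable (fun x => conj (u x)) := (Complex.conjCLE.integrable_comp_iff).mpr hu
    refine (h0.comp_fst μ).mul_bdd (c := 1) ?_ ?_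
    · exact (hph.comp measurable_swap).aestronglyMeasurable
    · exact Eventually.of_forall fun p => (norm_phase _ _).le
  have hXv : Integrable (Function.uncurry fun (x : Sq) (ξ : ℝ × ℝ) =>
      (conj (u x) * phase ξ x) * inner ℂ (wave ξ) v) ((volume : Measure Sq).prod μ) := by
    have hcont : Continuous fun p : Sq × (ℝ × ℝ) => inner ℂ (wave p.2) v :=
      (continuous_wave.comp continuous_snd).inner continuous_const
    refine hX.mul_bdd (c := ‖v‖) (g := fun p : Sq × (ℝ × ℝ) => inner ℂ (wave p.2) v)
      hcont.aestronglyMeasurable (Eventually.of_forall fun p => ?_)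
    exact (norm_inner_le_norm _ _).trans
      (mul_le_of_le_one_left (norm_nonneg _) (norm_wave_le _))
  calc inner ℂ u (kernelOp (fourierKernel μ) v)
      = ∫ x, ∫ ξ, (conj (u x) * phase ξ x) * inner ℂ (wave ξ) v ∂μ := by
        rw [inner_eq_integral]
        refine integral_congr_ae ?_
        filter_upwards [coeFn_kernelOp (continuous_fourierKernel μ) v] with x hx
        rw [hx]
        have hsw : ∫ y, fourierKernel μ x y * v y
            = ∫ ξ, phase ξ x * inner ℂ (wave ξ) v ∂μ := by
          simp only [fourierKernel, ← integral_mul_const, inner_wave_left, ← integral_const_mul]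
          rw [integral_integral_swap]
          · simp only [mul_assoc]
          · refine ((hv.comp_fst μ).bdd_mul (c := 1)
              (f := fun p : Sq × (ℝ × ℝ) => phase p.2 x * conj (phase p.2 p.1)) ?_ ?_)
            · have h1 : Measurable fun p : Sq × (ℝ × ℝ) => phase p.2 x :=
                (continuous_phase.comp (by fun_prop : Continuous
                  fun p : Sq × (ℝ × ℝ) => (p.2, x))).measurable
              exact (h1.mul (Complex.continuous_conj.measurable.comp
                (hph.comp measurable_swap))).aestronglyMeasurable
            · refine Eventually.of_forall fun p => ?_
              rw [norm_mul, norm_phase, RCLike.norm_conj, norm_phase, one_mul]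
        rw [hsw, ← integral_const_mul]
        simp only [mul_assoc]
    _ = ∫ ξ, (∫ x, (conj (u x) * phase ξ x) * inner ℂ (wave ξ) v) ∂μ := by
        exact integral_integral_swap hXv
    _ = ∫ ξ, inner ℂ u (wave ξ) * inner ℂ (wave ξ) v ∂μ := by
        simp only [integral_mul_const, inner_wave_right]

/-! ### Spectral measures and size of the slices -/

/-- The weight of the parameter `α` in the propagator at coinciding points. -/
def massWeight (m α : ℝ) : ℝ := Real.exp (-α * m ^ 2) / α

theorem measurable_massWeight (m : ℝ) : Measurable (massWeight m) := by
  unfold massWeight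
  fun_prop

theorem measurableSet_sliceRange (M j : ℕ) : MeasurableSet (sliceRange M j) := by
  unfold sliceRange
  split_ifs
  · exact measurableSet_Ici
  · exact measurableSet_Icc

theorem sliceRange_pos {M : ℕ} (hM : 2 ≤ M) {j : ℕ} {α : ℝ} (h : α ∈ sliceRange M j) : 0 < α := by
  have : (0 : ℝ) < M := by positivity
  unfold sliceRange at h
  split_ifs at h
  · exact zero_lt_one.trans_le h
  · exact lt_of_lt_of_le (by positivity) h.1

theorem integrableOn_massWeight {M : ℕ} (hM : 2 ≤ M) {m : ℝ} (hm : 0 < m) (j : ℕ) :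
    IntegrableOn (massWeight m) (sliceRange M j) := by
  rcases eq_or_ne j 0 with rfl | hj
  · rw [sliceRange, if_pos rfl, integrableOn_Ici_iff_integrableOn_Ioi]
    refine Integrable.mono' (exp_neg_integrableOn_Ioi 1 (b := m ^ 2) (by positivity))
      (measurable_massWeight m).aestronglyMeasurable ?_
    refine (ae_restrict_mem measurableSet_Ioi).mono fun α hα => ?_
    have h1 : (1 : ℝ) < α := hα
    rw [massWeight, Real.norm_of_nonneg (by positivity), mul_comm (-α), mul_neg, ← neg_mul]
    exact div_le_self (Real.exp_nonneg _) h1.le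
  · rw [sliceRange, if_neg hj]
    refine ContinuousOn.integrableOn_Icc ?_
    unfold massWeight
    refine ContinuousOn.div (by fun_prop) continuousOn_id fun α hα => ?_
    have : (0 : ℝ) < M := by positivity
    exact (lt_of_lt_of_le (by positivity) hα.1).ne'

/-- The measure `exp (-α m²) dα / α` on the range of the slice `j`. -/
def alphaMeasure (M : ℕ) (m : ℝ) (j : ℕ) : Measure ℝ :=
  (volume.restrict (sliceRange M j)).withDensity fun α => ENNReal.ofReal (massWeight m α)

theorem isFiniteMeasure_alphaMeasure {M : ℕ} (hM : 2 ≤ M) {m : ℝ} (hm : 0 < m) (j : ℕ) :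
    IsFiniteMeasure (alphaMeasure M m j) :=
  isFiniteMeasure_withDensity_ofReal (integrableOn_massWeight hM hm j).2

theorem integral_alphaMeasure {M : ℕ} (hM : 2 ≤ M) (m : ℝ) (j : ℕ) (f : ℝ → ℂ) :
    ∫ α, f α ∂alphaMeasure M m j = ∫ α in sliceRange M j, massWeight m α • f α := by
  rw [alphaMeasure, integral_withDensity_eq_integral_toReal_smul
    (measurable_massWeight m).ennreal_ofReal (Eventually.of_forall fun _ => ENNReal.ofReal_lt_top)]
  refine setIntegral_congr_fun (measurableSet_sliceRange M j) fun α hα => ?_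
  have := sliceRange_pos hM hα
  rw [ENNReal.toReal_ofReal (by unfold massWeight; positivity)]

/-- The frequencies `ξ = η / √(2α)`, with `η` standard Gaussian in the plane. -/
def frequency (p : ℝ × (ℝ × ℝ)) : ℝ × ℝ := (p.2.1 / √(2 * p.1), p.2.2 / √(2 * p.1))

theorem measurable_frequency : Measurable frequency := by
  unfold frequency
  fun_prop

/-- The spectral measure of the slice `C_j` of the propagator. -/
def sliceMeasure (M : ℕ) (m : ℝ) (j : ℕ) : Measure (ℝ × ℝ) :=
  ((alphaMeasure M m j).prod ((gaussianReal 0 1).prod (gaussianReal 0 1))).map frequency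

theorem isFiniteMeasure_sliceMeasure {M : ℕ} (hM : 2 ≤ M) {m : ℝ} (hm : 0 < m) (j : ℕ) :
    IsFiniteMeasure (sliceMeasure M m j) := by
  have := isFiniteMeasure_alphaMeasure hM hm j
  unfold sliceMeasure
  infer_instance

theorem measurable_phase_left (x : Sq) : Measurable fun ξ => phase ξ x :=
  (continuous_phase.comp (Continuous.prodMk_left x)).measurable

/-- The integral is a product of two characteristic functions of the standard Gaussian, at the
coordinates of `(x - y) / √(2α)`. -/
theorem integral_gaussian_phase {α : ℝ} (hα : 0 < α) (x y : Sq) :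
    ∫ η : ℝ × ℝ, phase (frequency (α, η)) x * conj (phase (frequency (α, η)) y)
      ∂(gaussianReal 0 1).prod (gaussianReal 0 1) = Real.exp (-sqDist x y / (4 * α)) := by
  have h1 : ∀ η : ℝ × ℝ, phase (frequency (α, η)) x * conj (phase (frequency (α, η)) y)
      = Complex.exp ((((x.1 : ℝ) - y.1) / √(2 * α) : ℝ) * (η.1 : ℂ) * Complex.I)
        * Complex.exp ((((x.2 : ℝ) - y.2) / √(2 * α) : ℝ) * (η.2 : ℂ) * Complex.I) := fun η => by
    unfold phase frequency
    rw [← Complex.exp_conj, ← Complex.exp_add, ← Complex.exp_add]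
    congr 1
    simp only [map_mul, Complex.conj_ofReal, Complex.conj_I]
    push_cast
    ring
  simp only [h1]
  rw [integral_prod_mul (fun η : ℝ => Complex.exp ((((x.1 : ℝ) - y.1) / √(2 * α) : ℝ)
    * (η : ℂ) * Complex.I)) (fun η : ℝ => Complex.exp ((((x.2 : ℝ) - y.2) / √(2 * α) : ℝ)
    * (η : ℂ) * Complex.I)), ← charFun_apply_real, ← charFun_apply_real, charFun_gaussianReal,
    charFun_gaussianReal, ← Complex.exp_add, Complex.ofReal_exp]
  congr 1
  have h2 : (√(2 * α)) ^ 2 = 2 * α := Real.sq_sqrt (by positivity)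
  have h3 : -sqDist x y / (4 * α) = -(((x.1 : ℝ) - y.1) / √(2 * α)) ^ 2 / 2
      - (((x.2 : ℝ) - y.2) / √(2 * α)) ^ 2 / 2 := by
    rw [div_pow, div_pow, h2, sqDist]
    field_simp
    ring
  rw [h3]
  push_cast
  ring

theorem norm_phase_mul_conj (ξ : ℝ × ℝ) (x y : Sq) : ‖phase ξ x * conj (phase ξ y)‖ = 1 := by
  rw [norm_mul, RCLike.norm_conj, norm_phase, norm_phase, one_mul]

theorem integrable_phase_mul_conj (μ : Measure (ℝ × ℝ)) [IsFiniteMeasure μ] (x y : Sq) :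
    Integrable (fun ξ => phase ξ x * conj (phase ξ y)) μ :=
  Integrable.of_bound ((measurable_phase_left x).mul (Complex.continuous_conj.measurable.comp
    (measurable_phase_left y))).aestronglyMeasurable 1
    (Eventually.of_forall fun ξ => (norm_phase_mul_conj ξ x y).le)

theorem exp_div_eq (m α : ℝ) (x y : Sq) :
    Real.exp (-α * m ^ 2 - sqDist x y / (4 * α)) / α
      = massWeight m α * Real.exp (-sqDist x y / (4 * α)) := by
  rw [massWeight, sub_eq_add_neg, Real.exp_add, neg_div]
  ring

theorem fourierKernel_sliceMeasure {M : ℕ} (hM : 2 ≤ M) {m : ℝ} (hm : 0 < m) (j : ℕ) (x y : Sq) :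
    fourierKernel (sliceMeasure M m j) x y = sliceProp M m j x y := by
  have := isFiniteMeasure_alphaMeasure hM hm j
  have := isFiniteMeasure_sliceMeasure hM hm j
  have hmeas : Measurable fun ξ : ℝ × ℝ => phase ξ x * conj (phase ξ y) :=
    (measurable_phase_left x).mul (Complex.continuous_conj.measurable.comp
      (measurable_phase_left y))
  rw [fourierKernel, sliceMeasure, integral_map measurable_frequency.aemeasurable
    hmeas.aestronglyMeasurable, integral_prod
    (fun p => phase (frequency p) x * conj (phase (frequency p) y)) (Integrable.of_bound
    (hmeas.comp measurable_frequency).aestronglyMeasurable 1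
    (Eventually.of_forall fun p => (norm_phase_mul_conj _ x y).le)), integral_alphaMeasure hM,
    sliceProp, ← integral_complex_ofReal]
  refine setIntegral_congr_fun (measurableSet_sliceRange M j) fun α hα => ?_
  rw [integral_gaussian_phase (sliceRange_pos hM hα), exp_div_eq, Complex.real_smul,
    Complex.ofReal_mul]

theorem massWeight_nonneg {m α : ℝ} (hα : 0 < α) : 0 ≤ massWeight m α := by
  unfold massWeight
  positivity

theorem exp_neg_sqDist_le_one {α : ℝ} (hα : 0 < α) (x y : Sq) :
    Real.exp (-sqDist x y / (4 * α)) ≤ 1 := by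
  rw [Real.exp_le_one_iff, neg_div, neg_nonpos]
  unfold sqDist
  positivity

theorem sliceProp_nonneg {M : ℕ} (hM : 2 ≤ M) (m : ℝ) (j : ℕ) (x y : Sq) :
    0 ≤ sliceProp M m j x y :=
  setIntegral_nonneg (measurableSet_sliceRange M j) fun α hα => by
    have := sliceRange_pos hM hα
    positivity

theorem sliceProp_self (M : ℕ) (m : ℝ) (j : ℕ) (x : Sq) :
    sliceProp M m j x x = ∫ α in sliceRange M j, massWeight m α := by
  simp [sliceProp, sqDist, massWeight]

theorem measurable_exp_neg_sqDist (x y : Sq) :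
    Measurable fun α : ℝ => Real.exp (-sqDist x y / (4 * α)) := by
  fun_prop

theorem sliceProp_le {M : ℕ} (hM : 2 ≤ M) {m : ℝ} (hm : 0 < m) (j : ℕ) (x y : Sq) :
    sliceProp M m j x y ≤ sliceProp M m j 0 0 := by
  have hint := integrableOn_massWeight hM hm j
  rw [sliceProp_self, sliceProp]
  simp only [exp_div_eq]
  refine setIntegral_mono_on (hint.mul_bdd (c := 1)
    (measurable_exp_neg_sqDist x y).aestronglyMeasurable ?_) hint
    (measurableSet_sliceRange M j) fun α hα => ?_
  · refine (ae_restrict_mem (measurableSet_sliceRange M j)).mono fun α hα => ?_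
    rw [Real.norm_of_nonneg (Real.exp_nonneg _)]
    exact exp_neg_sqDist_le_one (sliceRange_pos hM hα) x y
  · exact mul_le_of_le_one_right (massWeight_nonneg (sliceRange_pos hM hα))
      (exp_neg_sqDist_le_one (sliceRange_pos hM hα) x y)

/-- The length of the slice `j ≥ 1` in `α` is at most `M^(-2(j-1))`. -/
theorem volume_sliceRange_le {M : ℕ} (hM : 2 ≤ M) {j : ℕ} (hj : j ≠ 0) :
    volume.real (sliceRange M j) ≤ (M : ℝ) ^ 2 * ((M : ℝ) ^ (-2 * (j : ℤ))) := by
  have h0 : (0 : ℝ) < M := by positivity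
  have h1 : (0 : ℝ) < (M : ℝ) ^ (-2 * (j : ℤ)) := by positivity
  have h2 : (M : ℝ) ^ (-2 * ((j : ℤ) - 1)) = (M : ℝ) ^ 2 * ((M : ℝ) ^ (-2 * (j : ℤ))) := by
    rw [← zpow_natCast, ← zpow_add₀ h0.ne']
    congr 1
    push_cast
    ring
  have h3 : (1 : ℝ) ≤ (M : ℝ) ^ 2 := one_le_pow₀ (by exact_mod_cast (by lia : 1 ≤ M))
  rw [sliceRange, if_neg hj, Real.volume_real_Icc_of_le, h2]
  · linarith
  · rw [h2]
    nlinarith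

/-- For `j ≥ 1` the weight is at most `M^(2j)` on an interval of length at most `M² M^(-2j)`. Each
slice thus contributes a bounded amount, and the sum up to `j` grows only linearly in `j`. -/
theorem exists_tadpole_bound {M : ℕ} (hM : 2 ≤ M) {m : ℝ} (hm : 0 < m) :
    ∃ τ : ℝ, 1 ≤ τ ∧ ∀ j, sliceProp M m j 0 0 ≤ τ := by
  refine ⟨max 1 (max (sliceProp M m 0 0 0) ((M : ℝ) ^ 2)), le_max_left _ _, fun j => ?_⟩
  rcases eq_or_ne j 0 with rfl | hj
  · exact (le_max_left _ _).trans (le_max_right _ _)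
  refine le_trans ?_ ((le_max_right _ _).trans (le_max_right _ _))
  have h0 : (0 : ℝ) < M := by positivity
  have h1 : (0 : ℝ) < (M : ℝ) ^ (-2 * (j : ℤ)) := by positivity
  rw [sliceProp_self]
  have hfin : volume (sliceRange M j) ≠ ⊤ := by
    rw [sliceRange, if_neg hj]
    simp
  have h2 : ∀ α ∈ sliceRange M j, massWeight m α ≤ ((M : ℝ) ^ (-2 * (j : ℤ)))⁻¹ := fun α hα => by
    have hα0 := sliceRange_pos hM hα
    have hle : (M : ℝ) ^ (-2 * (j : ℤ)) ≤ α := by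
      rw [sliceRange, if_neg hj] at hα
      exact hα.1
    calc massWeight m α ≤ 1 / α := by
          unfold massWeight
          gcongr
          rw [Real.exp_le_one_iff]
          nlinarith [sq_nonneg m]
      _ ≤ _ := by
          rw [one_div]
          gcongr
  calc ∫ α in sliceRange M j, massWeight m α
      ≤ ∫ α in sliceRange M j, ((M : ℝ) ^ (-2 * (j : ℤ)))⁻¹ :=
        setIntegral_mono_on (integrableOn_massWeight hM hm j) (integrableOn_const hfin)
          (measurableSet_sliceRange M j) h2
    _ = volume.real (sliceRange M j) * ((M : ℝ) ^ (-2 * (j : ℤ)))⁻¹ := by simp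
    _ ≤ ((M : ℝ) ^ 2 * ((M : ℝ) ^ (-2 * (j : ℤ)))) * ((M : ℝ) ^ (-2 * (j : ℤ)))⁻¹ := by
        gcongr
        exact volume_sliceRange_le hM hj
    _ = (M : ℝ) ^ 2 := by field_simp

theorem integral_unitInterval_gaussian_le {α : ℝ} (hα : 0 < α) (a : ℝ) :
    ∫ y : unitInterval, Real.exp (-(a - (y : ℝ)) ^ 2 / (4 * α)) ≤ √(4 * Real.pi * α) := by
  have h1 : ∀ y : ℝ, Real.exp (-(a - y) ^ 2 / (4 * α))
      = Real.exp (-(1 / (4 * α)) * (y - a) ^ 2) := fun y => by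
    congr 1
    field_simp
    ring
  have hint : Integrable fun y : ℝ => Real.exp (-(a - y) ^ 2 / (4 * α)) := by
    simp only [h1]
    exact (integrable_exp_neg_mul_sq (by positivity)).comp_sub_right a
  calc ∫ y : unitInterval, Real.exp (-(a - (y : ℝ)) ^ 2 / (4 * α))
      = ∫ y in unitInterval, Real.exp (-(a - y) ^ 2 / (4 * α)) :=
        integral_subtype_comap measurableSet_Icc
          (fun y : ℝ => Real.exp (-(a - y) ^ 2 / (4 * α)))
    _ ≤ ∫ y, Real.exp (-(a - y) ^ 2 / (4 * α)) :=
        setIntegral_le_integral hint (Eventually.of_forall fun y => Real.exp_nonneg _)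
    _ = √(4 * Real.pi * α) := by
        simp only [h1]
        rw [integral_sub_right_eq_self (fun y => Real.exp (-(1 / (4 * α)) * y ^ 2)) a,
          integral_gaussian]
        congr 1
        field_simp

theorem integral_sq_gaussian_le {α : ℝ} (hα : 0 < α) (x : Sq) :
    ∫ y : Sq, Real.exp (-sqDist x y / (4 * α)) ≤ 4 * Real.pi * α := by
  have h1 : ∀ y : Sq, Real.exp (-sqDist x y / (4 * α))
      = Real.exp (-((x.1 : ℝ) - y.1) ^ 2 / (4 * α))
        * Real.exp (-((x.2 : ℝ) - y.2) ^ 2 / (4 * α)) := fun y => by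
    rw [← Real.exp_add, sqDist]
    congr 1
    ring
  simp only [h1]
  rw [Measure.volume_eq_prod, integral_prod_mul (fun y : unitInterval =>
    Real.exp (-((x.1 : ℝ) - y) ^ 2 / (4 * α))) (fun y : unitInterval =>
    Real.exp (-((x.2 : ℝ) - y) ^ 2 / (4 * α)))]
  refine (mul_le_mul (integral_unitInterval_gaussian_le hα _)
    (integral_unitInterval_gaussian_le hα _) (integral_nonneg fun _ => Real.exp_nonneg _)
    (Real.sqrt_nonneg _)).trans_eq ?_
  exact Real.mul_self_sqrt (by positivity)

theorem continuous_sqDist : Continuous fun p : Sq × Sq => sqDist p.1 p.2 := by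
  unfold sqDist
  fun_prop

/-- For `j ≥ 1`, the Gaussian has mass at most `4πα` in the plane, which cancels the weight `1 / α`.
What remains is the length of the slice, at most `M² M^(-2j) ≤ M² 4^(-j)` because `M ≥ 2`. -/
theorem exists_integral_sliceProp_bound {M : ℕ} (hM : 2 ≤ M) {m : ℝ} (hm : 0 < m) :
    ∃ υ : ℝ, 1 ≤ υ ∧ ∀ j x, ∫ y, sliceProp M m j x y ≤ υ * (1 / 4) ^ j := by
  refine ⟨max 1 (max (sliceProp M m 0 0 0) (4 * Real.pi * (M : ℝ) ^ 2)), le_max_left _ _,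
    fun j x => ?_⟩
  have hle : ∀ a : ℝ, a ≤ max (sliceProp M m 0 0 0) (4 * Real.pi * (M : ℝ) ^ 2) * (1 / 4) ^ j →
      a ≤ max 1 (max (sliceProp M m 0 0 0) (4 * Real.pi * (M : ℝ) ^ 2)) * (1 / 4) ^ j :=
    fun a h => h.trans (mul_le_mul_of_nonneg_right (le_max_right _ _) (by positivity))
  apply hle
  have hint := integrableOn_massWeight hM hm j
  rcases eq_or_ne j 0 with rfl | hj
  · rw [pow_zero, mul_one]
    refine le_trans ?_ (le_max_left _ _)
    calc ∫ y, sliceProp M m 0 x y ≤ ∫ y : Sq, sliceProp M m 0 0 0 :=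
          integral_mono_of_nonneg (Eventually.of_forall fun y => sliceProp_nonneg hM m 0 x y)
            (integrable_const _) (Eventually.of_forall fun y => sliceProp_le hM hm 0 x y)
      _ = _ := by simp
  have h0 : (0 : ℝ) < M := by positivity
  have h4 : (M : ℝ) ^ (-2 * (j : ℤ)) ≤ (1 / 4) ^ j := by
    rw [zpow_mul, zpow_natCast]
    gcongr
    rw [zpow_neg, one_div]
    have h2 : (2 : ℝ) ≤ M := by exact_mod_cast hM
    refine inv_anti₀ (by norm_num) ?_
    norm_cast
    nlinarith
  have hfin : volume (sliceRange M j) ≠ ⊤ := by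
    rw [sliceRange, if_neg hj]
    simp
  have hjoint : Integrable (Function.uncurry fun (y : Sq) (α : ℝ) =>
      massWeight m α * Real.exp (-sqDist x y / (4 * α)))
      ((volume : Measure Sq).prod (volume.restrict (sliceRange M j))) := by
    refine (hint.comp_snd (volume : Measure Sq)).mul_bdd (c := 1)
      (g := fun p : Sq × ℝ => Real.exp (-sqDist x p.1 / (4 * p.2))) ?_ ?_
    · have hd : Measurable fun p : Sq × ℝ => sqDist x p.1 :=
        (continuous_sqDist.comp (by fun_prop : Continuous fun p : Sq × ℝ => (x, p.1))).measurable
      exact (by fun_prop : Measurable _).aestronglyMeasurable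
    · have : ∀ᵐ p ∂((volume : Measure Sq).prod (volume.restrict (sliceRange M j))),
          p.2 ∈ sliceRange M j :=
        Measure.quasiMeasurePreserving_snd.ae (ae_restrict_mem (measurableSet_sliceRange M j))
      refine this.mono fun p hp => ?_
      rw [Real.norm_of_nonneg (Real.exp_nonneg _)]
      exact exp_neg_sqDist_le_one (sliceRange_pos hM hp) x p.1
  calc ∫ y, sliceProp M m j x y
      = ∫ α in sliceRange M j, ∫ y, massWeight m α * Real.exp (-sqDist x y / (4 * α)) := by
        simp only [sliceProp, exp_div_eq]
        exact integral_integral_swap hjoint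
    _ ≤ ∫ α in sliceRange M j, 4 * Real.pi := by
        refine setIntegral_mono_on hjoint.integral_prod_right (integrableOn_const hfin)
          (measurableSet_sliceRange M j) fun α hα => ?_
        have hα0 := sliceRange_pos hM hα
        rw [integral_const_mul]
        calc massWeight m α * ∫ y, Real.exp (-sqDist x y / (4 * α))
            ≤ 1 / α * (4 * Real.pi * α) := by
              refine mul_le_mul ?_ (integral_sq_gaussian_le hα0 x)
                (integral_nonneg fun _ => Real.exp_nonneg _) (by positivity)
              unfold massWeight
              gcongr
              rw [Real.exp_le_one_iff]
              nlinarith [sq_nonneg m]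
          _ = 4 * Real.pi := by field_simp
    _ = volume.real (sliceRange M j) * (4 * Real.pi) := by simp
    _ ≤ ((M : ℝ) ^ 2 * (1 / 4) ^ j) * (4 * Real.pi) := by
        gcongr
        exact (volume_sliceRange_le hM hj).trans (by gcongr)
    _ = (4 * Real.pi * (M : ℝ) ^ 2) * (1 / 4) ^ j := by ring
    _ ≤ _ := by
        gcongr
        exact le_max_right _ _

/-! ### Hilbert-Schmidt norms as quadratic forms, and the trace of the logarithm -/

/-- The law of the difference of independent frequencies: the spectral measure of a product of
two kernels. -/
def diffMeasure (μ ν : Measure (ℝ × ℝ)) : Measure (ℝ × ℝ) := (μ.prod ν).map fun p => p.1 - p.2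

instance isFiniteMeasure_diffMeasure (μ ν : Measure (ℝ × ℝ)) [IsFiniteMeasure μ]
    [IsFiniteMeasure ν] : IsFiniteMeasure (diffMeasure μ ν) := by
  unfold diffMeasure
  infer_instance

theorem IsMixture.nonneg {μ : Measure (ℝ × ℝ)} {A : H →L[ℂ] H} (hA : IsMixture wave μ A) :
    0 ≤ A := by
  have hsq : ∀ v, inner ℂ v (A v) = ((∫ ξ, ‖inner ℂ (wave ξ) v‖ ^ 2 ∂μ : ℝ) : ℂ) := fun v => by
    rw [hA, ← integral_complex_ofReal]
    refine integral_congr_ae (Eventually.of_forall fun ξ => ?_)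
    beta_reduce
    rw [← inner_conj_symm v, mul_comm, Complex.mul_conj, Complex.normSq_eq_norm_sq]
  rw [ContinuousLinearMap.nonneg_iff_isPositive, ContinuousLinearMap.isPositive_iff_complex]
  intro v
  rw [← inner_conj_symm, hsq, Complex.conj_ofReal]
  exact ⟨by simp, by simpa using integral_nonneg fun ξ => by positivity⟩

theorem exists_sqrt_of_nonneg {E : Type*} [NormedAddCommGroup E] [InnerProductSpace ℂ E]
    [CompleteSpace E] {A : E →L[ℂ] E} (h : 0 ≤ A) :
    ∃ T : E →L[ℂ] E, IsSelfAdjoint T ∧ T * T = A :=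
  ⟨CFC.sqrt A, IsSelfAdjoint.of_nonneg (CFC.sqrt_nonneg A), CFC.sqrt_mul_sqrt_self A h⟩

theorem exists_sqrt_kernelOp (μ : Measure (ℝ × ℝ)) [IsFiniteMeasure μ] :
    ∃ T : H →L[ℂ] H, IsSelfAdjoint T ∧ T * T = kernelOp (fourierKernel μ) :=
  exists_sqrt_of_nonneg (isMixture_fourierKernel μ).nonneg

theorem norm_sq_eq_integral {μ : Measure (ℝ × ℝ)} {T : H →L[ℂ] H} (hT : IsSelfAdjoint T)
    (hA : IsMixture wave μ (T * T)) (v : H) :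
    ‖T v‖ ^ 2 = ∫ ξ, ‖inner ℂ (wave ξ) v‖ ^ 2 ∂μ := by
  have h : ((‖T v‖ ^ 2 : ℝ) : ℂ) = ((∫ ξ, ‖inner ℂ (wave ξ) v‖ ^ 2 ∂μ : ℝ) : ℂ) := by
    have h1 : ((‖T v‖ ^ 2 : ℝ) : ℂ) = inner ℂ v ((T * T) v) := by
      rw [mul_apply_eq_comp T T, ← IsSelfAdjoint.inner_apply hT, inner_self_eq_norm_sq_to_K]
      push_cast
      rfl
    rw [h1, hA, ← integral_complex_ofReal]
    refine integral_congr_ae (Eventually.of_forall fun ξ => ?_)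
    beta_reduce
    rw [← inner_conj_symm v, mul_comm, Complex.mul_conj, Complex.normSq_eq_norm_sq]
  exact_mod_cast h

/-- The matrix element of `σ` between two plane waves is its Fourier transform at the difference of
the frequencies. The square of `T σ φ_ξ` is the integral of the squared matrix elements over `μ`. -/
theorem integral_norm_sq_eq_qForm {μ ν : Measure (ℝ × ℝ)} [IsFiniteMeasure μ] [IsFiniteMeasure ν]
    {T : H →L[ℂ] H} (hT : IsSelfAdjoint T) (hA : IsMixture wave μ (T * T)) (σ : C(Sq, ℝ)) :
    ∫ ξ, ‖T (mulOp σ (wave ξ))‖ ^ 2 ∂ν = qForm (diffMeasure ν μ) σ := by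
  have hc : Continuous fun ζ => ‖fourierSq σ ζ‖ ^ 2 := by
    have := continuous_fourierSq σ
    fun_prop
  have hm : Measurable fun p : (ℝ × ℝ) × (ℝ × ℝ) => p.1 - p.2 := by fun_prop
  rw [qForm, diffMeasure, integral_map hm.aemeasurable hc.aestronglyMeasurable,
    integral_prod (fun p : (ℝ × ℝ) × (ℝ × ℝ) => ‖fourierSq σ (p.1 - p.2)‖ ^ 2)]
  · simp only [norm_sq_eq_integral hT hA, inner_wave_mulOp_wave]
  · have h := integrable_fourierSq_sq (diffMeasure ν μ) σ
    exact h.comp_measurable hm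

section LogTrace

variable {μ ν : Measure (ℝ × ℝ)} [IsFiniteMeasure μ] [IsFiniteMeasure ν] {g : ℂ} {c : ℝ}

/-- The trace of `log₂ (1 + g A σ)`, where `A` is the propagator with spectral measure `μ`. -/
def logTrace (μ : Measure (ℝ × ℝ)) (g : ℂ) (σ : C(Sq, ℝ)) : ℂ :=
  opTrace (opLog2 (g • (kernelOp (fourierKernel μ) * mulOp σ)))

theorem logTrace_eq {T : H →L[ℂ] H} (hT : IsSelfAdjoint T)
    (hTT : T * T = kernelOp (fourierKernel μ)) (hc : 0 < c) (hg : ∀ x : ℝ, c ≤ ‖1 + g * x‖)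
    (σ : C(Sq, ℝ)) :
    logTrace μ g σ = -∫ s in (0 : ℝ)..1, g ^ 2 * logTerm wave μ T (mulOp σ) g s := by
  rw [logTrace, ← hTT]
  refine opTrace_opLog2 stronglyMeasurable_wave norm_wave_le ?_ hT (isSelfAdjoint_mulOp σ) hc hg
  rw [hTT]
  exact isMixture_fourierKernel μ

theorem kernelOp_add : kernelOp (fourierKernel (μ + ν))
    = kernelOp (fourierKernel μ) + kernelOp (fourierKernel ν) := by
  refine ContinuousLinearMap.ext fun v => ext_inner_left ℂ fun u => ?_
  have hint : ∀ (μ : Measure (ℝ × ℝ)) [IsFiniteMeasure μ],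
      Integrable (fun ξ => inner ℂ u (wave ξ) * inner ℂ (wave ξ) v) μ := fun μ _ => by
    have hcont : Continuous fun ξ => inner ℂ u (wave ξ) * inner ℂ (wave ξ) v :=
      (continuous_const.inner continuous_wave).mul (continuous_wave.inner continuous_const)
    refine Integrable.of_bound hcont.aestronglyMeasurable (‖u‖ * ‖v‖)
      (Eventually.of_forall fun ξ => ?_)
    rw [norm_mul]
    gcongr
    · exact (norm_inner_le_norm _ _).trans
        (mul_le_of_le_one_right (norm_nonneg _) (norm_wave_le ξ))
    · exact (norm_inner_le_norm _ _).trans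
        (mul_le_of_le_one_left (norm_nonneg _) (norm_wave_le ξ))
  rw [_root_.add_apply, inner_add_right, isMixture_fourierKernel, isMixture_fourierKernel,
    isMixture_fourierKernel, integral_add_measure (hint μ) (hint ν)]

theorem norm_intervalIntegral_sub_le {f h : ℝ → ℂ} (hf : IntervalIntegrable f volume 0 1)
    (hh : IntervalIntegrable h volume 0 1) {K : ℝ}
    (hK : ∀ s ∈ Set.Icc (0 : ℝ) 1, ‖f s - h s‖ ≤ K) :
    ‖(-∫ s in (0 : ℝ)..1, f s) - (-∫ s in (0 : ℝ)..1, h s)‖ ≤ K := by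
  rw [neg_sub_neg, ← norm_neg, neg_sub, ← intervalIntegral.integral_sub hf hh]
  refine (intervalIntegral.norm_integral_le_of_norm_le_const (C := K) fun s hs => ?_).trans ?_
  · rw [Set.uIoc_of_le zero_le_one] at hs
    exact hK s ⟨hs.1.le, hs.2⟩
  · simp

theorem norm_logTrace_add_sub_le (hc : 0 < c) (hg : ∀ x : ℝ, c ≤ ‖1 + g * x‖) (σ : C(Sq, ℝ)) :
    ‖logTrace (μ + ν) g σ - logTrace μ g σ‖
      ≤ ‖g‖ ^ 2 * (4 * c⁻¹ ^ 2 * qForm (diffMeasure ν (μ + ν)) σ) := by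
  obtain ⟨T, hT, hTT⟩ := exists_sqrt_kernelOp (μ + ν)
  obtain ⟨T', hT', hTT'⟩ := exists_sqrt_kernelOp μ
  have hφ := stronglyMeasurable_wave
  have hA : IsMixture wave (μ + ν) (T * T) := hTT ▸ isMixture_fourierKernel (μ + ν)
  have hB : IsMixture wave μ (T' * T') := hTT' ▸ isMixture_fourierKernel μ
  have hC : IsMixture wave ν (T * T - T' * T') := by
    rw [hTT, hTT', kernelOp_add, add_sub_cancel_left]
    exact isMixture_fourierKernel ν
  -- The square roots are compared only through the quadratic forms of their squares, which are
  -- integrals of one nonnegative function over `μ` and over `μ + ν`.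
  have hle : ∀ v, ‖T' v‖ ≤ ‖T v‖ := fun v => by
    refine le_of_sq_le_sq ?_ (norm_nonneg _)
    have hint : ∀ (μ : Measure (ℝ × ℝ)) [IsFiniteMeasure μ],
        Integrable (fun ξ => ‖inner ℂ (wave ξ) v‖ ^ 2) μ := fun μ _ => by
      have hcont : Continuous fun ξ => ‖inner ℂ (wave ξ) v‖ ^ 2 :=
        ((continuous_wave.inner continuous_const).norm).pow 2
      refine Integrable.of_bound hcont.aestronglyMeasurable (‖v‖ ^ 2)
        (Eventually.of_forall fun ξ => ?_)
      rw [Real.norm_of_nonneg (by positivity)]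
      gcongr
      exact (norm_inner_le_norm _ _).trans
        (mul_le_of_le_one_left (norm_nonneg _) (norm_wave_le ξ))
    rw [norm_sq_eq_integral hT hA, norm_sq_eq_integral hT' hB,
      integral_add_measure (hint μ) (hint ν)]
    exact le_add_of_nonneg_right (integral_nonneg fun _ => by positivity)
  have hS := isSelfAdjoint_mulOp σ
  rw [logTrace_eq hT hTT hc hg, logTrace_eq hT' hTT' hc hg]
  refine norm_intervalIntegral_sub_le (intervalIntegrable_logTerm hφ norm_wave_le hT hS hc hg 0 1)
    (intervalIntegrable_logTerm hφ norm_wave_le hT' hS hc hg 0 1) fun s hs => ?_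
  rw [logTerm, logTerm, ← mul_sub, ← mul_sub, norm_mul, norm_mul, norm_pow, Complex.norm_real,
    Real.norm_of_nonneg hs.1, ← integral_norm_sq_eq_qForm (ν := ν) hT hA]
  refine mul_le_mul_of_nonneg_left ?_ (by positivity)
  refine (mul_le_of_le_one_left (norm_nonneg _) hs.2).trans ?_
  exact norm_mixTrace_dressed_sub_propagator hφ norm_wave_le hT hT' hS hB hC hle hc
    (le_norm_one_add_smul hg s)

/-- This serves only to define the interaction at a white noise, so the constant may depend on `g`
and `c` and may be crude. -/
theorem norm_logTrace_sub_le (hc : 0 < c) (hg : ∀ x : ℝ, c ≤ ‖1 + g * x‖) (σ τ : C(Sq, ℝ)) :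
    ‖logTrace μ g σ - logTrace μ g τ‖ ≤ ‖g‖ ^ 2 * (c⁻¹ + ‖g‖ * c⁻¹ ^ 2)
      * √(qForm (diffMeasure μ μ) (σ - τ)) * (1 + √(qForm (diffMeasure μ μ) σ))
      * (1 + √(qForm (diffMeasure μ μ) τ)) := by
  obtain ⟨T, hT, hTT⟩ := exists_sqrt_kernelOp μ
  have hφ := stronglyMeasurable_wave
  have hA : IsMixture wave μ (T * T) := hTT ▸ isMixture_fourierKernel μ
  have hS := isSelfAdjoint_mulOp σ
  have hS' := isSelfAdjoint_mulOp τ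
  rw [logTrace_eq hT hTT hc hg, logTrace_eq hT hTT hc hg]
  refine norm_intervalIntegral_sub_le (intervalIntegrable_logTerm hφ norm_wave_le hT hS hc hg 0 1)
    (intervalIntegrable_logTerm hφ norm_wave_le hT hS' hc hg 0 1) fun s hs => ?_
  rw [logTerm, logTerm, ← mul_sub, ← mul_sub, norm_mul, norm_mul, norm_pow, Complex.norm_real,
    Real.norm_of_nonneg hs.1, mul_assoc (‖g‖ ^ 2), mul_assoc (‖g‖ ^ 2), mul_assoc (‖g‖ ^ 2)]
  refine mul_le_mul_of_nonneg_left ?_ (by positivity)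
  refine (mul_le_of_le_one_left (norm_nonneg _) hs.2).trans ?_
  have h := norm_mixTrace_dressed_sub_field hφ norm_wave_le hT hS hS' hA hc
    (le_norm_one_add_smul hg s)
    (N := fun U => √(∫ ξ, ‖T (U (wave ξ))‖ ^ 2 ∂μ)) (fun _ => rfl)
  beta_reduce at h
  rw [← mulOp_sub, integral_norm_sq_eq_qForm hT hA, integral_norm_sq_eq_qForm hT hA,
    integral_norm_sq_eq_qForm hT hA, norm_mul, Complex.norm_real, Real.norm_of_nonneg hs.1] at h
  refine h.trans ?_
  set a := √(qForm (diffMeasure μ μ) (σ - τ))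
  set b := √(qForm (diffMeasure μ μ) σ)
  set d := √(qForm (diffMeasure μ μ) τ)
  have ha : 0 ≤ a := Real.sqrt_nonneg _
  have hb : 0 ≤ b := Real.sqrt_nonneg _
  have hd : 0 ≤ d := Real.sqrt_nonneg _
  have hci : 0 < c⁻¹ := inv_pos.mpr hc
  have h1 : s * ‖g‖ * c⁻¹ ^ 2 * a * (d * b) ≤ ‖g‖ * c⁻¹ ^ 2 * a * (d * b) := by
    have := mul_le_of_le_one_left (norm_nonneg g) hs.2
    gcongr
  have h2 : 0 ≤ c⁻¹ * a * (1 + b * d) := by positivity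
  have h3 : 0 ≤ ‖g‖ * c⁻¹ ^ 2 * a * (1 + b + d) := by positivity
  nlinarith

end LogTrace

theorem qForm_mono {κ κ' : Measure (ℝ × ℝ)} [IsFiniteMeasure κ'] (h : κ ≤ κ') (σ : C(Sq, ℝ)) :
    qForm κ σ ≤ qForm κ' σ :=
  integral_mono_measure h (Eventually.of_forall fun _ => by positivity)
    (integrable_fourierSq_sq κ' σ)

theorem diffMeasure_mono {μ μ' ν ν' : Measure (ℝ × ℝ)} [SFinite ν] [SFinite ν']
    (h : μ ≤ μ') (h' : ν ≤ ν') : diffMeasure μ ν ≤ diffMeasure μ' ν' :=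
  Measure.map_mono (Measure.prod_mono h h') (by fun_prop)

/-! ### Quadratic forms and their kernels -/

theorem fourierKernel_symm (κ : Measure (ℝ × ℝ)) (x y : Sq) :
    fourierKernel κ y x = conj (fourierKernel κ x y) := by
  rw [fourierKernel, fourierKernel, ← integral_conj]
  refine integral_congr_ae (Eventually.of_forall fun ξ => ?_)
  simp only [map_mul, Complex.conj_conj]
  ring

/-- The phase at a difference of independent frequencies factorizes. Hence `qForm` of such a measure
has a product of two propagators as its kernel. -/
theorem fourierKernel_diffMeasure (μ ν : Measure (ℝ × ℝ)) [IsFiniteMeasure μ] [IsFiniteMeasure ν]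
    (x y : Sq) :
    fourierKernel (diffMeasure μ ν) x y = fourierKernel μ x y * conj (fourierKernel ν x y) := by
  have hmeas : Measurable fun ξ : ℝ × ℝ => phase ξ x * conj (phase ξ y) :=
    (measurable_phase_left x).mul (Complex.continuous_conj.measurable.comp
      (measurable_phase_left y))
  rw [fourierKernel, diffMeasure, integral_map (by fun_prop) hmeas.aestronglyMeasurable,
    fourierKernel, fourierKernel, ← integral_conj, ← integral_prod_mul]
  refine integral_congr_ae (Eventually.of_forall fun p => ?_)
  beta_reduce
  rw [← conj_phase_mul, ← conj_phase_mul]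
  simp only [map_mul, Complex.conj_conj]
  ring

theorem qForm_eq_integral (κ : Measure (ℝ × ℝ)) [IsFiniteMeasure κ] (f : C(Sq, ℝ)) :
    ((qForm κ f : ℝ) : ℂ) = ∫ x, (f x : ℂ) * ∫ y, fourierKernel κ x y * (f y : ℂ) := by
  set F : H := ContinuousMap.toLp 2 volume ℂ (⟨fun x => (f x : ℂ), by fun_prop⟩ : C(Sq, ℂ)) with hF
  have hFc : F =ᵐ[volume] fun x => (f x : ℂ) := ContinuousMap.coeFn_toLp _ _
  have hinner : ∀ ζ, ‖inner ℂ (wave ζ) F‖ = ‖fourierSq f ζ‖ := fun ζ => by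
    rw [inner_wave_left, fourierSq, ← RCLike.norm_conj, ← integral_conj]
    congr 1
    refine integral_congr_ae ?_
    filter_upwards [hFc] with x hx
    rw [hx, map_mul, Complex.conj_conj, Complex.conj_ofReal, mul_comm]
  have e1 : inner ℂ F (kernelOp (fourierKernel κ) F) = ((qForm κ f : ℝ) : ℂ) := by
    rw [isMixture_fourierKernel, qForm, ← integral_complex_ofReal]
    refine integral_congr_ae (Eventually.of_forall fun ζ => ?_)
    beta_reduce
    rw [← inner_conj_symm F, mul_comm, Complex.mul_conj, Complex.normSq_eq_norm_sq, hinner]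
  rw [← e1, inner_eq_integral]
  refine integral_congr_ae ?_
  filter_upwards [hFc, coeFn_kernelOp (continuous_fourierKernel κ) F] with x hx hk
  rw [hx, hk, Complex.conj_ofReal]
  congr 1
  refine integral_congr_ae ?_
  filter_upwards [hFc] with y hy
  rw [hy]

theorem integrable_of_continuous_sq {u : Sq → ℝ} (hu : Continuous u) : Integrable u :=
  hu.integrable_of_hasCompactSupport (HasCompactSupport.of_compactSpace _)

theorem integrable_of_continuous_sq_prod {u : Sq × Sq → ℝ} (hu : Continuous u) :
    Integrable u ((volume : Measure Sq).prod volume) :=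
  hu.integrable_of_hasCompactSupport (HasCompactSupport.of_compactSpace _)

/-- The Schur test. -/
theorem integral_kernel_le {k : Sq → Sq → ℝ} (hk : Continuous fun p : Sq × Sq => k p.1 p.2)
    (hk0 : ∀ x y, 0 ≤ k x y) (hsymm : ∀ x y, k y x = k x y) {N : ℝ} (hN : ∀ x, ∫ y, k x y ≤ N)
    (f : C(Sq, ℝ)) :
    ∫ x, ∫ y, |f x| * (k x y * |f y|) ≤ N * ∫ x, f x ^ 2 := by
  have hkx : ∀ x, Continuous fun y => k x y := fun x => hk.comp (Continuous.prodMk_right x)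
  have hP1 : Integrable (fun p : Sq × Sq => f p.1 ^ 2 * k p.1 p.2)
      ((volume : Measure Sq).prod volume) := integrable_of_continuous_sq_prod (by fun_prop)
  have hP2 : Integrable (fun p : Sq × Sq => f p.2 ^ 2 * k p.1 p.2)
      ((volume : Measure Sq).prod volume) := integrable_of_continuous_sq_prod (by fun_prop)
  have hside : ∫ x, f x ^ 2 * ∫ y, k x y ≤ N * ∫ x, f x ^ 2 := by
    rw [← integral_const_mul]
    refine integral_mono_of_nonneg (Eventually.of_forall fun x =>
      mul_nonneg (sq_nonneg _) (integral_nonneg (hk0 x)))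
      (integrable_of_continuous_sq (by fun_prop)) (Eventually.of_forall fun x => ?_)
    beta_reduce
    rw [mul_comm N]
    exact mul_le_mul_of_nonneg_left (hN x) (by positivity)
  have hI1 : ∫ x, ∫ y, f x ^ 2 * k x y ≤ N * ∫ x, f x ^ 2 := by
    simp only [integral_const_mul]
    exact hside
  have hI2 : ∫ x, ∫ y, f y ^ 2 * k x y ≤ N * ∫ x, f x ^ 2 := by
    rw [integral_integral_swap hP2]
    simp only [integral_const_mul]
    refine le_trans (le_of_eq ?_) hside
    simp only [fun x y => hsymm x y]
  -- The product `|f x| |f y|` is at most half the sum of the squares; the symmetry of `k` makes the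
  -- two halves equal.
  have h4 : ∫ x, ∫ y, |f x| * (k x y * |f y|)
      ≤ ∫ x, ∫ y, (1 / 2 : ℝ) * (f x ^ 2 * k x y + f y ^ 2 * k x y) := by
    rw [← integral_prod (fun p : Sq × Sq => |f p.1| * (k p.1 p.2 * |f p.2|))
      (integrable_of_continuous_sq_prod (by fun_prop)), ← integral_prod (fun p : Sq × Sq =>
      (1 / 2 : ℝ) * (f p.1 ^ 2 * k p.1 p.2 + f p.2 ^ 2 * k p.1 p.2)) ((hP1.add hP2).const_mul _)]
    refine integral_mono (integrable_of_continuous_sq_prod (by fun_prop))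
      ((hP1.add hP2).const_mul _) fun p => ?_
    beta_reduce
    rw [← sq_abs (f p.1), ← sq_abs (f p.2)]
    nlinarith [mul_nonneg (hk0 p.1 p.2) (sq_nonneg (|f p.1| - |f p.2|))]
  have h5 : ∫ x, ∫ y, (1 / 2 : ℝ) * (f x ^ 2 * k x y + f y ^ 2 * k x y)
      = (1 / 2) * ((∫ x, ∫ y, f x ^ 2 * k x y) + ∫ x, ∫ y, f y ^ 2 * k x y) := by
    rw [← integral_add hP1.integral_prod_left hP2.integral_prod_left, ← integral_const_mul]
    refine integral_congr_ae (Eventually.of_forall fun x => ?_)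
    beta_reduce
    have := hkx x
    rw [integral_const_mul, ← integral_add (integrable_of_continuous_sq (by fun_prop))
      (integrable_of_continuous_sq (by fun_prop))]
  refine h4.trans ?_
  rw [h5]
  linarith

theorem qForm_le_of_kernel (κ : Measure (ℝ × ℝ)) [IsFiniteMeasure κ] {N : ℝ}
    (hN : ∀ x, ∫ y, ‖fourierKernel κ x y‖ ≤ N) (f : C(Sq, ℝ)) :
    qForm κ f ≤ N * ∫ x, f x ^ 2 := by
  have hK2 : Continuous fun p : Sq × Sq => ‖fourierKernel κ p.1 p.2‖ :=
    (continuous_fourierKernel κ).norm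
  refine le_trans ?_ (integral_kernel_le hK2 (fun _ _ => norm_nonneg _)
    (fun x y => by rw [fourierKernel_symm, RCLike.norm_conj]) hN f)
  have h3 : ‖((qForm κ f : ℝ) : ℂ)‖ = qForm κ f := by
    rw [Complex.norm_real, Real.norm_of_nonneg (qForm_nonneg κ f)]
  rw [← h3, qForm_eq_integral]
  refine norm_integral_le_of_norm_le ?_ (Eventually.of_forall fun x => ?_)
  · have h := integrable_of_continuous_sq_prod
      (u := fun p => |f p.1| * (‖fourierKernel κ p.1 p.2‖ * |f p.2|)) (by fun_prop)
    exact h.integral_prod_left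
  · rw [norm_mul, Complex.norm_real, Real.norm_eq_abs, integral_const_mul]
    refine mul_le_mul_of_nonneg_left ?_ (abs_nonneg _)
    refine (norm_integral_le_integral_norm _).trans (le_of_eq ?_)
    simp only [norm_mul, Complex.norm_real, Real.norm_eq_abs]

/-! ### The interaction of a slice -/

/-- The spectral measure of the weighted sum of the slices `k < N`. -/
def cutMeasure (M : ℕ) (m : ℝ) (t : ℕ → ℝ) (N : ℕ) : Measure (ℝ × ℝ) :=
  ∑ k ∈ Finset.range N, ENNReal.ofReal (t k) • sliceMeasure M m k

section Slice

variable {M : ℕ} {m : ℝ} {t : ℕ → ℝ}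

theorem isFiniteMeasure_cutMeasure (hM : 2 ≤ M) (hm : 0 < m) (t : ℕ → ℝ) (N : ℕ) :
    IsFiniteMeasure (cutMeasure M m t N) := by
  have := fun j => isFiniteMeasure_sliceMeasure hM hm j
  have h : ∀ k, IsFiniteMeasure (ENNReal.ofReal (t k) • sliceMeasure M m k) := fun k =>
    Measure.smul_finite _ ENNReal.ofReal_ne_top
  unfold cutMeasure
  infer_instance

theorem cutMeasure_succ (t : ℕ → ℝ) (N : ℕ) : cutMeasure M m t (N + 1)
    = cutMeasure M m t N + ENNReal.ofReal (t N) • sliceMeasure M m N :=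
  Finset.sum_range_succ _ _

theorem fourierKernel_cutMeasure (hM : 2 ≤ M) (hm : 0 < m) (ht : ∀ k, 0 ≤ t k) (N : ℕ) (x y : Sq) :
    fourierKernel (cutMeasure M m t N) x y = cutProp M m t N x y := by
  have := fun j => isFiniteMeasure_sliceMeasure hM hm j
  rw [fourierKernel, cutMeasure, integral_finsetSum_measure, cutProp, Complex.ofReal_sum]
  · refine Finset.sum_congr rfl fun k _ => ?_
    rw [integral_smul_measure, ENNReal.toReal_ofReal (ht k), Complex.ofReal_mul,
      ← fourierKernel_sliceMeasure hM hm, Complex.real_smul, fourierKernel]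
  · exact fun k _ => (integrable_phase_mul_conj _ x y).smul_measure ENNReal.ofReal_ne_top

theorem real_univ_eq_fourierKernel (μ : Measure (ℝ × ℝ)) [IsFiniteMeasure μ] (x : Sq) :
    fourierKernel μ x x = μ.real Set.univ := by
  have h1 : ∀ ξ, phase ξ x * conj (phase ξ x) = 1 := fun ξ => by
    rw [mul_comm, conj_phase_mul, sub_self, phase_zero]
  simp [fourierKernel, h1]

theorem fieldOp_eq (hM : 2 ≤ M) (hm : 0 < m) (ht : ∀ k, 0 ≤ t k) (lam : ℂ) (N : ℕ)
    (σ : C(Sq, ℝ)) : fieldOp M m lam t N σ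
      = (2 * Complex.I * sqrtC lam) • (kernelOp (fourierKernel (cutMeasure M m t N)) * mulOp σ) := by
  have := isFiniteMeasure_cutMeasure hM hm t N
  rw [fieldOp, ← kernelOp_mul (continuous_fourierKernel _)]
  congr 2
  ext x y
  rw [fourierKernel_cutMeasure hM hm ht, Complex.ofReal_mul]

theorem fourierSq_zero (σ : C(Sq, ℝ)) : fourierSq σ 0 = ((∫ x, σ x : ℝ) : ℂ) := by
  simp only [fourierSq, phase_zero, mul_one, integral_complex_ofReal]

theorem cutV_eq (hM : 2 ≤ M) (hm : 0 < m) (ht : ∀ k, 0 ≤ t k) (lam : ℂ) (N : ℕ) (σ : C(Sq, ℝ)) :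
    cutV M m lam t N σ = 3 * lam * (cutTadpole M m t N : ℂ) ^ 2
      + 2 * Complex.I * sqrtC lam * (cutTadpole M m t N : ℂ) * fourierSq σ 0
      - (1 / 2) * logTrace (cutMeasure M m t N) (2 * Complex.I * sqrtC lam) σ := by
  rw [cutV, fieldOp_eq hM hm ht, logTrace, integral_add (integrable_const _), fourierSq]
  · simp only [phase_zero, mul_one, integral_const, probReal_univ, one_smul]
    rw [integral_const_mul]
  · refine Integrable.const_mul ?_ _
    simpa [phase_zero] using integrable_ofReal_mul_phase σ 0

theorem cutTadpole_succ (t : ℕ → ℝ) (N : ℕ) :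
    cutTadpole M m t (N + 1) = cutTadpole M m t N + t N * sliceProp M m N 0 0 :=
  Finset.sum_range_succ _ _

theorem sliceV_eq (hM : 2 ≤ M) (hm : 0 < m) (ht : ∀ k, 0 ≤ t k) (lam : ℂ) (j : ℕ) (σ : C(Sq, ℝ)) :
    sliceV M m lam t j σ
      = 3 * lam * ((cutTadpole M m t (j + 1) : ℂ) ^ 2 - (cutTadpole M m t j : ℂ) ^ 2)
      + 2 * Complex.I * sqrtC lam * ((t j * sliceProp M m j 0 0 : ℝ) : ℂ) * fourierSq σ 0
      - (1 / 2) * (logTrace (cutMeasure M m t (j + 1)) (2 * Complex.I * sqrtC lam) σ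
        - logTrace (cutMeasure M m t j) (2 * Complex.I * sqrtC lam) σ) := by
  rw [sliceV, cutV_eq hM hm ht, cutV_eq hM hm ht, cutTadpole_succ]
  push_cast
  ring

theorem norm_coupling_sq (lam : ℂ) : ‖2 * Complex.I * sqrtC lam‖ ^ 2 = 4 * ‖lam‖ := by
  have h : sqrtC lam ^ 2 = lam := by
    rw [sqrtC, one_div]
    exact_mod_cast Complex.cpow_nat_inv_pow lam two_ne_zero
  rw [norm_mul, norm_mul, Complex.norm_I, mul_pow, ← norm_pow (sqrtC lam), h]
  norm_num

/-- Let `θ = Arg λ / 2`. Multiplication by `exp (-iθ)` preserves the norm and sends `1 + 2 i √λ x`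
to `exp (-iθ)` plus an imaginary number, whose real part is `cos θ`. -/
theorem cos_le_norm_one_add (lam : ℂ) (x : ℝ) :
    Real.cos (lam.arg / 2) ≤ ‖1 + (2 * Complex.I * sqrtC lam) * x‖ := by
  rcases eq_or_ne lam 0 with rfl | h0
  · simp [sqrtC]
  set θ := lam.arg / 2 with hθ
  set r := Real.exp (Real.log ‖lam‖ / 2)
  have hs : sqrtC lam = r * Complex.exp (θ * Complex.I) := by
    rw [sqrtC, Complex.cpow_def_of_ne_zero h0, Complex.log, Complex.ofReal_exp, ← Complex.exp_add,
      hθ]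
    congr 1
    push_cast
    ring
  have h1 : Complex.exp (-(θ * Complex.I)) * Complex.exp (θ * Complex.I) = 1 := by
    rw [← Complex.exp_add, neg_add_cancel, Complex.exp_zero]
  have hn : ‖Complex.exp (-(θ * Complex.I))‖ = 1 := by
    have := Complex.norm_exp_ofReal_mul_I (-θ)
    rwa [Complex.ofReal_neg, neg_mul] at this
  have h2 : Complex.exp (-(θ * Complex.I)) * (1 + (2 * Complex.I * sqrtC lam) * x)
      = Complex.exp (((-θ : ℝ) : ℂ) * Complex.I) + ((2 * r * x : ℝ) : ℂ) * Complex.I := by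
    rw [hs, Complex.ofReal_neg, neg_mul]
    push_cast
    linear_combination (2 * Complex.I * r * x) * h1
  calc Real.cos θ = (Complex.exp (-(θ * Complex.I)) * (1 + (2 * Complex.I * sqrtC lam) * x)).re := by
        rw [h2, Complex.add_re, Complex.exp_ofReal_mul_I_re, Real.cos_neg]
        simp
    _ ≤ ‖Complex.exp (-(θ * Complex.I)) * (1 + (2 * Complex.I * sqrtC lam) * x)‖ :=
        Complex.re_le_norm _
    _ = _ := by rw [norm_mul, hn, one_mul]

theorem cos_half_arg_pos {ρ : ℝ} {lam : ℂ} (h : lam ∈ cardioid ρ) :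
    0 < Real.cos (lam.arg / 2) := by
  have h1 : 0 ≤ Real.cos (lam.arg / 2) := by
    refine Real.cos_nonneg_of_neg_pi_div_two_le_of_le ?_ ?_
    · linarith [Complex.neg_pi_lt_arg lam]
    · linarith [Complex.arg_le_pi lam]
  refine lt_of_le_of_ne h1 fun h0 => ?_
  have h2 : ‖lam‖ < ρ * Real.cos (lam.arg / 2) ^ 2 := h
  rw [← h0] at h2
  simp only [ne_eq, OfNat.ofNat_ne_zero, not_false_eq_true, zero_pow, mul_zero] at h2
  exact absurd h2 (not_lt.mpr (norm_nonneg lam))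

theorem norm_lam_lt {ρ : ℝ} (hρ : 0 < ρ) {lam : ℂ} (h : lam ∈ cardioid ρ) : ‖lam‖ < ρ := by
  have h2 : ‖lam‖ < ρ * Real.cos (lam.arg / 2) ^ 2 := h
  nlinarith [Real.cos_sq_le_one (lam.arg / 2)]

theorem one_mem_Icc (k : ℕ) : (1 : ℕ → ℝ) k ∈ Set.Icc (0 : ℝ) 1 := by simp

/-- The spectral measure of the kernel `C_j C_{≤ j}`. -/
def pairMeasure (M : ℕ) (m : ℝ) (j : ℕ) : Measure (ℝ × ℝ) :=
  diffMeasure (sliceMeasure M m j) (cutMeasure M m 1 (j + 1))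

theorem isFiniteMeasure_pairMeasure (hM : 2 ≤ M) (hm : 0 < m) (j : ℕ) :
    IsFiniteMeasure (pairMeasure M m j) := by
  have := isFiniteMeasure_sliceMeasure hM hm j
  have := isFiniteMeasure_cutMeasure hM hm 1 (j + 1)
  unfold pairMeasure
  infer_instance

theorem fourierKernel_pairMeasure (hM : 2 ≤ M) (hm : 0 < m) (j : ℕ) (x y : Sq) :
    fourierKernel (pairMeasure M m j) x y
      = ((sliceProp M m j x y * cutProp M m 1 (j + 1) x y : ℝ) : ℂ) := by
  have := isFiniteMeasure_sliceMeasure hM hm j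
  have := isFiniteMeasure_cutMeasure hM hm 1 (j + 1)
  rw [pairMeasure, fourierKernel_diffMeasure, fourierKernel_sliceMeasure hM hm,
    fourierKernel_cutMeasure hM hm (fun k => (one_mem_Icc k).1), Complex.conj_ofReal, Complex.ofReal_mul]

theorem cutProp_nonneg (hM : 2 ≤ M) (m : ℝ) (ht : ∀ k, 0 ≤ t k) (N : ℕ) (x y : Sq) :
    0 ≤ cutProp M m t N x y :=
  Finset.sum_nonneg fun k _ => mul_nonneg (ht k) (sliceProp_nonneg hM m k x y)

theorem cutProp_le (hM : 2 ≤ M) (hm : 0 < m) {τ : ℝ} (hτ : ∀ j, sliceProp M m j 0 0 ≤ τ)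
    (ht : ∀ k, t k ∈ Set.Icc (0 : ℝ) 1) (N : ℕ) (x y : Sq) : cutProp M m t N x y ≤ N * τ := by
  calc cutProp M m t N x y ≤ ∑ k ∈ Finset.range N, τ :=
        Finset.sum_le_sum fun k _ => (mul_le_of_le_one_left (sliceProp_nonneg hM m k x y)
          (ht k).2).trans ((sliceProp_le hM hm k x y).trans (hτ k))
    _ = N * τ := by simp

/-- The mass of a spectral measure is its kernel on the diagonal, here `T_j T_{≤ j}`. It plays the
role of the trace of the quadratic form. -/
theorem real_pairMeasure_univ_le (hM : 2 ≤ M) (hm : 0 < m) {τ : ℝ}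
    (hτ : ∀ j, sliceProp M m j 0 0 ≤ τ) (j : ℕ) :
    (pairMeasure M m j).real Set.univ ≤ τ ^ 2 * (j + 1) := by
  have := isFiniteMeasure_pairMeasure hM hm j
  have h := real_univ_eq_fourierKernel (pairMeasure M m j) 0
  rw [fourierKernel_pairMeasure hM hm, Complex.ofReal_inj] at h
  rw [← h]
  have h1 := cutProp_le hM hm hτ one_mem_Icc (j + 1) 0 0
  push_cast at h1
  have h0 := sliceProp_nonneg hM m j 0 0
  calc _ ≤ τ * ((j + 1) * τ) := by
        refine mul_le_mul (hτ j) h1 (cutProp_nonneg hM m (fun k => (one_mem_Icc k).1) _ _ _)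
          (h0.trans (hτ j))
    _ = _ := by ring

/-- Schur test with `C_{≤ j} ≤ (j + 1) τ` pointwise and the mass of `C_j`. The factor `4^(-j)` is
what later leaves room for Hölder exponents of order `2^j`. -/
theorem qForm_pairMeasure_le (hM : 2 ≤ M) (hm : 0 < m) {τ υ : ℝ}
    (hτ : ∀ j, sliceProp M m j 0 0 ≤ τ) (hυ : ∀ j x, ∫ y, sliceProp M m j x y ≤ υ * (1 / 4) ^ j)
    (j : ℕ) (f : C(Sq, ℝ)) :
    qForm (pairMeasure M m j) f ≤ (τ * υ * ((j + 1) * (1 / 4) ^ j)) * ∫ x, f x ^ 2 := by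
  have := isFiniteMeasure_pairMeasure hM hm j
  have := isFiniteMeasure_sliceMeasure hM hm j
  refine qForm_le_of_kernel _ (fun x => ?_) f
  have hτ0 : 0 ≤ τ := (sliceProp_nonneg hM m j 0 0).trans (hτ j)
  have hc : Continuous fun y => sliceProp M m j x y := by
    have h := ((continuous_fourierKernel (sliceMeasure M m j)).comp
      (Continuous.prodMk_right x))
    have h2 : (fun y => sliceProp M m j x y)
        = fun y => (fourierKernel (sliceMeasure M m j) x y).re := by
      ext y
      rw [fourierKernel_sliceMeasure hM hm, Complex.ofReal_re]
    rw [h2]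
    exact Complex.continuous_re.comp h
  calc ∫ y, ‖fourierKernel (pairMeasure M m j) x y‖
      ≤ ∫ y, ((j + 1) * τ) * sliceProp M m j x y := by
        refine integral_mono_of_nonneg (Eventually.of_forall fun y => norm_nonneg _)
          ((hc.integrable_of_hasCompactSupport
            (HasCompactSupport.of_compactSpace _)).const_mul _) (Eventually.of_forall fun y => ?_)
        beta_reduce
        rw [fourierKernel_pairMeasure hM hm, Complex.norm_real, Real.norm_of_nonneg
          (mul_nonneg (sliceProp_nonneg hM m j x y)
            (cutProp_nonneg hM m (fun k => (one_mem_Icc k).1) _ _ _)), mul_comm]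
        refine mul_le_mul_of_nonneg_right ?_ (sliceProp_nonneg hM m j x y)
        have := cutProp_le hM hm hτ one_mem_Icc (j + 1) x y
        push_cast at this
        exact this
    _ = ((j + 1) * τ) * ∫ y, sliceProp M m j x y := integral_const_mul _ _
    _ ≤ ((j + 1) * τ) * (υ * (1 / 4) ^ j) := by
        gcongr
        exact hυ j x
    _ = _ := by ring

theorem smul_sliceMeasure_le {a : ℝ} (ha : a ≤ 1) (k : ℕ) :
    ENNReal.ofReal a • sliceMeasure M m k ≤ sliceMeasure M m k := by
  have h : ENNReal.ofReal a ≤ 1 := ENNReal.ofReal_le_one.mpr ha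
  calc _ ≤ (1 : ENNReal) • sliceMeasure M m k := by gcongr
    _ = _ := one_smul _ _

theorem cutMeasure_le_one (ht : ∀ k, t k ∈ Set.Icc (0 : ℝ) 1) (N : ℕ) :
    cutMeasure M m t N ≤ cutMeasure M m 1 N := by
  refine Finset.sum_le_sum fun k _ => ?_
  have h := smul_sliceMeasure_le (M := M) (m := m) (ht k).2 k
  simpa using h

/-- The interaction of the slice `j` is linear in the field up to a bounded quadratic form. -/
theorem norm_sliceV_sub_linear_le (hM : 2 ≤ M) (hm : 0 < m) {τ : ℝ}
    (hτ : ∀ j, sliceProp M m j 0 0 ≤ τ) {ρ : ℝ} (hρ : 0 < ρ) {lam : ℂ} (hlam : lam ∈ cardioid ρ)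
    (ht : ∀ k, t k ∈ Set.Icc (0 : ℝ) 1) (j : ℕ) (σ : C(Sq, ℝ)) :
    ‖sliceV M m lam t j σ
      - 2 * Complex.I * sqrtC lam * ((t j * sliceProp M m j 0 0 * ∫ x, σ x : ℝ) : ℂ)‖
      ≤ ρ * (6 * τ ^ 2 * (j + 1) + 8 * qForm (pairMeasure M m j) σ) := by
  have := isFiniteMeasure_pairMeasure hM hm j
  have := isFiniteMeasure_cutMeasure hM hm t j
  have := isFiniteMeasure_cutMeasure hM hm 1 (j + 1)
  have := isFiniteMeasure_sliceMeasure hM hm j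
  have : IsFiniteMeasure (ENNReal.ofReal (t j) • sliceMeasure M m j) :=
    Measure.smul_finite _ ENNReal.ofReal_ne_top
  have ht0 : ∀ k, 0 ≤ t k := fun k => (ht k).1
  have hτ0 : 0 ≤ τ := (sliceProp_nonneg hM m j 0 0).trans (hτ j)
  set g := 2 * Complex.I * sqrtC lam with hg
  have hc := cos_half_arg_pos hlam
  have hlog := norm_logTrace_add_sub_le (μ := cutMeasure M m t j)
    (ν := ENNReal.ofReal (t j) • sliceMeasure M m j) hc (cos_le_norm_one_add lam) σ
  rw [← cutMeasure_succ, ← hg] at hlog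
  -- Raising all weights to `1` increases the spectral measures, so the bound is uniform in `t`.
  have hq : qForm (diffMeasure (ENNReal.ofReal (t j) • sliceMeasure M m j)
      (cutMeasure M m t (j + 1))) σ ≤ qForm (pairMeasure M m j) σ := by
    have := isFiniteMeasure_cutMeasure hM hm t (j + 1)
    exact qForm_mono (diffMeasure_mono (smul_sliceMeasure_le (ht j).2 j)
      (cutMeasure_le_one ht (j + 1))) σ
  have hq0 := qForm_nonneg (pairMeasure M m j) σ
  -- The cardioid condition reads `|λ| / cos² (Arg λ / 2) < ρ`: it pays for the two resolvents.
  have hgc : ‖g‖ ^ 2 * (4 * (Real.cos (lam.arg / 2))⁻¹ ^ 2 * qForm (pairMeasure M m j) σ)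
      ≤ 16 * ρ * qForm (pairMeasure M m j) σ := by
    rw [hg, norm_coupling_sq]
    have h1 : ‖lam‖ * (Real.cos (lam.arg / 2))⁻¹ ^ 2 ≤ ρ := by
      rw [inv_pow, ← div_eq_mul_inv, div_le_iff₀ (by positivity)]
      exact hlam.le
    nlinarith [mul_le_mul_of_nonneg_right h1 hq0]
  have hlog2 : ‖logTrace (cutMeasure M m t (j + 1)) g σ - logTrace (cutMeasure M m t j) g σ‖
      ≤ 16 * ρ * qForm (pairMeasure M m j) σ := hlog.trans (le_trans (by gcongr) hgc)
  have htad : ‖3 * lam * ((cutTadpole M m t (j + 1) : ℂ) ^ 2 - (cutTadpole M m t j : ℂ) ^ 2)‖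
      ≤ ρ * (6 * τ ^ 2 * (j + 1)) := by
    -- In this difference of squares one factor is a single slice, hence a growth in `j + 1` and not
    -- in its square.
    have e : (cutTadpole M m t (j + 1) : ℂ) ^ 2 - (cutTadpole M m t j : ℂ) ^ 2
        = (((t j * sliceProp M m j 0 0) *
          (cutTadpole M m t (j + 1) + cutTadpole M m t j) : ℝ) : ℂ) := by
      rw [cutTadpole_succ]
      push_cast
      ring
    have h1 : 0 ≤ t j * sliceProp M m j 0 0 := mul_nonneg (ht0 j) (sliceProp_nonneg hM m j 0 0)
    have h2 : t j * sliceProp M m j 0 0 ≤ τ :=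
      (mul_le_of_le_one_left (sliceProp_nonneg hM m j 0 0) (ht j).2).trans (hτ j)
    have h3 : 0 ≤ cutTadpole M m t (j + 1) := cutProp_nonneg hM m ht0 _ _ _
    have h4 : 0 ≤ cutTadpole M m t j := cutProp_nonneg hM m ht0 _ _ _
    have h5 : cutTadpole M m t (j + 1) ≤ (j + 1) * τ := by
      have := cutProp_le hM hm hτ ht (j + 1) 0 0
      push_cast at this
      exact this
    have h6 : cutTadpole M m t j ≤ (j + 1) * τ :=
      (cutProp_le hM hm hτ ht j 0 0).trans (by nlinarith)
    rw [e, norm_mul, norm_mul, Complex.norm_real, Real.norm_of_nonneg (by positivity)]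
    have h7 : (t j * sliceProp M m j 0 0) * (cutTadpole M m t (j + 1) + cutTadpole M m t j)
        ≤ τ * (2 * ((j + 1) * τ)) := by
      refine mul_le_mul h2 (by linarith) (by positivity) hτ0
    calc ‖(3 : ℂ)‖ * ‖lam‖ * ((t j * sliceProp M m j 0 0)
          * (cutTadpole M m t (j + 1) + cutTadpole M m t j))
        ≤ 3 * ρ * (τ * (2 * ((j + 1) * τ))) := by
          have := (norm_lam_lt hρ hlam).le
          have h9 : ‖(3 : ℂ)‖ = 3 := by norm_num
          rw [h9]
          gcongr
      _ = _ := by ring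
  rw [sliceV_eq hM hm ht0, fourierSq_zero, ← hg]
  have hsplit : ∀ a b d e : ℂ, a + b - 1 / 2 * (d - e) - b = a - 1 / 2 * (d - e) := by
    intro a b d e
    ring
  rw [Complex.ofReal_mul (t j * sliceProp M m j 0 0), ← mul_assoc, hsplit]
  refine (norm_sub_le _ _).trans ?_
  rw [norm_mul (1 / 2 : ℂ)]
  have h12 : ‖(1 / 2 : ℂ)‖ = 1 / 2 := by norm_num
  rw [h12]
  nlinarith

/-- The measure whose quadratic form controls the continuity of the interaction. -/
def controlMeasure (M : ℕ) (m : ℝ) (t : ℕ → ℝ) (j : ℕ) : Measure (ℝ × ℝ) :=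
  Measure.dirac 0 + (diffMeasure (cutMeasure M m t (j + 1)) (cutMeasure M m t (j + 1))
    + diffMeasure (cutMeasure M m t j) (cutMeasure M m t j))

theorem isFiniteMeasure_controlMeasure (hM : 2 ≤ M) (hm : 0 < m) (t : ℕ → ℝ) (j : ℕ) :
    IsFiniteMeasure (controlMeasure M m t j) := by
  have := fun j => isFiniteMeasure_cutMeasure hM hm t j
  unfold controlMeasure
  infer_instance

/-- The point mass at `0` in the control measure handles the linear term, since `∫ σ` is the Fourier
transform of `σ` at `0`; the two other measures handle the two logarithms. -/
theorem sliceV_lipschitz (hM : 2 ≤ M) (hm : 0 < m) {ρ : ℝ} {lam : ℂ} (hlam : lam ∈ cardioid ρ)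
    (ht : ∀ k, 0 ≤ t k) (j : ℕ) :
    ∃ L : ℝ, 0 ≤ L ∧ ∀ σ σ' : C(Sq, ℝ), ‖sliceV M m lam t j σ - sliceV M m lam t j σ'‖
      ≤ L * √(qForm (controlMeasure M m t j) (σ - σ'))
        * (1 + √(qForm (controlMeasure M m t j) σ)) * (1 + √(qForm (controlMeasure M m t j) σ')) := by
  have := fun j => isFiniteMeasure_cutMeasure hM hm t j
  have := isFiniteMeasure_controlMeasure hM hm t j
  set g := 2 * Complex.I * sqrtC lam with hg
  set κ := controlMeasure M m t j with hκ
  have hc := cos_half_arg_pos hlam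
  have hgc := cos_le_norm_one_add lam
  rw [← hg] at hgc
  set c := Real.cos (lam.arg / 2)
  set K := ‖g‖ ^ 2 * (c⁻¹ + ‖g‖ * c⁻¹ ^ 2)
  have hK : 0 ≤ K := by positivity
  have h0 : ∀ σ, ‖fourierSq σ 0‖ ≤ √(qForm κ σ) := fun σ => by
    refine Real.le_sqrt_of_sq_le ?_
    have : qForm (Measure.dirac 0) σ ≤ qForm κ σ :=
      qForm_mono (Measure.le_add_right le_rfl) σ
    refine le_trans (le_of_eq ?_) this
    rw [qForm, integral_dirac]
  have h1 : ∀ σ, qForm (diffMeasure (cutMeasure M m t (j + 1)) (cutMeasure M m t (j + 1))) σ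
      ≤ qForm κ σ := fun σ =>
    qForm_mono (Measure.le_add_left (Measure.le_add_right le_rfl)) σ
  have h2 : ∀ σ, qForm (diffMeasure (cutMeasure M m t j) (cutMeasure M m t j)) σ
      ≤ qForm κ σ := fun σ =>
    qForm_mono (Measure.le_add_left (Measure.le_add_left le_rfl)) σ
  refine ⟨‖g‖ * |t j * sliceProp M m j 0 0| + K, by positivity, fun σ σ' => ?_⟩
  have hl1 := norm_logTrace_sub_le (μ := cutMeasure M m t (j + 1)) hc hgc σ σ'
  have hl2 := norm_logTrace_sub_le (μ := cutMeasure M m t j) hc hgc σ σ'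
  set d := √(qForm κ (σ - σ'))
  set a := √(qForm κ σ)
  set b := √(qForm κ σ')
  have hd : 0 ≤ d := Real.sqrt_nonneg _
  have ha : 0 ≤ a := Real.sqrt_nonneg _
  have hb : 0 ≤ b := Real.sqrt_nonneg _
  have hl1' : ‖logTrace (cutMeasure M m t (j + 1)) g σ - logTrace (cutMeasure M m t (j + 1)) g σ'‖
      ≤ K * d * (1 + a) * (1 + b) := hl1.trans (by gcongr <;> exact Real.sqrt_le_sqrt (h1 _))
  have hl2' : ‖logTrace (cutMeasure M m t j) g σ - logTrace (cutMeasure M m t j) g σ'‖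
      ≤ K * d * (1 + a) * (1 + b) := hl2.trans (by gcongr <;> exact Real.sqrt_le_sqrt (h2 _))
  have hlin : ‖g * ((t j * sliceProp M m j 0 0 : ℝ) : ℂ) * (fourierSq (σ - σ') 0)‖
      ≤ ‖g‖ * |t j * sliceProp M m j 0 0| * d := by
    rw [norm_mul, norm_mul, Complex.norm_real, Real.norm_eq_abs]
    gcongr
    exact h0 _
  rw [sliceV_eq hM hm ht, sliceV_eq hM hm ht, ← hg]
  have e : ∀ a b f f' p q p' q' : ℂ, a + b * f - 1 / 2 * (p - q) - (a + b * f' - 1 / 2 * (p' - q'))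
      = b * (f - f') - 1 / 2 * (p - p') + 1 / 2 * (q - q') := by
    intros
    ring
  rw [e, ← fourierSq_sub]
  have h12 : ‖(1 / 2 : ℂ)‖ = 1 / 2 := by norm_num
  refine (norm_add_le _ _).trans ((add_le_add_left (norm_sub_le _ _) _).trans ?_)
  rw [norm_mul (1 / 2 : ℂ), norm_mul (1 / 2 : ℂ), h12]
  have hgt : 0 ≤ ‖g‖ * |t j * sliceProp M m j 0 0| * d := by positivity
  have hone : 1 ≤ (1 + a) * (1 + b) := by nlinarith [mul_nonneg ha hb]
  have := mul_le_mul_of_nonneg_left hone hgt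
  nlinarith

end Slice

/-! ### Gaussian exponential moments of quadratic forms -/

/-- Squared, this follows from `exp (4a) ≥ 1 + 4a` and `(1 + 4a) (1 - 2a) = 1 + 2a (1 - 4a) ≥ 1`,
which is where `a ≤ 1/4` is needed. -/
theorem one_div_sqrt_le_exp {a : ℝ} (h0 : 0 ≤ a) (h1 : a ≤ 1 / 4) :
    √(1 / (1 - 2 * a)) ≤ Real.exp (2 * a) := by
  have h2 : 0 < 1 - 2 * a := by linarith
  refine Real.sqrt_le_iff.mpr ⟨(Real.exp_pos _).le, ?_⟩
  rw [div_le_iff₀ h2, ← Real.exp_nat_mul]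
  have h3 := Real.add_one_le_exp (((2 : ℕ) : ℝ) * (2 * a))
  push_cast at h3 ⊢
  nlinarith

theorem lintegral_exp_mul_sq_gaussianReal_le {a : ℝ} (h0 : 0 ≤ a) (h1 : a ≤ 1 / 4) :
    ∫⁻ y, ENNReal.ofReal (Real.exp (a * y ^ 2)) ∂gaussianReal 0 1
      ≤ ENNReal.ofReal (Real.exp (2 * a)) := by
  have h2 : 0 < 1 - 2 * a := by linarith
  have hpdf : ∀ y : ℝ, gaussianPDFReal 0 1 y * Real.exp (a * y ^ 2)
      = (√(2 * Real.pi))⁻¹ * Real.exp (-((1 - 2 * a) / 2) * y ^ 2) := fun y => by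
    rw [gaussianPDFReal, mul_assoc, ← Real.exp_add]
    congr 2
    · simp
    · push_cast
      ring
  have hint : Integrable fun y : ℝ => gaussianPDFReal 0 1 y * Real.exp (a * y ^ 2) := by
    simp only [hpdf]
    exact (integrable_exp_neg_mul_sq (by linarith)).const_mul _
  rw [gaussianReal_of_var_ne_zero 0 one_ne_zero, lintegral_withDensity_eq_lintegral_mul _
    (measurable_gaussianPDF 0 1) (by fun_prop)]
  have e : ∀ y, (gaussianPDF 0 1 * fun y : ℝ => ENNReal.ofReal (Real.exp (a * y ^ 2))) y
      = ENNReal.ofReal (gaussianPDFReal 0 1 y * Real.exp (a * y ^ 2)) := fun y => by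
    rw [Pi.mul_apply, gaussianPDF, ENNReal.ofReal_mul (gaussianPDFReal_nonneg 0 1 y)]
  simp only [e]
  rw [← ofReal_integral_eq_lintegral_ofReal hint (Eventually.of_forall fun y =>
    mul_nonneg (gaussianPDFReal_nonneg 0 1 y) (Real.exp_nonneg _))]
  refine ENNReal.ofReal_le_ofReal ?_
  simp only [hpdf]
  rw [integral_const_mul, integral_gaussian, ← Real.sqrt_inv, ← Real.sqrt_mul (by positivity)]
  refine le_trans (le_of_eq ?_) (one_div_sqrt_le_exp h0 h1)
  congr 1
  have := Real.pi_pos.ne'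
  field_simp

section Quadratic

variable {Ω ι : Type*} [MeasurableSpace Ω] {P : Measure Ω} [Fintype ι] [DecidableEq ι]

theorem hasGaussianLaw_sum_mul {X : ι → Ω → ℝ} (hX : HasGaussianLaw (fun ω i => X i ω) P)
    {κ : Type*} [Fintype κ] (u : κ → ι → ℝ) :
    HasGaussianLaw (fun ω k => ∑ i, u k i * X i ω) P := by
  have h := hX.map_fun (ContinuousLinearMap.pi fun k =>
    ∑ i, u k i • (ContinuousLinearMap.proj (R := ℝ) (φ := fun _ : ι => ℝ) i))
  have e : ∀ ω, (ContinuousLinearMap.pi fun k => ∑ i, u k i •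
      (ContinuousLinearMap.proj (R := ℝ) (φ := fun _ : ι => ℝ) i)) (fun i => X i ω)
      = fun k => ∑ i, u k i * X i ω := fun ω => by
    ext k
    simp
  simpa only [e] using h

theorem integral_sum_mul_sum {X : ι → Ω → ℝ} (hX : HasGaussianLaw (fun ω i => X i ω) P)
    (hcov : ∀ i k, ∫ ω, X i ω * X k ω ∂P = if i = k then 1 else 0) (u v : ι → ℝ) :
    ∫ ω, (∑ i, u i * X i ω) * (∑ i, v i * X i ω) ∂P = ∑ i, u i * v i := by
  have hL : ∀ i, MemLp (X i) 2 P := fun i => (hX.eval i).memLp_two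
  have hint : ∀ i k, Integrable (fun ω => X i ω * X k ω) P := fun i k =>
    (hL i).integrable_mul (hL k)
  have e : ∀ ω, (∑ i, u i * X i ω) * (∑ i, v i * X i ω)
      = ∑ i, ∑ k, (u i * v k) * (X i ω * X k ω) := fun ω => by
    rw [Finset.sum_mul_sum]
    exact Finset.sum_congr rfl fun i _ => Finset.sum_congr rfl fun k _ => by ring
  simp only [e]
  rw [integral_finsetSum _ fun i _ => integrable_finsetSum _ fun k _ => (hint i k).const_mul _]
  refine Finset.sum_congr rfl fun i _ => ?_
  rw [integral_finsetSum _ fun k _ => (hint i k).const_mul _]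
  simp only [integral_const_mul, hcov]
  simp

theorem quadratic_eq_sum_eigenvalues {Q : Matrix ι ι ℝ} (hQ : Q.IsHermitian) (x : ι → ℝ) :
    x ⬝ᵥ Q.mulVec x = ∑ k, hQ.eigenvalues k * (∑ i, hQ.eigenvectorBasis k i * x i) ^ 2 := by
  set b := hQ.eigenvectorBasis
  have h1 := b.sum_inner_mul_inner (WithLp.toLp 2 x) (WithLp.toLp 2 (Q.mulVec x))
  have h2 : ∀ u v : EuclideanSpace ℝ ι, inner ℝ u v = ∑ i, u i * v i := fun u v => by
    rw [PiLp.inner_apply]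
    exact Finset.sum_congr rfl fun i _ => by simp [mul_comm]
  have h3 : ∀ k, inner ℝ (b k) (WithLp.toLp 2 (Q.mulVec x))
      = hQ.eigenvalues k * ∑ i, b k i * x i := fun k => by
    have h4 : (⇑(b k) : ι → ℝ) ⬝ᵥ Q.mulVec x = Q.mulVec (⇑(b k)) ⬝ᵥ x := by
      rw [Matrix.dotProduct_mulVec, ← Matrix.mulVec_transpose]
      have : Q.transpose = Q := by simpa using hQ.eq
      rw [this]
    have h5 : Q.mulVec (⇑(b k)) = hQ.eigenvalues k • ⇑(b k) := hQ.mulVec_eigenvectorBasis k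
    rw [h2]
    change (⇑(b k) : ι → ℝ) ⬝ᵥ Q.mulVec x = _
    rw [h4, h5, smul_dotProduct]
    rfl
  simp only [h3] at h1
  rw [h2] at h1
  change _ = x ⬝ᵥ Q.mulVec x at h1
  rw [← h1]
  refine Finset.sum_congr rfl fun k _ => ?_
  rw [h2]
  have : ∑ i, (WithLp.toLp 2 x : EuclideanSpace ℝ ι) i * b k i = ∑ i, b k i * x i :=
    Finset.sum_congr rfl fun i _ => mul_comm _ _
  rw [this]
  ring

/-- In an eigenbasis of `Q` the coordinates are uncorrelated and jointly Gaussian, hence independent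
standard variables. The integral factorizes over the eigenvalues `q_k`, with factors at most `exp (2
ε q_k)`, and the `q_k` sum to the trace. -/
theorem lintegral_exp_quadratic_le [IsProbabilityMeasure P] {X : ι → Ω → ℝ}
    (hX : HasGaussianLaw (fun ω i => X i ω) P)
    (hmean : ∀ i, ∫ ω, X i ω ∂P = 0)
    (hcov : ∀ i k, ∫ ω, X i ω * X k ω ∂P = if i = k then 1 else 0)
    {Q : Matrix ι ι ℝ} (hQ : Q.IsHermitian) {N ε : ℝ} (hpos : ∀ x, 0 ≤ x ⬝ᵥ Q.mulVec x)
    (hle : ∀ x, x ⬝ᵥ Q.mulVec x ≤ N * ∑ i, x i ^ 2) (hε : 0 ≤ ε) (hεN : ε * N ≤ 1 / 4) :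
    ∫⁻ ω, ENNReal.ofReal (Real.exp (ε * ((fun i => X i ω) ⬝ᵥ Q.mulVec fun i => X i ω))) ∂P
      ≤ ENNReal.ofReal (Real.exp (2 * ε * Q.trace)) := by
  set b := hQ.eigenvectorBasis with hb
  set q := hQ.eigenvalues with hq
  set Y : ι → Ω → ℝ := fun k ω => ∑ i, b k i * X i ω with hYdef
  have hY : HasGaussianLaw (fun ω k => Y k ω) P := hasGaussianLaw_sum_mul hX fun k i => b k i
  have hbb : ∀ k l, ∑ i, b k i * b l i = if k = l then 1 else 0 := fun k l => by
    have := orthonormal_iff_ite.mp b.orthonormal k l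
    rw [PiLp.inner_apply] at this
    rw [← this]
    exact Finset.sum_congr rfl fun i _ => by simp [mul_comm]
  have hYY : ∀ k l, ∫ ω, Y k ω * Y l ω ∂P = if k = l then 1 else 0 := fun k l => by
    rw [← hbb k l]
    exact integral_sum_mul_sum hX hcov _ _
  have hYmean : ∀ k, ∫ ω, Y k ω ∂P = 0 := fun k => by
    simp only [hYdef]
    rw [integral_finsetSum _ fun i _ => ((hX.eval i).integrable.const_mul _)]
    simp [integral_const_mul, hmean]
  have hqk : ∀ k, q k = (fun i => b k i) ⬝ᵥ Q.mulVec fun i => b k i := fun k => by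
    rw [quadratic_eq_sum_eigenvalues hQ, Finset.sum_eq_single k]
    · rw [← hb, hbb k k, if_pos rfl]
      ring
    · intro l _ hl
      rw [← hb, hbb l k, if_neg hl]
      ring
    · simp
  have hq0 : ∀ k, 0 ≤ q k := fun k => (hqk k).symm ▸ hpos _
  have hqN : ∀ k, ε * q k ≤ 1 / 4 := fun k => by
    have h1 := hle fun i => b k i
    rw [← hqk] at h1
    have h2 := hbb k k
    simp only [if_true, ← pow_two] at h2
    rw [h2, mul_one] at h1
    exact (mul_le_mul_of_nonneg_left h1 hε).trans hεN
  have hlaw : ∀ k, P.map (Y k) = gaussianReal 0 1 := fun k => by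
    have h := (hY.eval k).map_eq_gaussianReal
    have hv : Var[Y k; P] = 1 := by
      rw [variance_of_integral_eq_zero (hY.eval k).aemeasurable (hYmean k)]
      simpa [pow_two] using hYY k k
    rw [h, hYmean k, hv, Real.toNNReal_one]
  have hind : iIndepFun Y P := by
    refine hY.iIndepFun_of_covariance_eq_zero fun k l hkl => ?_
    rw [covariance_eq_sub (hY.eval k).memLp_two (hY.eval l).memLp_two, hYmean k, zero_mul, sub_zero]
    have := hYY k l
    rw [if_neg hkl] at this
    exact this
  have hYm : ∀ k, AEMeasurable (Y k) P := fun k => (hY.eval k).aemeasurable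
  -- The variables are only almost everywhere measurable; the factorization is carried out on
  -- measurable representatives.
  have hindep := (hind.congr fun k => (hYm k).ae_eq_mk).comp
    (fun k (y : ℝ) => ENNReal.ofReal (Real.exp ((ε * q k) * y ^ 2))) (fun k => by fun_prop)
  have hsplit : ∀ ω, ENNReal.ofReal (Real.exp (ε * ((fun i => X i ω) ⬝ᵥ
      Q.mulVec fun i => X i ω))) = ∏ k, ENNReal.ofReal (Real.exp ((ε * q k) * Y k ω ^ 2)) := by
    intro ω
    rw [quadratic_eq_sum_eigenvalues hQ, Finset.mul_sum, Real.exp_sum,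
      ENNReal.ofReal_prod_of_nonneg fun k _ => Real.exp_nonneg _]
    refine Finset.prod_congr rfl fun k _ => ?_
    rw [← mul_assoc]
  have hae : ∀ᵐ ω ∂P, ∀ k, Y k ω = (hYm k).mk (Y k) ω := ae_all_iff.mpr fun k => (hYm k).ae_eq_mk
  calc ∫⁻ ω, ENNReal.ofReal (Real.exp (ε * ((fun i => X i ω) ⬝ᵥ Q.mulVec fun i => X i ω))) ∂P
      = ∫⁻ ω, ∏ k, ENNReal.ofReal (Real.exp ((ε * q k) * (hYm k).mk (Y k) ω ^ 2)) ∂P := by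
        simp only [hsplit]
        refine lintegral_congr_ae (hae.mono fun ω hω => ?_)
        simp only [hω]
    _ = ∏ k, ∫⁻ ω, ENNReal.ofReal (Real.exp ((ε * q k) * (hYm k).mk (Y k) ω ^ 2)) ∂P :=
        lintegral_prod_eq_prod_lintegral_of_indepFun Finset.univ _ hindep fun k =>
          (by fun_prop : Measurable fun y : ℝ => ENNReal.ofReal (Real.exp ((ε * q k) * y ^ 2))).comp
            (hYm k).measurable_mk
    _ ≤ ∏ k, ENNReal.ofReal (Real.exp (2 * (ε * q k))) := by
        refine Finset.prod_le_prod' fun k _ => ?_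
        refine le_trans (le_of_eq ?_) (lintegral_exp_mul_sq_gaussianReal_le
          (mul_nonneg hε (hq0 k)) (hqN k))
        rw [← hlaw k, Measure.map_congr (hYm k).ae_eq_mk,
          lintegral_map (by fun_prop) (hYm k).measurable_mk]
    _ = ENNReal.ofReal (Real.exp (2 * ε * Q.trace)) := by
        rw [← ENNReal.ofReal_prod_of_nonneg fun k _ => Real.exp_nonneg _, ← Real.exp_sum,
          hQ.trace_eq_sum_eigenvalues, Finset.mul_sum]
        congr 2
        exact Finset.sum_congr rfl fun k _ => (mul_assoc _ _ _).symm

end Quadratic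

/-! ### Bessel and Parseval for plane waves -/

/-- The real part of a plane wave. -/
def cosWave (ζ : ℝ × ℝ) : C(Sq, ℝ) := ⟨fun x => (phaseC ζ x).re, by fun_prop⟩

/-- The imaginary part of a plane wave. -/
def sinWave (ζ : ℝ × ℝ) : C(Sq, ℝ) := ⟨fun x => (phaseC ζ x).im, by fun_prop⟩

theorem integrable_mul_sq (f g : C(Sq, ℝ)) : Integrable fun x => f x * g x :=
  integrable_of_continuous_sq (f.continuous.mul g.continuous)

theorem inner_toLp_eq (f g : C(Sq, ℝ)) :
    inner ℝ (ContinuousMap.toLp 2 volume ℝ f : Lp ℝ 2 (volume : Measure Sq))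
      (ContinuousMap.toLp 2 volume ℝ g) = ∫ x, f x * g x := by
  rw [ContinuousMap.inner_toLp]
  refine integral_congr_ae (Eventually.of_forall fun x => ?_)
  simp [mul_comm]

theorem fourierSq_eq_cosWave_add_sinWave (f : C(Sq, ℝ)) (ζ : ℝ × ℝ) :
    fourierSq f ζ = ((∫ x, f x * cosWave ζ x : ℝ) : ℂ) + ((∫ x, f x * sinWave ζ x : ℝ) : ℂ) * Complex.I := by
  rw [← Complex.re_add_im (fourierSq f ζ)]
  have h := integrable_ofReal_mul_phase f ζ
  have h1 : (fourierSq f ζ).re = ∫ x, f x * cosWave ζ x := by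
    rw [fourierSq]
    refine (integral_re h).symm.trans (integral_congr_ae (Eventually.of_forall fun x => ?_))
    exact Complex.re_ofReal_mul _ _
  have h2 : (fourierSq f ζ).im = ∫ x, f x * sinWave ζ x := by
    rw [fourierSq]
    refine (integral_im h).symm.trans (integral_congr_ae (Eventually.of_forall fun x => ?_))
    exact Complex.im_ofReal_mul _ _
  rw [h1, h2]

theorem norm_fourierSq_sq (f : C(Sq, ℝ)) (ζ : ℝ × ℝ) :
    ‖fourierSq f ζ‖ ^ 2 = (∫ x, f x * cosWave ζ x) ^ 2 + (∫ x, f x * sinWave ζ x) ^ 2 := by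
  rw [fourierSq_eq_cosWave_add_sinWave, ← Complex.normSq_eq_norm_sq, Complex.normSq_add_mul_I]

theorem integral_cosWave_sq_add_integral_sinWave_sq (ζ : ℝ × ℝ) :
    (∫ x, cosWave ζ x * cosWave ζ x) + ∫ x, sinWave ζ x * sinWave ζ x = 1 := by
  rw [← integral_add (integrable_mul_sq _ _) (integrable_mul_sq _ _)]
  have e : ∀ x, cosWave ζ x * cosWave ζ x + sinWave ζ x * sinWave ζ x = 1 := fun x => by
    have := norm_phase ζ x
    change (phase ζ x).re * (phase ζ x).re + (phase ζ x).im * (phase ζ x).im = 1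
    rw [← Complex.normSq_apply, Complex.normSq_eq_norm_sq, this, one_pow]
  simp [e]

theorem fourierSq_sum_smul {ι : Type*} (I : Finset ι) (c : ι → ℝ) (e : ι → C(Sq, ℝ)) (ζ : ℝ × ℝ) :
    fourierSq (∑ i ∈ I, c i • e i) ζ = ∑ i ∈ I, (c i : ℂ) * fourierSq (e i) ζ := by
  simp only [fourierSq]
  simp only [← integral_const_mul]
  rw [← integral_finsetSum _ fun i _ => (integrable_ofReal_mul_phase (e i) ζ).const_mul _]
  refine integral_congr_ae (Eventually.of_forall fun x => ?_)
  simp only [ContinuousMap.coe_sum, Finset.sum_apply, ContinuousMap.coe_smul, Pi.smul_apply, smul_eq_mul]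
  push_cast
  rw [Finset.sum_mul]
  exact Finset.sum_congr rfl fun i _ => mul_assoc _ _ _

/-- The family `e` of continuous functions is orthonormal in `L²`. -/
def IsOrthonormalFamily {ι : Type*} (e : ι → C(Sq, ℝ)) : Prop :=
  Orthonormal ℝ fun i => (ContinuousMap.toLp 2 volume ℝ (e i) : Lp ℝ 2 (volume : Measure Sq))

section Bessel

variable {ι : Type*} {e : ι → C(Sq, ℝ)}

theorem IsOrthonormalFamily.integral_mul [DecidableEq ι] (he : IsOrthonormalFamily e) (i k : ι) :
    ∫ x, e i x * e k x = if i = k then 1 else 0 := by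
  rw [← inner_toLp_eq]
  exact orthonormal_iff_ite.mp he i k

theorem IsOrthonormalFamily.sum_sq_le (he : IsOrthonormalFamily e) (I : Finset ι) (ψ : C(Sq, ℝ)) :
    ∑ i ∈ I, (∫ x, e i x * ψ x) ^ 2 ≤ ∫ x, ψ x * ψ x := by
  have h := Orthonormal.sum_inner_products_le (s := I)
    (ContinuousMap.toLp 2 volume ℝ ψ : Lp ℝ 2 (volume : Measure Sq)) he
  rw [← real_inner_self_eq_norm_sq, inner_toLp_eq] at h
  simpa only [inner_toLp_eq, Real.norm_eq_abs, sq_abs] using h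

/-- Bessel's inequality for the real and the imaginary part of the plane wave, whose squared norms
add up to `1`. Integrated against `κ`, it bounds the trace of the form by the mass of `κ`, uniformly
in the truncation. -/
theorem IsOrthonormalFamily.sum_norm_fourierSq_sq_le (he : IsOrthonormalFamily e) (I : Finset ι)
    (ζ : ℝ × ℝ) : ∑ i ∈ I, ‖fourierSq (e i) ζ‖ ^ 2 ≤ 1 := by
  simp only [norm_fourierSq_sq, Finset.sum_add_distrib]
  rw [← integral_cosWave_sq_add_integral_sinWave_sq ζ]
  exact add_le_add (he.sum_sq_le I _) (he.sum_sq_le I _)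

theorem IsOrthonormalFamily.sum_qForm_le (he : IsOrthonormalFamily e) (I : Finset ι)
    (κ : Measure (ℝ × ℝ)) [IsFiniteMeasure κ] : ∑ i ∈ I, qForm κ (e i) ≤ κ.real Set.univ := by
  simp only [qForm]
  rw [← integral_finsetSum _ fun i _ => integrable_fourierSq_sq κ (e i)]
  refine (integral_mono (integrable_finsetSum _ fun i _ => integrable_fourierSq_sq κ (e i))
    (integrable_const 1) fun ζ => he.sum_norm_fourierSq_sq_le I ζ).trans ?_
  simp

theorem hasSum_sq_of_isContinuousBasis {e : ℕ → C(Sq, ℝ)} (he : IsContinuousBasis e) (ψ : C(Sq, ℝ)) :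
    HasSum (fun i => (∫ x, e i x * ψ x) ^ 2) (∫ x, ψ x * ψ x) := by
  have h := (HilbertBasis.mk he.1 he.2.ge).hasSum_inner_mul_inner
    (ContinuousMap.toLp 2 volume ℝ ψ : Lp ℝ 2 (volume : Measure Sq)) (ContinuousMap.toLp 2 volume ℝ ψ)
  simp only [HilbertBasis.coe_mk, inner_toLp_eq] at h
  refine h.congr_fun fun i => ?_
  rw [pow_two]
  congr 2
  ext x
  ring

/-- For a complete family Bessel becomes Parseval, and dominated convergence integrates it. The
missing mass measures how far a truncation is from the white noise. -/
theorem tendsto_sum_qForm {e : ℕ → C(Sq, ℝ)} (he : IsContinuousBasis e)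
    (κ : Measure (ℝ × ℝ)) [IsFiniteMeasure κ] :
    Tendsto (fun N => ∑ i ∈ Finset.range N, qForm κ (e i)) atTop (nhds (κ.real Set.univ)) := by
  have h1 : ∀ N, ∑ i ∈ Finset.range N, qForm κ (e i)
      = ∫ ζ, ∑ i ∈ Finset.range N, ‖fourierSq (e i) ζ‖ ^ 2 ∂κ := fun N =>
    (integral_finsetSum _ fun i _ => integrable_fourierSq_sq κ (e i)).symm
  have h2 : κ.real Set.univ = ∫ _ζ, (1 : ℝ) ∂κ := by simp
  simp only [h1]
  rw [h2]
  refine tendsto_integral_of_dominated_convergence (fun _ => 1) (fun N => ?_) (integrable_const 1)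
    (fun N => Eventually.of_forall fun ζ => ?_) (Eventually.of_forall fun ζ => ?_)
  · exact (integrable_finsetSum _ fun i _ => integrable_fourierSq_sq κ (e i)).aestronglyMeasurable
  · rw [Real.norm_of_nonneg (Finset.sum_nonneg fun i _ => by positivity)]
    exact IsOrthonormalFamily.sum_norm_fourierSq_sq_le he.1 _ ζ
  · rw [← integral_cosWave_sq_add_integral_sinWave_sq ζ]
    simp only [norm_fourierSq_sq, Finset.sum_add_distrib]
    exact (hasSum_sq_of_isContinuousBasis he _).tendsto_sum_nat.add
      (hasSum_sq_of_isContinuousBasis he _).tendsto_sum_nat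

end Bessel

/-! ### Gram matrices and truncated white noise -/

/-- The Gram matrix of the functions `e i` for the quadratic form `qForm κ`. -/
def gramMatrix {ι : Type*} (κ : Measure (ℝ × ℝ)) (e : ι → C(Sq, ℝ)) : Matrix ι ι ℝ :=
  Matrix.of fun i k => ∫ ζ, (fourierSq (e i) ζ * conj (fourierSq (e k) ζ)).re ∂κ

section Gram

variable {ι : Type*} (κ : Measure (ℝ × ℝ)) [IsFiniteMeasure κ]

theorem integrable_fourierSq_mul (f g : C(Sq, ℝ)) :
    Integrable (fun ζ => (fourierSq f ζ * conj (fourierSq g ζ)).re) κ := by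
  refine (Integrable.of_bound (C := ‖f‖ * ‖g‖) ?_ (Eventually.of_forall fun ζ => ?_))
  · exact (Complex.continuous_re.comp ((continuous_fourierSq f).mul
      (Complex.continuous_conj.comp (continuous_fourierSq g)))).aestronglyMeasurable
  · refine (Complex.abs_re_le_norm _).trans ?_
    rw [norm_mul, RCLike.norm_conj]
    exact mul_le_mul (norm_fourierSq_le f ζ) (norm_fourierSq_le g ζ) (norm_nonneg _) (norm_nonneg _)

theorem isHermitian_gramMatrix (e : ι → C(Sq, ℝ)) : (gramMatrix κ e).IsHermitian := by
  ext i k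
  simp only [gramMatrix, Matrix.conjTranspose_apply, Matrix.of_apply, star_trivial]
  refine integral_congr_ae (Eventually.of_forall fun ζ => ?_)
  simp
  ring

theorem qForm_sum_smul [Fintype ι] (e : ι → C(Sq, ℝ)) (x : ι → ℝ) :
    qForm κ (∑ i, x i • e i) = x ⬝ᵥ (gramMatrix κ e).mulVec x := by
  have h1 : ∀ ζ, ‖fourierSq (∑ i, x i • e i) ζ‖ ^ 2
      = ∑ i, ∑ k, x i * x k * (fourierSq (e i) ζ * conj (fourierSq (e k) ζ)).re := fun ζ => by
    rw [fourierSq_sum_smul, ← Complex.ofReal_re (‖_‖ ^ 2), ← Complex.normSq_eq_norm_sq,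
      ← Complex.mul_conj, map_sum, Finset.sum_mul_sum, Complex.re_sum]
    refine Finset.sum_congr rfl fun i _ => ?_
    rw [Complex.re_sum]
    refine Finset.sum_congr rfl fun k _ => ?_
    rw [map_mul, Complex.conj_ofReal, mul_mul_mul_comm, ← Complex.ofReal_mul, Complex.re_ofReal_mul]
  simp only [qForm, h1]
  rw [integral_finsetSum _ fun i _ => integrable_finsetSum _ fun k _ =>
    (integrable_fourierSq_mul κ (e i) (e k)).const_mul _]
  refine Finset.sum_congr rfl fun i _ => ?_
  rw [integral_finsetSum _ fun k _ => (integrable_fourierSq_mul κ (e i) (e k)).const_mul _,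
    Matrix.mulVec, dotProduct, Finset.mul_sum]
  refine Finset.sum_congr rfl fun k _ => ?_
  rw [integral_const_mul, gramMatrix, Matrix.of_apply]
  ring

theorem trace_gramMatrix [Fintype ι] (e : ι → C(Sq, ℝ)) :
    (gramMatrix κ e).trace = ∑ i, qForm κ (e i) := by
  refine Finset.sum_congr rfl fun i _ => ?_
  rw [Matrix.diag_apply, gramMatrix, Matrix.of_apply, qForm]
  refine integral_congr_ae (Eventually.of_forall fun ζ => ?_)
  simp only [Complex.mul_conj, Complex.ofReal_re, Complex.normSq_eq_norm_sq]

end Gram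

/-- The random field `s` is a centered Gaussian field with covariance `δ(x - y)`. -/
structure IsStdWhiteNoise {Ω : Type*} [MeasurableSpace Ω] (P : Measure Ω)
    (s : C(Sq, ℝ) → Ω → ℝ) : Prop where
  gaussian : IsGaussianProcess s P
  centered : ∀ f, ∫ ω, s f ω ∂P = 0
  covariance : ∀ f g, ∫ ω, s f ω * s g ω ∂P = ∫ x : Sq, f x * g x

section Noise

variable {Ω : Type*} [MeasurableSpace Ω] {P : Measure Ω} [IsProbabilityMeasure P]
  {s : C(Sq, ℝ) → Ω → ℝ} {ι : Type*} {e : ι → C(Sq, ℝ)}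

/-- The only path from a vertex to itself has no edge, and the infimum over the empty list is the
default value `1`. Every single field is therefore a standard white noise. -/
theorem forestCov_self {n : ℕ} (F : SimpleGraph (Fin n)) (w : Sym2 (Fin n) → ℝ) (a : Fin n) :
    forestCov F w a a = 1 := by
  have h : ∃ p : F.Walk a a, p.IsPath := ⟨.nil, .nil⟩
  have h2 : h.choose = .nil := SimpleGraph.Walk.eq_nil_iff_nil.mpr (SimpleGraph.Walk.isPath_iff_nil.mp h.choose_spec)
  rw [forestCov, dif_pos h, h2]
  simp

theorem IsWhiteNoise.isStdWhiteNoise {n : ℕ} {F : SimpleGraph (Fin n)} {w : Sym2 (Fin n) → ℝ}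
    {σ : Fin n → C(Sq, ℝ) → Ω → ℝ} (hσ : IsWhiteNoise P (forestCov F w) σ) (a : Fin n) :
    IsStdWhiteNoise P (σ a) where
  gaussian := hσ.gaussian.comp_right (fun f => (a, f))
  centered := hσ.centered a
  covariance f g := by rw [hσ.covariance, forestCov_self, one_mul]

theorem IsStdWhiteNoise.hasGaussianLaw (hs : IsStdWhiteNoise P s) [Fintype ι] (e : ι → C(Sq, ℝ)) :
    HasGaussianLaw (fun ω i => s (e i) ω) P := by
  classical
  have h := (hs.gaussian.comp_right e).hasGaussianLaw Finset.univ
  have h2 := h.map_fun (ContinuousLinearMap.pi fun i : ι =>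
    ContinuousLinearMap.proj (R := ℝ) (φ := fun _ : (Finset.univ : Finset ι) => ℝ) ⟨i, Finset.mem_univ i⟩)
  exact h2

theorem IsStdWhiteNoise.memLp_two (hs : IsStdWhiteNoise P s) (f : C(Sq, ℝ)) : MemLp (s f) 2 P :=
  (hs.gaussian.hasGaussianLaw_eval f).memLp_two

theorem integral_partialSum (I : Finset ι) (c : ι → ℝ) (e : ι → C(Sq, ℝ)) :
    ∫ x, (∑ i ∈ I, c i • e i : C(Sq, ℝ)) x = ∑ i ∈ I, (∫ x, e i x * (1 : C(Sq, ℝ)) x) * c i := by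
  simp only [ContinuousMap.coe_sum, Finset.sum_apply, ContinuousMap.coe_smul, Pi.smul_apply, smul_eq_mul,
    ContinuousMap.one_apply, mul_one]
  rw [integral_finsetSum _ fun i _ => (integrable_of_continuous_sq (e i).continuous).const_mul _]
  exact Finset.sum_congr rfl fun i _ => by rw [integral_const_mul, mul_comm]

theorem integral_sq_sum_smul [Fintype ι] [DecidableEq ι] (he : IsOrthonormalFamily e) (x : ι → ℝ) :
    ∫ y, (∑ i, x i • e i : C(Sq, ℝ)) y ^ 2 = ∑ i, x i ^ 2 := by
  have h1 : ∀ y, (∑ i, x i • e i : C(Sq, ℝ)) y ^ 2 = ∑ i, ∑ k, x i * x k * (e i y * e k y) := fun y => by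
    simp only [ContinuousMap.coe_sum, Finset.sum_apply, ContinuousMap.coe_smul, Pi.smul_apply,
      smul_eq_mul]
    rw [pow_two, Finset.sum_mul_sum]
    exact Finset.sum_congr rfl fun i _ => Finset.sum_congr rfl fun k _ => by ring
  simp only [h1]
  rw [integral_finsetSum _ fun i _ => integrable_finsetSum _ fun k _ =>
    (integrable_mul_sq (e i) (e k)).const_mul _]
  refine Finset.sum_congr rfl fun i _ => ?_
  rw [integral_finsetSum _ fun k _ => (integrable_mul_sq (e i) (e k)).const_mul _]
  simp only [integral_const_mul, he.integral_mul]
  simp [pow_two]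

/-- The quadratic form `qForm κ` of a truncated white noise has exponential moments. -/
theorem IsStdWhiteNoise.lintegral_exp_qForm_le (hs : IsStdWhiteNoise P s) (he : IsOrthonormalFamily e)
    (I : Finset ι) (κ : Measure (ℝ × ℝ)) [IsFiniteMeasure κ] {N ε : ℝ}
    (hN : ∀ f : C(Sq, ℝ), qForm κ f ≤ N * ∫ x, f x ^ 2) (hε : 0 ≤ ε) (hεN : ε * N ≤ 1 / 4) :
    ∫⁻ ω, ENNReal.ofReal (Real.exp (ε * qForm κ (∑ i ∈ I, s (e i) ω • e i))) ∂P
      ≤ ENNReal.ofReal (Real.exp (2 * ε * κ.real Set.univ)) := by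
  classical
  have he' : IsOrthonormalFamily fun i : I => e i := Orthonormal.comp he _ Subtype.val_injective
  -- The coordinates in an orthonormal family are isometric, so `N` bounds the Gram matrix as well.
  have h := lintegral_exp_quadratic_le (X := fun (i : I) => s (e i)) (hs.hasGaussianLaw _)
    (fun i => hs.centered _) (fun i k => by rw [hs.covariance, he'.integral_mul])
    (isHermitian_gramMatrix κ fun i : I => e i) (N := N) (ε := ε)
    (fun x => by rw [← qForm_sum_smul]; exact qForm_nonneg _ _)
    (fun x => by
      rw [← qForm_sum_smul, ← integral_sq_sum_smul he']
      exact hN _) hε hεN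
  simp only [← qForm_sum_smul] at h
  have e1 : ∀ ω, ∑ i ∈ I, s (e i) ω • e i = ∑ i : I, s (e i) ω • e i := fun ω =>
    (Finset.sum_coe_sort I fun i => s (e i) ω • e i).symm
  simp only [e1]
  refine h.trans (ENNReal.ofReal_le_ofReal (Real.exp_le_exp.mpr ?_))
  rw [trace_gramMatrix]
  exact mul_le_mul_of_nonneg_left (he'.sum_qForm_le Finset.univ κ) (by positivity)

/-- The integral of the truncated field is a centered Gaussian. Its variance is the sum of the
squared coefficients of the constant function `1`, at most `1` by Bessel. -/
theorem IsStdWhiteNoise.lintegral_exp_linear_le (hs : IsStdWhiteNoise P s) (he : IsOrthonormalFamily e)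
    (I : Finset ι) (a : ℝ) :
    ∫⁻ ω, ENNReal.ofReal (Real.exp (a * ∫ x, (∑ i ∈ I, s (e i) ω • e i : C(Sq, ℝ)) x)) ∂P
      ≤ ENNReal.ofReal (Real.exp (a ^ 2 / 2)) := by
  classical
  have he' : IsOrthonormalFamily fun i : I => e i := Orthonormal.comp he _ Subtype.val_injective
  set u : I → ℝ := fun i => ∫ x, e i x * (1 : C(Sq, ℝ)) x with hu
  have hX := hs.hasGaussianLaw fun i : I => e i
  set G : Ω → ℝ := fun ω => ∑ i : I, u i * s (e i) ω with hGdef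
  have hG : HasGaussianLaw G P := (hasGaussianLaw_sum_mul hX fun _ : Unit => u).eval ()
  have hG0 : ∫ ω, G ω ∂P = 0 := by
    simp only [hGdef]
    rw [integral_finsetSum _ fun i _ => ((hX.eval i).integrable.const_mul _)]
    simp [integral_const_mul, hs.centered]
  have hGv : Var[G; P] ≤ 1 := by
    rw [variance_of_integral_eq_zero hG.aemeasurable hG0]
    have h1 := integral_sum_mul_sum hX (fun i k => by rw [hs.covariance, he'.integral_mul]) u u
    simp only [pow_two]
    rw [h1]
    have h2 := he'.sum_sq_le Finset.univ 1
    simp only [pow_two] at h2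
    simpa [hu] using h2
  have e1 : ∀ ω, ∫ x, (∑ i ∈ I, s (e i) ω • e i : C(Sq, ℝ)) x = G ω := fun ω => by
    rw [integral_partialSum, ← Finset.sum_coe_sort]
  simp only [e1]
  have hlaw := hG.map_eq_gaussianReal
  rw [hG0] at hlaw
  have hint : Integrable (fun y => Real.exp (a * y)) (P.map G) := by
    rw [hlaw]
    exact integrable_exp_mul_gaussianReal a
  have hlin : ∫⁻ ω, ENNReal.ofReal (Real.exp (a * G ω)) ∂P
      = ∫⁻ y, ENNReal.ofReal (Real.exp (a * y)) ∂P.map G :=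
    (lintegral_map' (f := fun y => ENNReal.ofReal (Real.exp (a * y))) (by fun_prop)
      hG.aemeasurable).symm
  rw [hlin, ← ofReal_integral_eq_lintegral_ofReal hint (Eventually.of_forall fun y => Real.exp_nonneg _)]
  refine ENNReal.ofReal_le_ofReal ?_
  have hm := congrFun (mgf_id_gaussianReal (μ := 0) (v := Var[G; P].toNNReal)) a
  rw [hlaw]
  rw [mgf] at hm
  simp only [id] at hm
  rw [hm]
  refine Real.exp_le_exp.mpr ?_
  rw [zero_mul, zero_add, Real.coe_toNNReal _ (variance_nonneg _ _)]
  nlinarith [sq_nonneg a]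

theorem IsStdWhiteNoise.aemeasurable_linear (hs : IsStdWhiteNoise P s) (e : ι → C(Sq, ℝ)) (I : Finset ι) :
    AEMeasurable (fun ω => ∫ x, (∑ i ∈ I, s (e i) ω • e i : C(Sq, ℝ)) x) P := by
  simp only [integral_partialSum]
  exact Finset.aemeasurable_fun_sum _ fun i _ => (hs.gaussian.aemeasurable (e i)).const_mul _

theorem IsStdWhiteNoise.lintegral_exp_abs_linear_le (hs : IsStdWhiteNoise P s)
    (he : IsOrthonormalFamily e) (I : Finset ι) (a : ℝ) :
    ∫⁻ ω, ENNReal.ofReal (Real.exp (a * |∫ x, (∑ i ∈ I, s (e i) ω • e i : C(Sq, ℝ)) x|)) ∂P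
      ≤ ENNReal.ofReal (2 * Real.exp (a ^ 2 / 2)) := by
  have hle : ∀ y : ℝ, ENNReal.ofReal (Real.exp (a * |y|))
      ≤ ENNReal.ofReal (Real.exp (a * y)) + ENNReal.ofReal (Real.exp (-a * y)) := fun y => by
    rw [← ENNReal.ofReal_add (Real.exp_nonneg _) (Real.exp_nonneg _)]
    refine ENNReal.ofReal_le_ofReal ?_
    rcases abs_cases y with ⟨h, _⟩ | ⟨h, _⟩ <;> rw [h]
    · linarith [Real.exp_nonneg (-a * y)]
    · rw [mul_neg, ← neg_mul]
      linarith [Real.exp_nonneg (a * y)]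
  refine (lintegral_mono fun ω => hle _).trans ?_
  rw [lintegral_add_left' (((hs.aemeasurable_linear e I).const_mul a).exp.ennreal_ofReal)]
  refine (add_le_add (hs.lintegral_exp_linear_le he I a) (hs.lintegral_exp_linear_le he I (-a))).trans ?_
  rw [← ENNReal.ofReal_add (Real.exp_nonneg _) (Real.exp_nonneg _), neg_sq, two_mul]

end Noise

/-! ### Functionals that are locally Lipschitz in the norm of `L²(κ)` -/

section Hat

variable (κ : Measure (ℝ × ℝ)) [IsFiniteMeasure κ]

theorem memLp_fourierSq (f : C(Sq, ℝ)) : MemLp (fourierSq f) 2 κ :=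
  MemLp.of_bound (continuous_fourierSq f).aestronglyMeasurable ‖f‖
    (Eventually.of_forall fun ζ => norm_fourierSq_le f ζ)

/-- The transform `fourierSq f` as an element of `L²(κ)`. -/
def hatLp (f : C(Sq, ℝ)) : Lp ℂ 2 κ := (memLp_fourierSq κ f).toLp

theorem norm_hatLp_sub (f g : C(Sq, ℝ)) : ‖hatLp κ f - hatLp κ g‖ = √(qForm κ (f - g)) := by
  have h : fourierSq f - fourierSq g = fourierSq (f - g) := by
    ext ζ
    rw [fourierSq_sub, Pi.sub_apply]
  rw [hatLp, hatLp, ← MemLp.toLp_sub, Lp.norm_toLp,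
    MemLp.eLpNorm_eq_integral_rpow_norm (by norm_num) (by norm_num)
      ((memLp_fourierSq κ f).sub (memLp_fourierSq κ g)), ENNReal.toReal_ofReal (by positivity), h,
    qForm, Real.sqrt_eq_rpow]
  norm_num

theorem fourierSq_zero_left : fourierSq 0 = 0 := by
  ext ζ
  simp [fourierSq]

theorem norm_hatLp (f : C(Sq, ℝ)) : ‖hatLp κ f‖ = √(qForm κ f) := by
  have h0 : hatLp κ 0 = 0 := by
    rw [← norm_eq_zero, hatLp, Lp.norm_toLp, fourierSq_zero_left, eLpNorm_zero, ENNReal.toReal_zero]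
  have := norm_hatLp_sub κ f 0
  rwa [h0, sub_zero, sub_zero] at this

theorem sqrt_qForm_le (f : C(Sq, ℝ)) : √(qForm κ f) ≤ √(κ.real Set.univ) * ‖f‖ := by
  rw [← Real.sqrt_sq (norm_nonneg f), ← Real.sqrt_mul (by positivity)]
  refine Real.sqrt_le_sqrt ?_
  refine (integral_mono (integrable_fourierSq_sq κ f) (integrable_const (‖f‖ ^ 2)) fun ζ =>
    pow_le_pow_left₀ (norm_nonneg _) (norm_fourierSq_le f ζ) 2).trans ?_
  simp

theorem continuous_hatLp : Continuous (hatLp κ) := by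
  refine (LipschitzWith.of_dist_le_mul (K := (√(κ.real Set.univ)).toNNReal) fun f g => ?_).continuous
  rw [dist_eq_norm, norm_hatLp_sub, dist_eq_norm, Real.coe_toNNReal _ (Real.sqrt_nonneg _)]
  exact sqrt_qForm_le κ _

theorem continuous_qForm : Continuous (qForm κ) := by
  have h : ∀ f, qForm κ f = ‖hatLp κ f‖ ^ 2 := fun f => by
    rw [norm_hatLp, Real.sq_sqrt (qForm_nonneg κ f)]
  simp only [funext h]
  exact (continuous_hatLp κ).norm.pow 2

variable {κ} {F : C(Sq, ℝ) → ℂ} {L : ℝ}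

/-- If the `x k` stay bounded in `L²(κ)`, so do the `y k` at vanishing distance, and the Lipschitz
factors stay bounded. -/
theorem tendsto_sub_of_hatLp {α : Type*} {l : Filter α} {x y : α → C(Sq, ℝ)} {R : ℝ}
    (hL : 0 ≤ L) (hF : ∀ f g, ‖F f - F g‖ ≤ L * √(qForm κ (f - g)) * (1 + √(qForm κ f)) * (1 + √(qForm κ g)))
    (hx : ∀ᶠ k in l, ‖hatLp κ (x k)‖ ≤ R)
    (hxy : Tendsto (fun k => ‖hatLp κ (x k) - hatLp κ (y k)‖) l (nhds 0)) :
    Tendsto (fun k => F (x k) - F (y k)) l (nhds 0) := by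
  rw [tendsto_zero_iff_norm_tendsto_zero]
  have hlim : Tendsto (fun k => L * ‖hatLp κ (x k) - hatLp κ (y k)‖ * (1 + R)
      * (1 + (R + ‖hatLp κ (x k) - hatLp κ (y k)‖))) l (nhds (L * 0 * (1 + R) * (1 + (R + 0)))) :=
    ((hxy.const_mul L).mul_const (1 + R)).mul ((hxy.const_add R).const_add 1)
  rw [mul_zero, zero_mul, zero_mul] at hlim
  refine squeeze_zero' (Eventually.of_forall fun k => norm_nonneg _) (hx.mono fun k hk => ?_) hlim
  refine (hF _ _).trans ?_
  rw [← norm_hatLp_sub, ← norm_hatLp, ← norm_hatLp]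
  have h1 : ‖hatLp κ (y k)‖ ≤ R + ‖hatLp κ (x k) - hatLp κ (y k)‖ := by
    have := norm_sub_norm_le (hatLp κ (y k)) (hatLp κ (x k))
    rw [norm_sub_rev] at this
    linarith
  have h0 : 0 ≤ R := (norm_nonneg _).trans hk
  gcongr

theorem continuous_of_lipschitz_qForm (hL : 0 ≤ L)
    (hF : ∀ f g, ‖F f - F g‖ ≤ L * √(qForm κ (f - g)) * (1 + √(qForm κ f)) * (1 + √(qForm κ g))) :
    Continuous F := by
  rw [continuous_iff_continuousAt]
  intro f
  have h := tendsto_sub_of_hatLp (l := nhds f) (x := fun _ => f) (y := id) (R := ‖hatLp κ f‖) hL hF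
    (Eventually.of_forall fun _ => le_rfl) (by
      have := ((continuous_hatLp κ).tendsto f).const_sub (hatLp κ f)
      rw [sub_self] at this
      simpa using this.norm)
  have h2 := h.const_sub (F f)
  change Tendsto F (nhds f) (nhds (F f))
  simpa using h2

end Hat

/-! ### The value of a functional at a white noise -/

section Value

variable {Ω : Type*} [MeasurableSpace Ω] {P : Measure Ω} [IsProbabilityMeasure P]
  {s : C(Sq, ℝ) → Ω → ℝ}

theorem IsStdWhiteNoise.aestronglyMeasurable_sum (hs : IsStdWhiteNoise P s) {ι : Type*} (I : Finset ι)
    (e : ι → C(Sq, ℝ)) : AEStronglyMeasurable (fun ω => ∑ i ∈ I, s (e i) ω • e i) P :=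
  Finset.aestronglyMeasurable_fun_sum _ fun i _ =>
    (hs.gaussian.aemeasurable (e i)).aestronglyMeasurable.smul_const _

/-- Expanding the square with covariance `δ`, the mean square error of the truncation tested against
`ψ` is the defect in Bessel's inequality for `ψ`. -/
theorem IsStdWhiteNoise.integral_sq_sub (hs : IsStdWhiteNoise P s) {ι : Type*} {e : ι → C(Sq, ℝ)}
    (he : IsOrthonormalFamily e) (I : Finset ι) (ψ : C(Sq, ℝ)) :
    ∫ ω, (∑ i ∈ I, s (e i) ω * (∫ x, e i x * ψ x) - s ψ ω) ^ 2 ∂P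
      = (∫ x, ψ x * ψ x) - ∑ i ∈ I, (∫ x, e i x * ψ x) ^ 2 := by
  classical
  set a : ι → ℝ := fun i => ∫ x, e i x * ψ x with ha
  have hint : ∀ f g, Integrable (fun ω => s f ω * s g ω) P := fun f g =>
    (hs.memLp_two f).integrable_mul (hs.memLp_two g)
  have h1 : ∀ ω, (∑ i ∈ I, s (e i) ω * a i - s ψ ω) ^ 2
      = (∑ i ∈ I, ∑ k ∈ I, (a i * a k) * (s (e i) ω * s (e k) ω)
        - ∑ i ∈ I, (2 * a i) * (s (e i) ω * s ψ ω)) + s ψ ω * s ψ ω := fun ω => by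
    have h2 : (∑ i ∈ I, s (e i) ω * a i) * (∑ i ∈ I, s (e i) ω * a i)
        = ∑ i ∈ I, ∑ k ∈ I, (a i * a k) * (s (e i) ω * s (e k) ω) := by
      rw [Finset.sum_mul_sum]
      exact Finset.sum_congr rfl fun i _ => Finset.sum_congr rfl fun k _ => by ring
    have h3 : 2 * (∑ i ∈ I, s (e i) ω * a i) * s ψ ω
        = ∑ i ∈ I, (2 * a i) * (s (e i) ω * s ψ ω) := by
      rw [Finset.mul_sum, Finset.sum_mul]
      exact Finset.sum_congr rfl fun i _ => by ring
    rw [← h2, ← h3]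
    ring
  change ∫ ω, (∑ i ∈ I, s (e i) ω * a i - s ψ ω) ^ 2 ∂P = _ - ∑ i ∈ I, a i ^ 2
  simp only [h1]
  have i1 : Integrable (fun ω => ∑ i ∈ I, ∑ k ∈ I, (a i * a k) * (s (e i) ω * s (e k) ω)) P :=
    integrable_finsetSum _ fun i _ => integrable_finsetSum _ fun k _ => (hint _ _).const_mul _
  have i2 : Integrable (fun ω => ∑ i ∈ I, (2 * a i) * (s (e i) ω * s ψ ω)) P :=
    integrable_finsetSum _ fun i _ => (hint _ _).const_mul _
  have i12 : Integrable (fun ω => ∑ i ∈ I, ∑ k ∈ I, (a i * a k) * (s (e i) ω * s (e k) ω)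
      - ∑ i ∈ I, (2 * a i) * (s (e i) ω * s ψ ω)) P := i1.sub i2
  rw [integral_add i12 (hint _ _), integral_sub i1 i2,
    integral_finsetSum _ fun i _ => integrable_finsetSum _ fun k _ => (hint _ _).const_mul _,
    integral_finsetSum _ fun i _ => (hint _ _).const_mul _, hs.covariance]
  have h4 : ∀ i ∈ I, ∫ ω, ∑ k ∈ I, (a i * a k) * (s (e i) ω * s (e k) ω) ∂P = a i ^ 2 := fun i hi => by
    rw [integral_finsetSum _ fun k _ => (hint _ _).const_mul _]
    simp only [integral_const_mul, hs.covariance, he.integral_mul]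
    simp [hi, pow_two]
  rw [Finset.sum_congr rfl h4]
  have h5 : ∀ i ∈ I, ∫ ω, (2 * a i) * (s (e i) ω * s ψ ω) ∂P = 2 * a i ^ 2 := fun i _ => by
    rw [integral_const_mul, hs.covariance]
    change 2 * a i * a i = _
    ring
  rw [Finset.sum_congr rfl h5, ← Finset.mul_sum]
  ring

theorem IsStdWhiteNoise.lintegral_sq_sub (hs : IsStdWhiteNoise P s) {ι : Type*} {e : ι → C(Sq, ℝ)}
    (he : IsOrthonormalFamily e) (I : Finset ι) (ψ : C(Sq, ℝ)) :
    ∫⁻ ω, ENNReal.ofReal ((∑ i ∈ I, s (e i) ω * (∫ x, e i x * ψ x) - s ψ ω) ^ 2) ∂P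
      = ENNReal.ofReal ((∫ x, ψ x * ψ x) - ∑ i ∈ I, (∫ x, e i x * ψ x) ^ 2) := by
  rw [← hs.integral_sq_sub he I ψ, ofReal_integral_eq_lintegral_ofReal]
  · refine MemLp.integrable_sq (MemLp.sub ?_ (hs.memLp_two ψ))
    exact memLp_finsetSum _ fun i _ => (hs.memLp_two (e i)).mul_const _
  · exact Eventually.of_forall fun ω => sq_nonneg _

theorem integral_partialSum_mul {ι : Type*} (I : Finset ι) (c : ι → ℝ) (e : ι → C(Sq, ℝ))
    (ψ : C(Sq, ℝ)) :
    ∫ x, (∑ i ∈ I, c i • e i : C(Sq, ℝ)) x * ψ x = ∑ i ∈ I, c i * ∫ x, e i x * ψ x := by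
  simp only [ContinuousMap.coe_sum, Finset.sum_apply, ContinuousMap.coe_smul, Pi.smul_apply, smul_eq_mul,
    Finset.sum_mul, mul_assoc]
  rw [integral_finsetSum _ fun i _ => (integrable_mul_sq (e i) ψ).const_mul _]
  exact Finset.sum_congr rfl fun i _ => integral_const_mul _ _

theorem lintegral_sq_sub_le_add {u v w : Ω → ℝ} {a b : ℝ} (ha : 0 ≤ a) (hb : 0 ≤ b)
    (hu : AEMeasurable u P) (hw : AEMeasurable w P)
    (huw : ∫⁻ ω, ENNReal.ofReal ((u ω - w ω) ^ 2) ∂P = ENNReal.ofReal a)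
    (hvw : ∫⁻ ω, ENNReal.ofReal ((v ω - w ω) ^ 2) ∂P = ENNReal.ofReal b) :
    ∫⁻ ω, ENNReal.ofReal ((u ω - v ω) ^ 2) ∂P ≤ ENNReal.ofReal (2 * a + 2 * b) := by
  have h : ∀ ω, ENNReal.ofReal ((u ω - v ω) ^ 2)
      ≤ ENNReal.ofReal 2 * ENNReal.ofReal ((u ω - w ω) ^ 2)
        + ENNReal.ofReal 2 * ENNReal.ofReal ((v ω - w ω) ^ 2) := fun ω => by
    rw [← ENNReal.ofReal_mul zero_le_two, ← ENNReal.ofReal_mul zero_le_two,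
      ← ENNReal.ofReal_add (by positivity) (by positivity)]
    refine ENNReal.ofReal_le_ofReal ?_
    nlinarith [sq_nonneg ((u ω - w ω) + (v ω - w ω))]
  refine (lintegral_mono h).trans (le_of_eq ?_)
  have hm : AEMeasurable (fun ω => ENNReal.ofReal 2 * ENNReal.ofReal ((u ω - w ω) ^ 2)) P :=
    (((hu.sub hw).pow_const 2).ennreal_ofReal).const_mul _
  rw [lintegral_add_left' hm,
    lintegral_const_mul' _ _ ENNReal.ofReal_ne_top, lintegral_const_mul' _ _ ENNReal.ofReal_ne_top,
    huw, hvw, ← ENNReal.ofReal_mul zero_le_two, ← ENNReal.ofReal_mul zero_le_two,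
    ← ENNReal.ofReal_add (by positivity) (by positivity)]

/-- Two truncations of the white noise are close in quadratic mean, as soon as both families nearly
exhaust the mass of `κ`. -/
theorem IsStdWhiteNoise.lintegral_qForm_sub_le (hs : IsStdWhiteNoise P s) {ι ι' : Type*}
    {e : ι → C(Sq, ℝ)} {f : ι' → C(Sq, ℝ)} (he : IsOrthonormalFamily e) (hf : IsOrthonormalFamily f)
    (I : Finset ι) (J : Finset ι') (κ : Measure (ℝ × ℝ)) [IsFiniteMeasure κ] :
    ∫⁻ ω, ENNReal.ofReal (qForm κ ((∑ i ∈ I, s (e i) ω • e i) - ∑ i ∈ J, s (f i) ω • f i)) ∂P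
      ≤ ENNReal.ofReal (2 * (κ.real Set.univ - ∑ i ∈ I, qForm κ (e i))
        + 2 * (κ.real Set.univ - ∑ i ∈ J, qForm κ (f i))) := by
  set S : Ω → C(Sq, ℝ) := fun ω => ∑ i ∈ I, s (e i) ω • e i with hS
  set T : Ω → C(Sq, ℝ) := fun ω => ∑ i ∈ J, s (f i) ω • f i with hT
  have h1 : ∀ ω, ENNReal.ofReal (qForm κ (S ω - T ω))
      = ∫⁻ ζ, ENNReal.ofReal (‖fourierSq (S ω) ζ - fourierSq (T ω) ζ‖ ^ 2) ∂κ := fun ω => by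
    rw [qForm, ofReal_integral_eq_lintegral_ofReal (integrable_fourierSq_sq κ _)
      (Eventually.of_forall fun ζ => by positivity)]
    simp only [fourierSq_sub]
  have hmeas : AEMeasurable (Function.uncurry fun ω ζ =>
      ENNReal.ofReal (‖fourierSq (S ω) ζ - fourierSq (T ω) ζ‖ ^ 2)) (P.prod κ) := by
    have hterm : ∀ g : C(Sq, ℝ), AEMeasurable
        (fun p : Ω × (ℝ × ℝ) => (s g p.1 : ℂ) * fourierSq g p.2) (P.prod κ) := fun g =>
      (Complex.measurable_ofReal.comp_aemeasurable (hs.gaussian.aemeasurable g).comp_fst).mul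
        ((continuous_fourierSq g).measurable.comp measurable_snd).aemeasurable
    have : Function.uncurry (fun ω ζ => ENNReal.ofReal (‖fourierSq (S ω) ζ - fourierSq (T ω) ζ‖ ^ 2))
        = fun p : Ω × (ℝ × ℝ) => ENNReal.ofReal (‖(∑ i ∈ I, (s (e i) p.1 : ℂ) * fourierSq (e i) p.2)
          - ∑ i ∈ J, (s (f i) p.1 : ℂ) * fourierSq (f i) p.2‖ ^ 2) := by
      ext p
      rw [Function.uncurry, hS, hT, fourierSq_sum_smul, fourierSq_sum_smul]
    rw [this]
    exact (((Finset.aemeasurable_fun_sum I fun i _ => hterm (e i)).sub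
      (Finset.aemeasurable_fun_sum J fun i _ => hterm (f i))).norm.pow_const 2).ennreal_ofReal
  -- Both truncations are compared with the same variable `s ψ`, which depends on neither family.
  -- This is the source of the independence of the basis.
  have hpart : ∀ ψ : C(Sq, ℝ), ∫⁻ ω, ENNReal.ofReal (((∫ x, S ω x * ψ x) - ∫ x, T ω x * ψ x) ^ 2) ∂P
      ≤ ENNReal.ofReal (2 * ((∫ x, ψ x * ψ x) - ∑ i ∈ I, (∫ x, e i x * ψ x) ^ 2)
        + 2 * ((∫ x, ψ x * ψ x) - ∑ i ∈ J, (∫ x, f i x * ψ x) ^ 2)) := fun ψ => by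
    simp only [hS, hT, integral_partialSum_mul]
    exact lintegral_sq_sub_le_add (sub_nonneg.mpr (he.sum_sq_le I ψ)) (sub_nonneg.mpr (hf.sum_sq_le J ψ))
      (Finset.aemeasurable_fun_sum _ fun i _ => (hs.gaussian.aemeasurable (e i)).mul_const _)
      (hs.gaussian.aemeasurable ψ) (hs.lintegral_sq_sub he I ψ) (hs.lintegral_sq_sub hf J ψ)
  have hfib : ∀ ζ, ∫⁻ ω, ENNReal.ofReal (‖fourierSq (S ω) ζ - fourierSq (T ω) ζ‖ ^ 2) ∂P
      ≤ ENNReal.ofReal (2 * (1 - ∑ i ∈ I, ‖fourierSq (e i) ζ‖ ^ 2)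
        + 2 * (1 - ∑ i ∈ J, ‖fourierSq (f i) ζ‖ ^ 2)) := fun ζ => by
    have e1 : ∀ ω, ENNReal.ofReal (‖fourierSq (S ω) ζ - fourierSq (T ω) ζ‖ ^ 2)
        = ENNReal.ofReal (((∫ x, S ω x * cosWave ζ x) - ∫ x, T ω x * cosWave ζ x) ^ 2)
          + ENNReal.ofReal (((∫ x, S ω x * sinWave ζ x) - ∫ x, T ω x * sinWave ζ x) ^ 2) := fun ω => by
      rw [← ENNReal.ofReal_add (sq_nonneg _) (sq_nonneg _), ← fourierSq_sub, norm_fourierSq_sq]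
      simp only [ContinuousMap.sub_apply, sub_mul]
      rw [integral_sub (integrable_mul_sq _ _) (integrable_mul_sq _ _),
        integral_sub (integrable_mul_sq _ _) (integrable_mul_sq _ _)]
    simp only [e1]
    rw [lintegral_add_left']
    · refine (add_le_add (hpart _) (hpart _)).trans ?_
      rw [← ENNReal.ofReal_add]
      · refine ENNReal.ofReal_le_ofReal (le_of_eq ?_)
        simp only [norm_fourierSq_sq, Finset.sum_add_distrib]
        linear_combination (4 : ℝ) * integral_cosWave_sq_add_integral_sinWave_sq ζ
      all_goals
        have h1 := he.sum_sq_le I (cosWave ζ)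
        have h2 := he.sum_sq_le I (sinWave ζ)
        have h3 := hf.sum_sq_le J (cosWave ζ)
        have h4 := hf.sum_sq_le J (sinWave ζ)
        linarith
    · simp only [hS, hT, integral_partialSum_mul]
      exact (((Finset.aemeasurable_fun_sum _ fun i _ =>
        (hs.gaussian.aemeasurable (e i)).mul_const _).sub (Finset.aemeasurable_fun_sum _ fun i _ =>
        (hs.gaussian.aemeasurable (f i)).mul_const _)).pow_const 2).ennreal_ofReal
  change ∫⁻ ω, ENNReal.ofReal (qForm κ (S ω - T ω)) ∂P ≤ _
  simp only [h1]
  rw [lintegral_lintegral_swap hmeas]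
  refine (lintegral_mono hfib).trans ?_
  have j1 : Integrable (fun ζ => ∑ i ∈ I, ‖fourierSq (e i) ζ‖ ^ 2) κ :=
    integrable_finsetSum _ fun i _ => integrable_fourierSq_sq κ (e i)
  have j2 : Integrable (fun ζ => ∑ i ∈ J, ‖fourierSq (f i) ζ‖ ^ 2) κ :=
    integrable_finsetSum _ fun i _ => integrable_fourierSq_sq κ (f i)
  have k1 : Integrable (fun ζ => 2 * (1 - ∑ i ∈ I, ‖fourierSq (e i) ζ‖ ^ 2)) κ :=
    ((integrable_const 1).sub j1).const_mul 2
  have k2 : Integrable (fun ζ => 2 * (1 - ∑ i ∈ J, ‖fourierSq (f i) ζ‖ ^ 2)) κ :=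
    ((integrable_const 1).sub j2).const_mul 2
  have k12 : Integrable (fun ζ => 2 * (1 - ∑ i ∈ I, ‖fourierSq (e i) ζ‖ ^ 2)
      + 2 * (1 - ∑ i ∈ J, ‖fourierSq (f i) ζ‖ ^ 2)) κ := k1.add k2
  rw [← ofReal_integral_eq_lintegral_ofReal k12 (Eventually.of_forall fun ζ => ?_)]
  · refine ENNReal.ofReal_le_ofReal (le_of_eq ?_)
    rw [integral_add k1 k2, integral_const_mul, integral_const_mul,
      integral_sub (integrable_const 1) j1, integral_sub (integrable_const 1) j2,
      integral_finsetSum _ fun i _ => integrable_fourierSq_sq κ (e i),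
      integral_finsetSum _ fun i _ => integrable_fourierSq_sq κ (f i)]
    simp [qForm]
  · have h1 := he.sum_norm_fourierSq_sq_le I ζ
    have h2 := hf.sum_norm_fourierSq_sq_le J ζ
    change 0 ≤ 2 * (1 - ∑ i ∈ I, ‖fourierSq (e i) ζ‖ ^ 2) + 2 * (1 - ∑ i ∈ J, ‖fourierSq (f i) ζ‖ ^ 2)
    linarith

/-- The sum of the `4^k q_k` has finite expectation, since `4^k / 16^k` is summable; it is almost
surely finite and bounds each of its terms. -/
theorem ae_exists_sqrt_le_of_lintegral_le {q : ℕ → Ω → ℝ} (hq : ∀ k ω, 0 ≤ q k ω)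
    (hm : ∀ k, AEMeasurable (q k) P) {C : ℝ}
    (h : ∀ k, ∫⁻ ω, ENNReal.ofReal (q k ω) ∂P ≤ ENNReal.ofReal (C * (1 / 16) ^ k)) :
    ∀ᵐ ω ∂P, ∃ c : ℝ, ∀ k, √(q k ω) ≤ c * (1 / 2) ^ k := by
  have hC : ∀ k, C * (1 / 16) ^ k ≤ |C| * (1 / 16) ^ k := fun k => by
    gcongr
    exact le_abs_self C
  have hfin : ∫⁻ ω, ∑' k, ENNReal.ofReal (4 ^ k * q k ω) ∂P ≠ ⊤ := by
    rw [lintegral_tsum fun k => ((hm k).const_mul _).ennreal_ofReal]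
    have hle : ∀ k, ∫⁻ ω, ENNReal.ofReal (4 ^ k * q k ω) ∂P ≤ ENNReal.ofReal (|C| * (1 / 4) ^ k) :=
      fun k => by
        simp only [ENNReal.ofReal_mul (by positivity : (0 : ℝ) ≤ 4 ^ k)]
        rw [lintegral_const_mul' _ _ ENNReal.ofReal_ne_top]
        refine (mul_le_mul_right ((h k).trans (ENNReal.ofReal_le_ofReal (hC k))) _).trans (le_of_eq ?_)
        rw [← ENNReal.ofReal_mul (by positivity)]
        congr 1
        rw [show (1 / 16 : ℝ) = 1 / 4 * (1 / 4) by norm_num, mul_pow]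
        have : (4 : ℝ) ^ k * (1 / 4) ^ k = 1 := by rw [← mul_pow]; norm_num
        linear_combination |C| * (1 / 4) ^ k * this
    refine ne_top_of_le_ne_top ?_ (ENNReal.tsum_le_tsum hle)
    have hsum : Summable fun k : ℕ => |C| * (1 / 4 : ℝ) ^ k :=
      (summable_geometric_of_lt_one (by norm_num) (by norm_num)).mul_left _
    rw [← ENNReal.ofReal_tsum_of_nonneg (fun k => by positivity) hsum]
    exact ENNReal.ofReal_ne_top
  have hm2 : AEMeasurable (fun ω => ∑' k, ENNReal.ofReal (4 ^ k * q k ω)) P :=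
    AEMeasurable.tsum fun k => ((hm k).const_mul _).ennreal_ofReal
  filter_upwards [ae_lt_top' hm2 hfin] with ω hω
  refine ⟨√(∑' k, ENNReal.ofReal (4 ^ k * q k ω)).toReal, fun k => ?_⟩
  have h1 : 4 ^ k * q k ω ≤ (∑' k, ENNReal.ofReal (4 ^ k * q k ω)).toReal := by
    have := ENNReal.toReal_mono hω.ne (ENNReal.le_tsum (f := fun k => ENNReal.ofReal (4 ^ k * q k ω)) k)
    rwa [ENNReal.toReal_ofReal (mul_nonneg (by positivity) (hq k ω))] at this
  have h2 : q k ω ≤ (∑' k, ENNReal.ofReal (4 ^ k * q k ω)).toReal * ((1 / 2) ^ k) ^ 2 := by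
    have h3 : ((1 / 2 : ℝ) ^ k) ^ 2 * 4 ^ k = 1 := by
      rw [← pow_mul, mul_comm k 2, pow_mul, ← mul_pow]
      norm_num
    calc q k ω = (4 ^ k * q k ω) * ((1 / 2) ^ k) ^ 2 := by linear_combination (-q k ω) * h3
      _ ≤ _ := mul_le_mul_of_nonneg_right h1 (by positivity)
  refine (Real.sqrt_le_sqrt h2).trans (le_of_eq ?_)
  rw [Real.sqrt_mul ENNReal.toReal_nonneg, Real.sqrt_sq (by positivity)]

theorem IsStdWhiteNoise.ae_exists_sqrt_qForm_sub_le (hs : IsStdWhiteNoise P s)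
    {e f : ℕ → C(Sq, ℝ)} (he : IsOrthonormalFamily e) (hf : IsOrthonormalFamily f)
    (κ : Measure (ℝ × ℝ)) [IsFiniteMeasure κ] {φ χ : ℕ → ℕ}
    (hφ : ∀ k, κ.real Set.univ - ∑ i ∈ Finset.range (φ k), qForm κ (e i) ≤ (1 / 16) ^ k)
    (hχ : ∀ k, κ.real Set.univ - ∑ i ∈ Finset.range (χ k), qForm κ (f i) ≤ (1 / 16) ^ k) :
    ∀ᵐ ω ∂P, ∃ c : ℝ, ∀ k, ‖hatLp κ (∑ i ∈ Finset.range (φ k), s (e i) ω • e i)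
      - hatLp κ (∑ i ∈ Finset.range (χ k), s (f i) ω • f i)‖ ≤ c * (1 / 2) ^ k := by
  simp only [norm_hatLp_sub]
  refine ae_exists_sqrt_le_of_lintegral_le (C := 4) (fun k ω => qForm_nonneg κ _) (fun k => ?_) fun k => ?_
  · exact ((continuous_qForm κ).comp_aestronglyMeasurable
      ((hs.aestronglyMeasurable_sum _ e).sub (hs.aestronglyMeasurable_sum _ f))).aemeasurable
  · refine (hs.lintegral_qForm_sub_le he hf _ _ κ).trans (ENNReal.ofReal_le_ofReal ?_)
    linarith [hφ k, hχ k]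

theorem exists_strictMono_sub_sum_qForm_le {e : ℕ → C(Sq, ℝ)} (he : IsContinuousBasis e)
    (κ : Measure (ℝ × ℝ)) [IsFiniteMeasure κ] {ns : ℕ → ℕ} (hns : Tendsto ns atTop atTop) :
    ∃ φ : ℕ → ℕ, StrictMono φ ∧
      ∀ k, κ.real Set.univ - ∑ i ∈ Finset.range (ns (φ k)), qForm κ (e i) ≤ (1 / 16) ^ k := by
  refine extraction_forall_of_eventually
    (P := fun k n => κ.real Set.univ - ∑ i ∈ Finset.range (ns n), qForm κ (e i) ≤ (1 / 16) ^ k) fun k => ?_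
  have h := ((tendsto_sum_qForm he κ).comp hns).const_sub (κ.real Set.univ)
  rw [sub_self] at h
  exact (h.eventually_lt_const (by positivity : (0 : ℝ) < (1 / 16) ^ k)).mono fun n hn => hn.le

/-- A functional that is locally Lipschitz in the seminorm `√(qForm κ)` has a value at the white
noise, and uniform bounds on the truncations pass to this value. -/
theorem IsStdWhiteNoise.exists_isValueAt (hs : IsStdWhiteNoise P s) {κ : Measure (ℝ × ℝ)}
    [IsFiniteMeasure κ] {F : C(Sq, ℝ) → ℂ} {L : ℝ} (hL : 0 ≤ L)
    (hF : ∀ f g, ‖F f - F g‖ ≤ L * √(qForm κ (f - g)) * (1 + √(qForm κ f)) * (1 + √(qForm κ g))) :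
    ∃ V : Ω → ℂ, IsValueAt P F s V ∧ ∀ (Φ : ℂ → ENNReal) (B : ENNReal), Continuous Φ →
      (∀ (ι : Type) (e : ι → C(Sq, ℝ)) (I : Finset ι), IsOrthonormalFamily e →
        ∫⁻ ω, Φ (F (∑ i ∈ I, s (e i) ω • e i)) ∂P ≤ B) → ∫⁻ ω, Φ (V ω) ∂P ≤ B := by
  have hFc : Continuous F := continuous_of_lipschitz_qForm hL hF
  have hFm : ∀ {ι : Type} (I : Finset ι) (e : ι → C(Sq, ℝ)),
      AEStronglyMeasurable (fun ω => F (∑ i ∈ I, s (e i) ω • e i)) P := fun I e =>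
    hFc.comp_aestronglyMeasurable (hs.aestronglyMeasurable_sum I e)
  by_cases hex : ∃ e : ℕ → C(Sq, ℝ), IsContinuousBasis e
  swap
  -- Without a basis the convergence is vacuous, and `F 0` obeys the uniform bounds as the empty
  -- truncation.
  · refine ⟨fun _ => F 0, ⟨aestronglyMeasurable_const, fun e he => (hex ⟨e, he⟩).elim⟩, fun Φ B _ h => ?_⟩
    have := h Empty (fun i => i.elim) ∅ ⟨fun i => i.elim, fun i => i.elim⟩
    simpa using this
  obtain ⟨e, he⟩ := hex
  -- Along a fast subsequence the increments are almost surely geometric, so the truncations are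
  -- almost surely Cauchy in `L²(κ)` and the values of `F` converge.
  obtain ⟨φ, hφm, hφ⟩ := exists_strictMono_sub_sum_qForm_le he κ (ns := id) tendsto_id
  set X : ℕ → Ω → C(Sq, ℝ) := fun k ω => ∑ i ∈ Finset.range (φ k), s (e i) ω • e i with hX
  have hφ' : ∀ k, κ.real Set.univ - ∑ i ∈ Finset.range (φ (k + 1)), qForm κ (e i) ≤ (1 / 16) ^ k :=
    fun k => (hφ (k + 1)).trans (pow_le_pow_of_le_one (by norm_num) (by norm_num) k.le_succ)
  have hcauchy : ∀ᵐ ω ∂P, CauchySeq fun k => hatLp κ (X k ω) := by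
    filter_upwards [hs.ae_exists_sqrt_qForm_sub_le he.1 he.1 κ hφ hφ'] with ω ⟨c, hc⟩
    refine cauchySeq_of_summable_dist (Summable.of_nonneg_of_le (fun _ => dist_nonneg) (fun k => ?_)
      ((summable_geometric_of_lt_one (by norm_num : (0 : ℝ) ≤ 1 / 2) (by norm_num)).mul_left c))
    rw [dist_eq_norm]
    exact hc k
  have hbdd : ∀ᵐ ω ∂P, ∃ R, ∀ k, ‖hatLp κ (X k ω)‖ ≤ R := hcauchy.mono fun ω h => by
    obtain ⟨R, hR⟩ := h.isBounded_range.exists_norm_le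
    exact ⟨R, fun k => hR _ ⟨k, rfl⟩⟩
  have hlim : ∀ᵐ ω ∂P, ∃ l, Tendsto (fun k => F (X k ω)) atTop (nhds l) := by
    filter_upwards [hcauchy, hbdd] with ω hc ⟨R, hR⟩
    refine cauchySeq_tendsto_of_complete (cauchySeq_iff_tendsto_dist_atTop_0.mpr ?_)
    have h1 : Tendsto (fun p : ℕ × ℕ => ‖hatLp κ (X p.1 ω) - hatLp κ (X p.2 ω)‖) atTop (nhds 0) := by
      simpa only [dist_eq_norm] using cauchySeq_iff_tendsto_dist_atTop_0.mp hc
    have h2 := (tendsto_sub_of_hatLp (x := fun p : ℕ × ℕ => X p.1 ω) (y := fun p => X p.2 ω) hL hF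
      (Eventually.of_forall fun p => hR p.1) h1).norm
    rw [norm_zero] at h2
    simpa only [dist_eq_norm] using h2
  obtain ⟨V, hVm, hV⟩ := measurable_limit_of_tendsto_metrizable_ae
    (fun k => (hFm (Finset.range (φ k)) e).aemeasurable) hlim
  refine ⟨V, ⟨hVm.aestronglyMeasurable, fun f hf => ?_⟩, fun Φ B hΦ h => ?_⟩
  -- Convergence in probability means that every subsequence has an almost surely convergent one. A
  -- fast extraction for the second basis stays geometrically close to the first, so it has the same
  -- limit.
  · rw [exists_seq_tendstoInMeasure_atTop_iff fun n => hFm (Finset.range n) f]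
    intro ns hns
    obtain ⟨χ, hχm, hχ⟩ := exists_strictMono_sub_sum_qForm_le hf κ hns.tendsto_atTop
    refine ⟨χ, hχm, ?_⟩
    filter_upwards [hV, hbdd, hs.ae_exists_sqrt_qForm_sub_le he.1 hf.1 κ hφ hχ] with ω hω ⟨R, hR⟩ ⟨c, hc⟩
    have h1 : Tendsto (fun k => ‖hatLp κ (X k ω)
        - hatLp κ (∑ i ∈ Finset.range (ns (χ k)), s (f i) ω • f i)‖) atTop (nhds 0) := by
      refine squeeze_zero (fun _ => norm_nonneg _) hc ?_
      have := (tendsto_pow_atTop_nhds_zero_of_lt_one (by norm_num : (0 : ℝ) ≤ 1 / 2)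
        (by norm_num)).const_mul c
      rwa [mul_zero] at this
    have h2 := hω.sub (tendsto_sub_of_hatLp (x := fun k => X k ω)
      (y := fun k => ∑ i ∈ Finset.range (ns (χ k)), s (f i) ω • f i) hL hF (Eventually.of_forall hR) h1)
    rw [sub_zero] at h2
    exact h2.congr fun k => sub_sub_cancel _ _
  -- Uniform bounds pass to the limit by Fatou's lemma.
  · have h1 : ∀ᵐ ω ∂P, Φ (V ω) = liminf (fun k => Φ (F (X k ω))) atTop := hV.mono fun ω hω =>
      (((hΦ.tendsto _).comp hω).liminf_eq).symm
    rw [lintegral_congr_ae h1]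
    refine (lintegral_liminf_le' fun k => (hΦ.comp_aestronglyMeasurable
      (hFm (Finset.range (φ k)) e)).aemeasurable).trans ?_
    refine (liminf_le_liminf (Eventually.of_forall fun k => h ℕ e (Finset.range (φ k)) he.1)).trans ?_
    simp

end Value

/-! ### Hölder's inequality and exponential moments of one slice -/

theorem ofReal_exp_rpow (x θ : ℝ) :
    ENNReal.ofReal (Real.exp x) ^ θ = ENNReal.ofReal (Real.exp (θ * x)) := by
  rw [ENNReal.ofReal_rpow_of_pos (Real.exp_pos x), ← Real.exp_mul, mul_comm]

/-- Hölder with exponents `1 / θ i`; the missing weight `1 - ∑ θ i` goes to the constant function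
`1`, whose integral is `1`. Nothing is needed about the joint law of the `Y i`. -/
theorem lintegral_exp_sum_le {Ω : Type*} [MeasurableSpace Ω] {P : Measure Ω} [IsProbabilityMeasure P]
    {ι : Type*} (S : Finset ι) {Y : ι → Ω → ℝ} {θ B : ι → ℝ}
    (hY : ∀ i ∈ S, AEMeasurable (Y i) P) (hθ : ∀ i ∈ S, 0 < θ i) (hsum : ∑ i ∈ S, θ i ≤ 1)
    (hB : ∀ i ∈ S, ∫⁻ ω, ENNReal.ofReal (Real.exp ((θ i)⁻¹ * Y i ω)) ∂P
      ≤ ENNReal.ofReal (Real.exp (B i))) :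
    ∫⁻ ω, ENNReal.ofReal (Real.exp (∑ i ∈ S, Y i ω)) ∂P
      ≤ ENNReal.ofReal (Real.exp (∑ i ∈ S, θ i * B i)) := by
  have h := ENNReal.lintegral_mul_prod_norm_pow_le (μ := P) S (g := fun _ => 1)
    (f := fun i ω => ENNReal.ofReal (Real.exp ((θ i)⁻¹ * Y i ω))) aemeasurable_const
    (fun i hi => ((hY i hi).const_mul _).exp.ennreal_ofReal) (1 - ∑ i ∈ S, θ i) (p := θ)
    (by ring) (by linarith) fun i hi => (hθ i hi).le
  simp only [ENNReal.one_rpow, one_mul, lintegral_const, measure_univ] at h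
  have e1 : ∀ ω, ENNReal.ofReal (Real.exp (∑ i ∈ S, Y i ω))
      = ∏ i ∈ S, ENNReal.ofReal (Real.exp ((θ i)⁻¹ * Y i ω)) ^ θ i := fun ω => by
    rw [Real.exp_sum, ENNReal.ofReal_prod_of_nonneg fun i _ => Real.exp_nonneg _]
    refine Finset.prod_congr rfl fun i hi => ?_
    rw [ofReal_exp_rpow, mul_inv_cancel_left₀ (hθ i hi).ne']
  simp only [e1]
  refine h.trans ?_
  rw [Real.exp_sum, ENNReal.ofReal_prod_of_nonneg fun i _ => Real.exp_nonneg _]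
  refine Finset.prod_le_prod' fun i hi => ?_
  rw [← ofReal_exp_rpow]
  exact ENNReal.rpow_le_rpow (hB i hi) (hθ i hi).le

theorem lintegral_exp_add_le {Ω : Type*} [MeasurableSpace Ω] {P : Measure Ω} {u v : Ω → ℝ} {a b : ℝ}
    (hu : AEMeasurable u P) (hv : AEMeasurable v P)
    (ha : ∫⁻ ω, ENNReal.ofReal (Real.exp (2 * u ω)) ∂P ≤ ENNReal.ofReal (Real.exp a))
    (hb : ∫⁻ ω, ENNReal.ofReal (Real.exp (2 * v ω)) ∂P ≤ ENNReal.ofReal (Real.exp b)) :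
    ∫⁻ ω, ENNReal.ofReal (Real.exp (u ω + v ω)) ∂P ≤ ENNReal.ofReal (Real.exp ((a + b) / 2)) := by
  have h := ENNReal.lintegral_mul_norm_pow_le (μ := P) (p := 1 / 2) (q := 1 / 2)
    ((hu.const_mul 2).exp.ennreal_ofReal) ((hv.const_mul 2).exp.ennreal_ofReal) (by norm_num)
    (by norm_num) (by norm_num)
  have e1 : ∀ ω, ENNReal.ofReal (Real.exp (u ω + v ω))
      = ENNReal.ofReal (Real.exp (2 * u ω)) ^ (1 / 2 : ℝ)
        * ENNReal.ofReal (Real.exp (2 * v ω)) ^ (1 / 2 : ℝ) := fun ω => by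
    rw [ofReal_exp_rpow, ofReal_exp_rpow, ← ENNReal.ofReal_mul (Real.exp_nonneg _), ← Real.exp_add]
    congr 2
    ring
  simp only [e1]
  refine h.trans ?_
  have e2 : ENNReal.ofReal (Real.exp ((a + b) / 2))
      = ENNReal.ofReal (Real.exp a) ^ (1 / 2 : ℝ) * ENNReal.ofReal (Real.exp b) ^ (1 / 2 : ℝ) := by
    rw [ofReal_exp_rpow, ofReal_exp_rpow, ← ENNReal.ofReal_mul (Real.exp_nonneg _), ← Real.exp_add]
    congr 2
    ring
  rw [e2]
  exact mul_le_mul' (ENNReal.rpow_le_rpow ha (by norm_num)) (ENNReal.rpow_le_rpow hb (by norm_num))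

section Slice

variable {M : ℕ} {m : ℝ} {τ υ ρ : ℝ} {lam : ℂ} {t : ℕ → ℝ} {j : ℕ}
  {Ω : Type*} [MeasurableSpace Ω] {P : Measure Ω} [IsProbabilityMeasure P]
  {s : C(Sq, ℝ) → Ω → ℝ}

theorem norm_coupling_le (hρ : 0 < ρ) (hlam : lam ∈ cardioid ρ) :
    ‖2 * Complex.I * sqrtC lam‖ ≤ 2 * √ρ := by
  rw [← abs_of_nonneg (norm_nonneg (2 * Complex.I * sqrtC lam)),
    ← abs_of_nonneg (by positivity : (0 : ℝ) ≤ 2 * √ρ)]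
  refine sq_le_sq.mp ?_
  rw [norm_coupling_sq, mul_pow, Real.sq_sqrt hρ.le]
  linarith [norm_lam_lt hρ hlam]

/-- With `j + 1 ≤ 2^j` the operator norm of the form is at most `τ υ 2^(-j)`. The condition on `b`
says exactly that `32 b` times this is at most `1/4`. It will be used with `b = c ρ`, where `c` is a
Hölder exponent. -/
theorem lintegral_exp_qForm_pairMeasure_le (hM : 2 ≤ M) (hm : 0 < m)
    (hτ : ∀ j, sliceProp M m j 0 0 ≤ τ) (hυ : ∀ j x, ∫ y, sliceProp M m j x y ≤ υ * (1 / 4) ^ j)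
    (hs : IsStdWhiteNoise P s) {ι : Type*} {e : ι → C(Sq, ℝ)} (he : IsOrthonormalFamily e)
    (I : Finset ι) {b : ℝ} (hb : 0 ≤ b) (hbj : b * (τ * υ * 512) ≤ 4 * 2 ^ j) :
    ∫⁻ ω, ENNReal.ofReal (Real.exp (32 * b * qForm (pairMeasure M m j) (∑ i ∈ I, s (e i) ω • e i))) ∂P
      ≤ ENNReal.ofReal (Real.exp (64 * b * (τ ^ 2 * (j + 1)))) := by
  have := isFiniteMeasure_pairMeasure hM hm j
  refine (hs.lintegral_exp_qForm_le he I (pairMeasure M m j) (qForm_pairMeasure_le hM hm hτ hυ j)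
    (by positivity) ?_).trans (ENNReal.ofReal_le_ofReal (Real.exp_le_exp.mpr ?_))
  · have h1 : ((j : ℝ) + 1) ≤ 2 ^ j := by exact_mod_cast Nat.lt_two_pow_self
    have h2 : (2 : ℝ) ^ j * 2 ^ j * (1 / 4) ^ j = 1 := by
      rw [← mul_pow, ← mul_pow]
      norm_num
    calc 32 * b * (τ * υ * ((j + 1) * (1 / 4) ^ j))
        = (b * (τ * υ * 512)) * ((j + 1) * (1 / 4) ^ j) / 16 := by ring
      _ ≤ (4 * 2 ^ j) * (2 ^ j * (1 / 4) ^ j) / 16 := by gcongr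
      _ = 1 / 4 := by linear_combination (1 / 4 : ℝ) * h2
  · have := real_pairMeasure_univ_le hM hm hτ j
    calc 2 * (32 * b) * (pairMeasure M m j).real Set.univ
        = 64 * b * (pairMeasure M m j).real Set.univ := by ring
      _ ≤ _ := by gcongr

theorem lintegral_exp_re_sliceV_le (hM : 2 ≤ M) (hm : 0 < m)
    (hτ : ∀ j, sliceProp M m j 0 0 ≤ τ) (hυ : ∀ j x, ∫ y, sliceProp M m j x y ≤ υ * (1 / 4) ^ j)
    (hρ : 0 < ρ) (hlam : lam ∈ cardioid ρ) (ht : ∀ k, t k ∈ Set.Icc (0 : ℝ) 1)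
    (hs : IsStdWhiteNoise P s) {ι : Type*} {e : ι → C(Sq, ℝ)} (he : IsOrthonormalFamily e)
    (I : Finset ι) {c : ℝ} (hc : 0 ≤ c) (hcj : c * ρ * (τ * υ * 512) ≤ 4 * 2 ^ j) :
    ∫⁻ ω, ENNReal.ofReal (Real.exp (c * (2 * (sliceV M m lam t j (∑ i ∈ I, s (e i) ω • e i)).re))) ∂P
      ≤ ENNReal.ofReal (Real.exp (44 * c * ρ * τ ^ 2 * (j + 1) + 16 * c ^ 2 * ρ * τ ^ 2)) := by
  have := isFiniteMeasure_pairMeasure hM hm j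
  set X : Ω → C(Sq, ℝ) := fun ω => ∑ i ∈ I, s (e i) ω • e i with hX
  set r : ℝ := t j * sliceProp M m j 0 0 with hr
  have hr0 : 0 ≤ r := mul_nonneg (ht j).1 (sliceProp_nonneg hM m j 0 0)
  have hr1 : r ≤ τ := (mul_le_of_le_one_left (sliceProp_nonneg hM m j 0 0) (ht j).2).trans (hτ j)
  set g : ℝ := (2 * Complex.I * sqrtC lam).re * r with hg
  have hg2 : g ^ 2 ≤ 4 * ρ * τ ^ 2 := by
    have h1 : (2 * Complex.I * sqrtC lam).re ^ 2 ≤ 4 * ρ := by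
      rw [← sq_abs]
      refine (pow_le_pow_left₀ (abs_nonneg _) (Complex.abs_re_le_norm _) 2).trans ?_
      rw [norm_coupling_sq]
      linarith [norm_lam_lt hρ hlam]
    rw [hg, mul_pow]
    gcongr
  have hpt : ∀ ω, c * (2 * (sliceV M m lam t j (X ω)).re) ≤ 12 * c * ρ * τ ^ 2 * (j + 1)
      + (2 * c * g * (∫ x, X ω x) + 16 * (c * ρ) * qForm (pairMeasure M m j) (X ω)) := fun ω => by
    have h1 := (Complex.re_le_norm _).trans (norm_sliceV_sub_linear_le hM hm hτ hρ hlam ht j (X ω))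
    rw [Complex.sub_re, Complex.re_mul_ofReal] at h1
    have h2 := mul_le_mul_of_nonneg_left h1 (by positivity : 0 ≤ 2 * c)
    rw [hg, hr]
    linarith
  have hL := hs.lintegral_exp_linear_le he I (2 * (2 * c * g))
  have hQ := lintegral_exp_qForm_pairMeasure_le hM hm hτ hυ hs he I
    (by positivity : 0 ≤ c * ρ) hcj
  have e32 : ∀ q : ℝ, 2 * (16 * (c * ρ) * q) = 32 * (c * ρ) * q := fun q => by ring
  -- Cauchy-Schwarz separates the linear from the quadratic part. It yields `44 = 12 + 64 / 2`, and
  -- `4 c² g² ≤ 16 c² ρ τ²` from the linear part: since this part is centered, its contribution is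
  -- of order `ρ` and not `√ρ`.
  have hCS := lintegral_exp_add_le (u := fun ω => 2 * c * g * (∫ x, X ω x))
    (v := fun ω => 16 * (c * ρ) * qForm (pairMeasure M m j) (X ω))
    (a := (2 * (2 * c * g)) ^ 2 / 2) (b := 64 * (c * ρ) * (τ ^ 2 * (j + 1)))
    ((hs.aemeasurable_linear e I).const_mul _)
    (((continuous_qForm _).comp_aestronglyMeasurable
      (hs.aestronglyMeasurable_sum I e)).aemeasurable.const_mul _)
    (by simpa only [mul_assoc] using hL) (by simpa only [e32] using hQ)
  calc ∫⁻ ω, ENNReal.ofReal (Real.exp (c * (2 * (sliceV M m lam t j (X ω)).re))) ∂P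
      ≤ ∫⁻ ω, ENNReal.ofReal (Real.exp (12 * c * ρ * τ ^ 2 * (j + 1)))
        * ENNReal.ofReal (Real.exp (2 * c * g * (∫ x, X ω x)
          + 16 * (c * ρ) * qForm (pairMeasure M m j) (X ω))) ∂P := by
        refine lintegral_mono fun ω => ?_
        rw [← ENNReal.ofReal_mul (Real.exp_nonneg _), ← Real.exp_add]
        exact ENNReal.ofReal_le_ofReal (Real.exp_le_exp.mpr (hpt ω))
    _ ≤ ENNReal.ofReal (Real.exp (12 * c * ρ * τ ^ 2 * (j + 1)))
        * ENNReal.ofReal (Real.exp (((2 * (2 * c * g)) ^ 2 / 2 + 64 * (c * ρ) * (τ ^ 2 * (j + 1))) / 2)) := by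
        rw [lintegral_const_mul' _ _ ENNReal.ofReal_ne_top]
        gcongr
    _ ≤ _ := by
        rw [← ENNReal.ofReal_mul (Real.exp_nonneg _), ← Real.exp_add]
        refine ENNReal.ofReal_le_ofReal (Real.exp_le_exp.mpr ?_)
        have := mul_le_mul_of_nonneg_left hg2 (sq_nonneg c)
        nlinarith

/-- The argument for the real part applies with the absolute value of the linear term, which is no
longer centered. The price is the extra `1` in the exponent, independent of `ρ`; Hölder weights
proportional to `√ρ` will later reduce it. -/
theorem lintegral_exp_norm_sliceV_le (hM : 2 ≤ M) (hm : 0 < m)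
    (hτ : ∀ j, sliceProp M m j 0 0 ≤ τ) (hυ : ∀ j x, ∫ y, sliceProp M m j x y ≤ υ * (1 / 4) ^ j)
    (hρ : 0 < ρ) (hlam : lam ∈ cardioid ρ) (ht : ∀ k, t k ∈ Set.Icc (0 : ℝ) 1)
    (hs : IsStdWhiteNoise P s) {ι : Type*} {e : ι → C(Sq, ℝ)} (he : IsOrthonormalFamily e)
    (I : Finset ι) {c : ℝ} (hc : 0 ≤ c) (hcj : c * ρ * (τ * υ * 512) ≤ 4 * 2 ^ j) :
    ∫⁻ ω, ENNReal.ofReal (Real.exp (c * (2 * ‖sliceV M m lam t j (∑ i ∈ I, s (e i) ω • e i)‖))) ∂P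
      ≤ ENNReal.ofReal (Real.exp (44 * c * ρ * τ ^ 2 * (j + 1) + 1 + 16 * c ^ 2 * ρ * τ ^ 2)) := by
  have := isFiniteMeasure_pairMeasure hM hm j
  set X : Ω → C(Sq, ℝ) := fun ω => ∑ i ∈ I, s (e i) ω • e i with hX
  set r : ℝ := t j * sliceProp M m j 0 0 with hr
  have hr0 : 0 ≤ r := mul_nonneg (ht j).1 (sliceProp_nonneg hM m j 0 0)
  have hr1 : r ≤ τ := (mul_le_of_le_one_left (sliceProp_nonneg hM m j 0 0) (ht j).2).trans (hτ j)
  have hpt : ∀ ω, c * (2 * ‖sliceV M m lam t j (X ω)‖) ≤ 12 * c * ρ * τ ^ 2 * (j + 1)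
      + (4 * c * √ρ * τ * |∫ x, X ω x| + 16 * (c * ρ) * qForm (pairMeasure M m j) (X ω)) := fun ω => by
    have h1 := norm_sliceV_sub_linear_le hM hm hτ hρ hlam ht j (X ω)
    have h2 := norm_sub_norm_le (sliceV M m lam t j (X ω))
      (2 * Complex.I * sqrtC lam * ((r * ∫ x, X ω x : ℝ) : ℂ))
    have h3 : ‖2 * Complex.I * sqrtC lam * ((r * ∫ x, X ω x : ℝ) : ℂ)‖
        ≤ 2 * √ρ * (τ * |∫ x, X ω x|) := by
      rw [norm_mul, Complex.norm_real, Real.norm_eq_abs, abs_mul, abs_of_nonneg hr0]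
      gcongr
      exact norm_coupling_le hρ hlam
    have h4 : ‖sliceV M m lam t j (X ω)‖ ≤ 2 * √ρ * (τ * |∫ x, X ω x|)
        + ρ * (6 * τ ^ 2 * (j + 1) + 8 * qForm (pairMeasure M m j) (X ω)) := by linarith
    have h5 := mul_le_mul_of_nonneg_left h4 (by positivity : 0 ≤ 2 * c)
    linarith
  -- The prefactor `2` is absorbed into `exp 2`, which Cauchy-Schwarz turns into the summand `1`.
  have hL := (hs.lintegral_exp_abs_linear_le he I (2 * (4 * c * √ρ * τ))).trans
    (ENNReal.ofReal_le_ofReal (q := Real.exp (2 + (2 * (4 * c * √ρ * τ)) ^ 2 / 2)) (by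
      rw [Real.exp_add]
      gcongr
      have := Real.add_one_le_exp 2
      linarith))
  have hQ := lintegral_exp_qForm_pairMeasure_le hM hm hτ hυ hs he I
    (by positivity : 0 ≤ c * ρ) hcj
  have e32 : ∀ q : ℝ, 2 * (16 * (c * ρ) * q) = 32 * (c * ρ) * q := fun q => by ring
  have hCS := lintegral_exp_add_le (u := fun ω => 4 * c * √ρ * τ * |∫ x, X ω x|)
    (v := fun ω => 16 * (c * ρ) * qForm (pairMeasure M m j) (X ω))
    (a := 2 + (2 * (4 * c * √ρ * τ)) ^ 2 / 2) (b := 64 * (c * ρ) * (τ ^ 2 * (j + 1)))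
    ((continuous_abs.measurable.comp_aemeasurable (hs.aemeasurable_linear e I)).const_mul _)
    (((continuous_qForm _).comp_aestronglyMeasurable
      (hs.aestronglyMeasurable_sum I e)).aemeasurable.const_mul _)
    (by simpa only [mul_assoc] using hL) (by simpa only [e32] using hQ)
  calc ∫⁻ ω, ENNReal.ofReal (Real.exp (c * (2 * ‖sliceV M m lam t j (X ω)‖))) ∂P
      ≤ ∫⁻ ω, ENNReal.ofReal (Real.exp (12 * c * ρ * τ ^ 2 * (j + 1)))
        * ENNReal.ofReal (Real.exp (4 * c * √ρ * τ * |∫ x, X ω x|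
          + 16 * (c * ρ) * qForm (pairMeasure M m j) (X ω))) ∂P := by
        refine lintegral_mono fun ω => ?_
        rw [← ENNReal.ofReal_mul (Real.exp_nonneg _), ← Real.exp_add]
        exact ENNReal.ofReal_le_ofReal (Real.exp_le_exp.mpr (hpt ω))
    _ ≤ ENNReal.ofReal (Real.exp (12 * c * ρ * τ ^ 2 * (j + 1)))
        * ENNReal.ofReal (Real.exp ((2 + (2 * (4 * c * √ρ * τ)) ^ 2 / 2
          + 64 * (c * ρ) * (τ ^ 2 * (j + 1))) / 2)) := by
        rw [lintegral_const_mul' _ _ ENNReal.ofReal_ne_top]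
        gcongr
    _ ≤ _ := by
        rw [← ENNReal.ofReal_mul (Real.exp_nonneg _), ← Real.exp_add]
        refine ENNReal.ofReal_le_ofReal (Real.exp_le_exp.mpr (le_of_eq ?_))
        linear_combination (16 * c ^ 2 * τ ^ 2) * Real.sq_sqrt hρ.le

end Slice

/-! ### Sets of scales and Hölder weights -/

/-- The sum of `n` distinct naturals is at least `0 + 1 + ⋯ + (n - 1)`. Inserting a new maximum
works because it is at least the number of the previous elements. -/
theorem card_mul_card_sub_one_le (U : Finset ℕ) :
    (U.card : ℝ) * (U.card - 1) ≤ 2 * ∑ j ∈ U, (j : ℝ) := by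
  induction U using Finset.induction_on_max with
  | empty => simp
  | insert a U h ih =>
    have ha : a ∉ U := fun h' => lt_irrefl _ (h a h')
    have hc : (U.card : ℝ) ≤ a := by
      have : U ⊆ Finset.range a := fun x hx => Finset.mem_range.mpr (h x hx)
      exact_mod_cast (Finset.card_le_card this).trans (Finset.card_range a).le
    rw [Finset.card_insert_of_notMem ha, Finset.sum_insert ha]
    push_cast
    linarith

theorem card_le_two_mul_max (U : Finset ℕ) : (U.card : ℝ) ≤ 2 * max 1 (∑ j ∈ U, (j : ℝ)) := by
  have h := card_mul_card_sub_one_le U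
  have h1 := le_max_left 1 (∑ j ∈ U, (j : ℝ))
  have h2 := le_max_right 1 (∑ j ∈ U, (j : ℝ))
  rcases le_or_gt (U.card : ℝ) 2 with h3 | h3
  · linarith
  · nlinarith

theorem card_sq_le_four_mul_max (U : Finset ℕ) :
    (U.card : ℝ) ^ 2 ≤ 4 * max 1 (∑ j ∈ U, (j : ℝ)) := by
  have h := card_mul_card_sub_one_le U
  have h1 := le_max_left 1 (∑ j ∈ U, (j : ℝ))
  have h2 := le_max_right 1 (∑ j ∈ U, (j : ℝ))
  rcases le_or_gt (U.card : ℝ) 2 with h3 | h3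
  · nlinarith [Nat.cast_nonneg (α := ℝ) U.card]
  · nlinarith

/-- The Hölder weight of the scale `j` in the set of scales `U`. -/
def scaleWeight (U : Finset ℕ) (j : ℕ) : ℝ := (2 * (U.card : ℝ))⁻¹ + (1 / 4) * (1 / 2) ^ j

theorem scaleWeight_pos (U : Finset ℕ) (j : ℕ) : 0 < scaleWeight U j := by
  unfold scaleWeight
  positivity

theorem sum_scaleWeight_le (U : Finset ℕ) : ∑ j ∈ U, scaleWeight U j ≤ 1 := by
  simp only [scaleWeight]
  rw [Finset.sum_add_distrib, ← Finset.mul_sum, Finset.sum_const, nsmul_eq_mul]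
  have h1 : ∑ j ∈ U, (1 / 2 : ℝ) ^ j ≤ 2 :=
    (summable_geometric_two.sum_le_tsum U fun i _ => by positivity).trans tsum_geometric_two.le
  have h2 : (U.card : ℝ) * (2 * (U.card : ℝ))⁻¹ ≤ 1 / 2 := by
    -- For empty `U` the convention `0⁻¹ = 0` makes the product vanish.
    rcases eq_or_ne (U.card : ℝ) 0 with h | h
    · rw [h]; norm_num
    · exact le_of_eq (by field_simp)
  linarith

theorem inv_scaleWeight_le_two_mul_card {U : Finset ℕ} {j : ℕ} (hj : j ∈ U) :
    (scaleWeight U j)⁻¹ ≤ 2 * U.card := by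
  have h : 0 < (U.card : ℝ) := by exact_mod_cast Finset.card_pos.mpr ⟨j, hj⟩
  rw [inv_le_comm₀ (scaleWeight_pos U j) (by positivity), scaleWeight]
  linarith [(by positivity : (0 : ℝ) ≤ 1 / 4 * (1 / 2) ^ j)]

theorem inv_scaleWeight_le (U : Finset ℕ) (j : ℕ) : (scaleWeight U j)⁻¹ ≤ 4 * 2 ^ j := by
  rw [inv_le_comm₀ (scaleWeight_pos U j) (by positivity), scaleWeight]
  have : (4 * (2 : ℝ) ^ j)⁻¹ = 1 / 4 * (1 / 2) ^ j := by
    rw [mul_inv, one_div_pow, one_div, one_div]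
  rw [this]
  linarith [(by positivity : (0 : ℝ) ≤ (2 * (U.card : ℝ))⁻¹)]

/-- Let `m` be the maximum. The sum of the `j + 1` is at most `3 m`, the weights sum to at most `1`,
and their inverses to at most `2 |U|² ≤ 8 m`; hence `261 = 44 · 3 + 1 + 16 · 8`. -/
theorem sum_exponent_le {τ : ℝ} (hτ1 : 1 ≤ τ) (U : Finset ℕ) :
    ∑ j ∈ U, (44 * τ ^ 2 * ((j : ℝ) + 1) + scaleWeight U j + 16 * τ ^ 2 * (scaleWeight U j)⁻¹)
      ≤ 261 * τ ^ 2 * max 1 (∑ j ∈ U, (j : ℝ)) := by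
  have h1 := le_max_left 1 (∑ j ∈ U, (j : ℝ))
  have h2 := le_max_right 1 (∑ j ∈ U, (j : ℝ))
  have h3 : ∑ j ∈ U, (scaleWeight U j)⁻¹ ≤ 8 * max 1 (∑ j ∈ U, (j : ℝ)) := by
    refine (Finset.sum_le_sum fun j hj => inv_scaleWeight_le_two_mul_card hj).trans ?_
    rw [Finset.sum_const, nsmul_eq_mul]
    linarith [card_sq_le_four_mul_max U]
  rw [Finset.sum_add_distrib, Finset.sum_add_distrib, ← Finset.mul_sum, ← Finset.mul_sum,
    Finset.sum_add_distrib]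
  simp only [Finset.sum_const, nsmul_eq_mul, mul_one]
  set m := max 1 (∑ j ∈ U, (j : ℝ))
  have hτ2 : 1 ≤ τ ^ 2 := one_le_pow₀ hτ1
  have h4 : ∑ j ∈ U, (j : ℝ) + U.card ≤ 3 * m := by linarith [card_le_two_mul_max U]
  have h5 := mul_le_mul_of_nonneg_left h4 (by positivity : 0 ≤ 44 * τ ^ 2)
  have h6 := mul_le_mul_of_nonneg_left h3 (by positivity : 0 ≤ 16 * τ ^ 2)
  have h7 := sum_scaleWeight_le U
  have h8 : 1 ≤ τ ^ 2 * m := by nlinarith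
  linarith

/-- The square root would even give `exp (x / 2)`; since `0 ≤ x`, the factor is given away. -/
theorem rpow_half_le_of_lintegral_le {Ω : Type*} [MeasurableSpace Ω] {P : Measure Ω} {Z : Ω → ℝ} {x : ℝ}
    (hZ : AEStronglyMeasurable Z P) (hx : 0 ≤ x)
    (h : ∫⁻ ω, ENNReal.ofReal (Real.exp (Z ω)) ∂P ≤ ENNReal.ofReal (Real.exp x)) :
    Integrable (fun ω => Real.exp (Z ω)) P ∧ (∫ ω, Real.exp (Z ω) ∂P) ^ (1 / 2 : ℝ) ≤ Real.exp x := by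
  have hm : AEStronglyMeasurable (fun ω => Real.exp (Z ω)) P :=
    Real.continuous_exp.comp_aestronglyMeasurable hZ
  have h0 : 0 ≤ᵐ[P] fun ω => Real.exp (Z ω) := Eventually.of_forall fun ω => Real.exp_nonneg _
  refine ⟨⟨hm, ?_⟩, ?_⟩
  · rw [hasFiniteIntegral_iff_ofReal h0]
    exact h.trans_lt ENNReal.ofReal_lt_top
  · have h1 : ∫ ω, Real.exp (Z ω) ∂P ≤ Real.exp x := by
      rw [integral_eq_lintegral_of_nonneg_ae h0 hm]
      exact ENNReal.toReal_le_of_le_ofReal (Real.exp_nonneg _) h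
    refine (Real.rpow_le_rpow (integral_nonneg fun ω => Real.exp_nonneg _) h1 (by norm_num)).trans ?_
    rw [← Real.exp_mul]
    exact Real.exp_le_exp.mpr (by linarith)

theorem sum_sigma_eq_sum_biUnion {n : ℕ} {J : Fin n → Finset ℕ}
    (hJ : ∀ a b, a ≠ b → Disjoint (J a) (J b)) (f : ℕ → ℝ) :
    ∑ i ∈ Finset.univ.sigma J, f i.2 = ∑ j ∈ Finset.univ.biUnion J, f j := by
  rw [Finset.sum_sigma, Finset.sum_biUnion fun a _ b _ hab => hJ a b hab]

end PhiFour

end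

/-! ### Assembly of the two bounds -/

open PhiFour

theorem theorem2 (M : ℕ) (hM : 2 ≤ M) (m : ℝ) (hm : 0 < m) :
    ∃ ρ₀ : ℝ, 0 < ρ₀ ∧ ∃ K : ℝ, 0 < K ∧
      ∀ ρ : ℝ, 0 < ρ → ρ ≤ ρ₀ → ∀ lam ∈ PhiFour.cardioid ρ,
      -- a block with vertices `Fin n`, its tree, the parameters `w`, the scale sets `J_a`
      ∀ (n : ℕ) (F : SimpleGraph (Fin n)), F.IsTree →
      ∀ w : Sym2 (Fin n) → ℝ, (∀ e ∈ F.edgeSet, w e ∈ Set.Icc (0 : ℝ) 1) →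
      ∀ J : Fin n → Finset ℕ, (∀ a b, a ≠ b → Disjoint (J a) (J b)) →
      -- `t j k` is the weight of the slice `k` inside `V_j`
      ∀ t : ℕ → ℕ → ℝ, (∀ j k, t j k ∈ Set.Icc (0 : ℝ) 1) →
      ∀ (Ω : Type*) [MeasurableSpace Ω] (P : MeasureTheory.Measure Ω)
        [MeasureTheory.IsProbabilityMeasure P] (σ : Fin n → C(PhiFour.Sq, ℝ) → Ω → ℝ),
      PhiFour.IsWhiteNoise P (PhiFour.forestCov F w) σ →
      ∃ V : Fin n → ℕ → Ω → ℂ,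
        (∀ a, ∀ j ∈ J a,
          PhiFour.IsValueAt P (PhiFour.sliceV M m lam (t j) j) (σ a) (V a j)) ∧
        MeasureTheory.Integrable
          (fun ω => ∏ a, ∏ j ∈ J a, ‖Complex.exp (V a j ω)‖ ^ 2) P ∧
        (∫ ω, ∏ a, ∏ j ∈ J a, ‖Complex.exp (V a j ω)‖ ^ 2 ∂P) ^ (1 / 2 : ℝ) ≤
          Real.exp (K * ρ * max 1 (∑ j ∈ Finset.univ.biUnion J, (j : ℝ))) ∧
        MeasureTheory.Integrable
          (fun ω => Real.exp (2 * ∑ a, ∑ j ∈ J a, ‖V a j ω‖)) P ∧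
        (∫ ω, Real.exp (2 * ∑ a, ∑ j ∈ J a, ‖V a j ω‖) ∂P) ^ (1 / 2 : ℝ) ≤
          Real.exp (K * √ρ * max 1 (∑ j ∈ Finset.univ.biUnion J, (j : ℝ))) := by
  obtain ⟨τ, hτ1, hτ⟩ := exists_tadpole_bound hM hm
  obtain ⟨υ, hυ1, hυ⟩ := exists_integral_sliceProp_bound hM hm
  have hτυ : 1 ≤ τ * υ * 512 := by nlinarith
  -- The choice of `ρ₀` makes `√ρ * (τ * υ * 512) ≤ 1`. The square is forced by the second bound,
  -- where the product of the Hölder exponent and `ρ` is of order `√ρ`.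
  refine ⟨(τ * υ * 512)⁻¹ ^ 2, by positivity, 261 * τ ^ 2, by positivity, ?_⟩
  intro ρ hρ hρ0 lam hlam n F _ w _ J hJ t ht Ω _ P _ σ hσ
  have hsqrt : √ρ * (τ * υ * 512) ≤ 1 := by
    have h := Real.sqrt_le_sqrt hρ0
    rw [Real.sqrt_sq (by positivity)] at h
    calc √ρ * (τ * υ * 512) ≤ (τ * υ * 512)⁻¹ * (τ * υ * 512) := by gcongr
      _ = 1 := inv_mul_cancel₀ (by positivity)
  have hsqrt_pos : 0 < √ρ := Real.sqrt_pos.mpr hρ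
  have hsqrt1 : √ρ ≤ 1 := (le_mul_of_one_le_right hsqrt_pos.le hτυ).trans hsqrt
  have hsq : √ρ * √ρ = ρ := Real.mul_self_sqrt hρ.le
  have hρle : ρ ≤ √ρ := by nlinarith
  have hs : ∀ a, IsStdWhiteNoise P (σ a) := fun a => hσ.isStdWhiteNoise a
  have hex : ∀ a j, ∃ V : Ω → ℂ, IsValueAt P (sliceV M m lam (t j) j) (σ a) V ∧
      ∀ (Φ : ℂ → ENNReal) (B : ENNReal), Continuous Φ →
      (∀ (ι : Type) (e : ι → C(Sq, ℝ)) (I : Finset ι), IsOrthonormalFamily e →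
        ∫⁻ ω, Φ (sliceV M m lam (t j) j (∑ i ∈ I, σ a (e i) ω • e i)) ∂P ≤ B) →
          ∫⁻ ω, Φ (V ω) ∂P ≤ B := fun a j => by
    obtain ⟨L, hL, hlip⟩ := sliceV_lipschitz hM hm hlam (fun k => (ht j k).1) j
    have := isFiniteMeasure_controlMeasure hM hm (t j) j
    exact (hs a).exists_isValueAt hL hlip
  choose V hV hVΦ using hex
  set U := Finset.univ.biUnion J with hU
  have hVm : ∀ a j, AEMeasurable (V a j) P := fun a j => (hV a j).1.aemeasurable
  have hw0 : ∀ j, 0 < scaleWeight U j := scaleWeight_pos U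
  have hinv : ∀ j, (scaleWeight U j * √ρ)⁻¹ * ρ = (scaleWeight U j)⁻¹ * √ρ := fun j => by
    rw [mul_inv, mul_assoc]
    congr 1
    rw [inv_mul_eq_iff_eq_mul₀ hsqrt_pos.ne', hsq]
  -- As the `J a` are disjoint, each scale of `U` occurs at exactly one vertex, and weights that
  -- depend on the scale alone are admissible.
  have hsum1 : ∑ i ∈ Finset.univ.sigma J, scaleWeight U i.2 ≤ 1 := by
    rw [sum_sigma_eq_sum_biUnion hJ]
    exact sum_scaleWeight_le U
  have hre : ∫⁻ ω, ENNReal.ofReal (Real.exp (∑ i ∈ Finset.univ.sigma J, 2 * (V i.1 i.2 ω).re)) ∂P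
      ≤ ENNReal.ofReal (Real.exp (261 * τ ^ 2 * ρ * max 1 (∑ j ∈ U, (j : ℝ)))) := by
    refine (lintegral_exp_sum_le _ (θ := fun i => scaleWeight U i.2)
      (B := fun i => 44 * (scaleWeight U i.2)⁻¹ * ρ * τ ^ 2 * ((i.2 : ℝ) + 1)
        + 16 * (scaleWeight U i.2)⁻¹ ^ 2 * ρ * τ ^ 2)
      (fun i _ => (Complex.measurable_re.comp_aemeasurable (hVm i.1 i.2)).const_mul 2)
      (fun i _ => hw0 i.2) hsum1 fun i _ => ?_).trans ?_
    · refine hVΦ i.1 i.2 (fun z => ENNReal.ofReal (Real.exp ((scaleWeight U i.2)⁻¹ * (2 * z.re)))) _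
        (ENNReal.continuous_ofReal.comp (by fun_prop)) fun ι e I he => ?_
      refine lintegral_exp_re_sliceV_le hM hm hτ hυ hρ hlam (ht i.2) (hs i.1) he I
        (inv_nonneg.mpr (hw0 i.2).le) ?_
      calc (scaleWeight U i.2)⁻¹ * ρ * (τ * υ * 512)
          = (scaleWeight U i.2)⁻¹ * (ρ * (τ * υ * 512)) := by ring
        _ ≤ 4 * 2 ^ i.2 * 1 := mul_le_mul (inv_scaleWeight_le U i.2)
            ((mul_le_mul_of_nonneg_right hρle (by positivity)).trans hsqrt) (by positivity)
            (by positivity)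
        _ = _ := mul_one _
    · refine ENNReal.ofReal_le_ofReal (Real.exp_le_exp.mpr ?_)
      rw [sum_sigma_eq_sum_biUnion hJ fun j => scaleWeight U j
        * (44 * (scaleWeight U j)⁻¹ * ρ * τ ^ 2 * ((j : ℝ) + 1)
          + 16 * (scaleWeight U j)⁻¹ ^ 2 * ρ * τ ^ 2)]
      calc ∑ j ∈ U, scaleWeight U j * (44 * (scaleWeight U j)⁻¹ * ρ * τ ^ 2 * ((j : ℝ) + 1)
            + 16 * (scaleWeight U j)⁻¹ ^ 2 * ρ * τ ^ 2)
          ≤ ∑ j ∈ U, ρ * (44 * τ ^ 2 * ((j : ℝ) + 1) + scaleWeight U j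
            + 16 * τ ^ 2 * (scaleWeight U j)⁻¹) := by
            refine Finset.sum_le_sum fun j _ => ?_
            have h1 : scaleWeight U j * (scaleWeight U j)⁻¹ = 1 := mul_inv_cancel₀ (hw0 j).ne'
            have h2 : 0 ≤ ρ * scaleWeight U j := mul_nonneg hρ.le (hw0 j).le
            linear_combination (44 * ρ * τ ^ 2 * ((j : ℝ) + 1)
              + 16 * ρ * τ ^ 2 * (scaleWeight U j)⁻¹) * h1 + h2
        _ ≤ ρ * (261 * τ ^ 2 * max 1 (∑ j ∈ U, (j : ℝ))) := by
            rw [← Finset.mul_sum]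
            exact mul_le_mul_of_nonneg_left (sum_exponent_le hτ1 U) hρ.le
        _ = _ := by ring
  have hnorm : ∫⁻ ω, ENNReal.ofReal (Real.exp (∑ i ∈ Finset.univ.sigma J, 2 * ‖V i.1 i.2 ω‖)) ∂P
      ≤ ENNReal.ofReal (Real.exp (261 * τ ^ 2 * √ρ * max 1 (∑ j ∈ U, (j : ℝ)))) := by
    -- The factor `√ρ` balances two effects: the additive `1` in each exponent is multiplied by it,
    -- while the linear part, of order `ρ`, is divided by it.
    refine (lintegral_exp_sum_le _ (θ := fun i => scaleWeight U i.2 * √ρ)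
      (B := fun i => 44 * (scaleWeight U i.2 * √ρ)⁻¹ * ρ * τ ^ 2 * ((i.2 : ℝ) + 1) + 1
        + 16 * (scaleWeight U i.2 * √ρ)⁻¹ ^ 2 * ρ * τ ^ 2)
      (fun i _ => (hVm i.1 i.2).norm.const_mul 2)
      (fun i _ => mul_pos (hw0 i.2) hsqrt_pos) ?_ fun i _ => ?_).trans ?_
    · rw [← Finset.sum_mul]
      exact mul_le_one₀ hsum1 hsqrt_pos.le hsqrt1
    · refine hVΦ i.1 i.2 (fun z => ENNReal.ofReal (Real.exp ((scaleWeight U i.2 * √ρ)⁻¹ * (2 * ‖z‖)))) _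
        (ENNReal.continuous_ofReal.comp (by fun_prop)) fun ι e I he => ?_
      refine lintegral_exp_norm_sliceV_le hM hm hτ hυ hρ hlam (ht i.2) (hs i.1) he I
        (inv_nonneg.mpr (mul_pos (hw0 i.2) hsqrt_pos).le) ?_
      calc (scaleWeight U i.2 * √ρ)⁻¹ * ρ * (τ * υ * 512)
          = (scaleWeight U i.2)⁻¹ * (√ρ * (τ * υ * 512)) := by
            rw [hinv]
            ring
        _ ≤ 4 * 2 ^ i.2 * 1 := mul_le_mul (inv_scaleWeight_le U i.2) hsqrt (by positivity) (by positivity)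
        _ = _ := mul_one _
    · refine ENNReal.ofReal_le_ofReal (Real.exp_le_exp.mpr ?_)
      rw [sum_sigma_eq_sum_biUnion hJ fun j => scaleWeight U j * √ρ
        * (44 * (scaleWeight U j * √ρ)⁻¹ * ρ * τ ^ 2 * ((j : ℝ) + 1) + 1
          + 16 * (scaleWeight U j * √ρ)⁻¹ ^ 2 * ρ * τ ^ 2)]
      calc ∑ j ∈ U, scaleWeight U j * √ρ * (44 * (scaleWeight U j * √ρ)⁻¹ * ρ * τ ^ 2 * ((j : ℝ) + 1)
            + 1 + 16 * (scaleWeight U j * √ρ)⁻¹ ^ 2 * ρ * τ ^ 2)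
          ≤ ∑ j ∈ U, √ρ * (44 * τ ^ 2 * ((j : ℝ) + 1) + scaleWeight U j
            + 16 * τ ^ 2 * (scaleWeight U j)⁻¹) := by
            refine Finset.sum_le_sum fun j _ => ?_
            have h1 : (scaleWeight U j * √ρ) * (scaleWeight U j * √ρ)⁻¹ = 1 :=
              mul_inv_cancel₀ (mul_pos (hw0 j) hsqrt_pos).ne'
            have h3 : 0 ≤ (√ρ - ρ) * (44 * τ ^ 2 * ((j : ℝ) + 1)) :=
              mul_nonneg (sub_nonneg.mpr hρle) (by positivity)
            linear_combination (44 * ρ * τ ^ 2 * ((j : ℝ) + 1)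
              + 16 * ρ * τ ^ 2 * (scaleWeight U j * √ρ)⁻¹) * h1 + 16 * τ ^ 2 * hinv j + h3
        _ ≤ √ρ * (261 * τ ^ 2 * max 1 (∑ j ∈ U, (j : ℝ))) := by
            rw [← Finset.mul_sum]
            exact mul_le_mul_of_nonneg_left (sum_exponent_le hτ1 U) hsqrt_pos.le
        _ = _ := by ring
  have hmax : (0 : ℝ) ≤ max 1 (∑ j ∈ U, (j : ℝ)) := zero_le_one.trans (le_max_left _ _)
  have h1 := rpow_half_le_of_lintegral_le (Finset.aestronglyMeasurable_fun_sum _ fun i _ =>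
    ((Complex.measurable_re.comp_aemeasurable (hVm i.1 i.2)).const_mul 2).aestronglyMeasurable)
    (by positivity) hre
  have h2 := rpow_half_le_of_lintegral_le (Finset.aestronglyMeasurable_fun_sum _ fun i _ =>
    ((hVm i.1 i.2).norm.const_mul 2).aestronglyMeasurable) (by positivity) hnorm
  have e1 : ∀ ω, ∏ a, ∏ j ∈ J a, ‖Complex.exp (V a j ω)‖ ^ 2
      = Real.exp (∑ i ∈ Finset.univ.sigma J, 2 * (V i.1 i.2 ω).re) := fun ω => by
    rw [Finset.sum_sigma, Real.exp_sum]
    refine Finset.prod_congr rfl fun a _ => ?_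
    rw [Real.exp_sum]
    refine Finset.prod_congr rfl fun j _ => ?_
    rw [Complex.norm_exp, ← Real.exp_nat_mul, Nat.cast_ofNat]
  have e2 : ∀ ω, 2 * ∑ a, ∑ j ∈ J a, ‖V a j ω‖
      = ∑ i ∈ Finset.univ.sigma J, 2 * ‖V i.1 i.2 ω‖ := fun ω => by
    rw [Finset.sum_sigma, Finset.mul_sum]
    exact Finset.sum_congr rfl fun a _ => Finset.mul_sum _ _ _
  refine ⟨V, fun a j _ => hV a j, ?_⟩
  simp only [e1, e2]
  exact ⟨h1.1, h1.2, h2.1, h2.2⟩
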